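/- Let $P_n$ denote the path on $n$ vertices. Given graphs $G_1,\dots,G_t$, consider the following game between Builder and Painter, which starts with the empty graph on an infinite vertex set. In each round Builder draws an edge between two distinct nonadjacent vertices, and Painter immediately gives it one of the colours $1,\dots,t$. Builder wins as soon as, for some $i$, there is a copy of $G_i$ (as a not necessarily induced subgraph) all of whose edges have colour $i$. The online Ramsey number $\tilde r(G_1,\dots,G_t)$ is the minimum number of rounds within which Builder can guarantee a win. **Theorem.** For every integer $\ell\ge 2$, \[ \tilde r(P_3,P_3,P_\ell)=\begin{cases}3\ell/2-1, & \text{if } \ell\equiv 0 \pmod 4 \text{ and } \ell\ge 8,\\ \lfloor 3\ell/2\rfloor, & \text{otherwise.}\end{cases} \] -/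

import Mathlib

/-- A finite graph, given as a simple graph on the vertex set `Fin n` for some `n`. -/
abbrev FinGraph : Type := Σ n : ℕ, SimpleGraph (Fin n)

/-- The path `P_n` on `n` vertices. -/
abbrev pathP (n : ℕ) : FinGraph := ⟨n, SimpleGraph.pathGraph n⟩

/-- A position of the `t`-colour game, played on the infinite vertex set `ℕ`: `P i` is the graph
formed by the edges that have been drawn so far and have received colour `i`. -/
abbrev Position (t : ℕ) : Type := Fin t → SimpleGraph ℕ

/-- The starting position: no edge has been drawn. -/
def emptyPosition (t : ℕ) : Position t := fun _ => ⊥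

/-- Builder may draw the edge `uv` iff `u` and `v` are distinct and nonadjacent (in all colours). -/
def LegalMove {t : ℕ} (P : Position t) (u v : ℕ) : Prop :=
  u ≠ v ∧ ∀ i, ¬ (P i).Adj u v

/-- The position after the edge `uv` has been drawn and coloured with colour `c`. -/
def paintEdge {t : ℕ} (P : Position t) (u v : ℕ) (c : Fin t) : Position t :=
  Function.update P c (P c ⊔ SimpleGraph.edge u v)

/-- Builder has won: for some colour `i` there is a copy of `G i` (as a subgraph, not necessarily
induced) all of whose edges have colour `i`. -/
def BuilderHasWon {t : ℕ} (G : Fin t → FinGraph) (P : Position t) : Prop :=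
  ∃ i, (G i).2.IsContained (P i)

/-- From the position `P`, Builder can guarantee a win within at most `n` further rounds, whatever
Painter does. -/
def BuilderForces {t : ℕ} (G : Fin t → FinGraph) : ℕ → Position t → Prop
  | 0, P => BuilderHasWon G P
  | n + 1, P => BuilderHasWon G P ∨
      ∃ u v : ℕ, LegalMove P u v ∧ ∀ c : Fin t, BuilderForces G n (paintEdge P u v c)

/-- The online Ramsey number of `G 0, …, G (t - 1)`: the minimum number of rounds in which Builder
can guarantee a win starting from the empty graph (`⊤` if there is no such number). -/
noncomputable def onlineRamsey {t : ℕ} (G : Fin t → FinGraph) : ℕ∞ :=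
  ⨅ (n : ℕ) (_ : BuilderForces G n (emptyPosition t)), (n : ℕ∞)

/-! ### Positions of the three-colour game -/

/-! Colours 0 and 1 are the side colours, colour 2 is the path colour. Painter can keep both side
colours matchings, so Builder must produce the long path in colour 2, and the question is how many
side-coloured edges have to be paid for besides the l - 1 edges of that path.

Lower bound. If Painter uses the path colour only when each side colour is present at an end of the
edge, then the vertices meeting a given side colour form a vertex cover of the final path. Such a
cover has at least ⌊l/2⌋ vertices and an edge supplies two of them, so each side colour has at least
⌈⌊l/2⌋/2⌉ edges (`greedy_won`). This is enough unless l = 4, where a short case analysis gains one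
edge (`greedy_four`), or l = 4k + 1. In the latter case Painter uses a side colour exactly when the
two ends carry at most one side-coloured edge in total. Path edges then have weight at least 2, and
with only 2k side edges the weights along the path would be 0, 2, 0, …, 2, 0 with weight 0
elsewhere. But this Painter always keeps a vertex of weight 1 (`forest_won`).

Upper bound. Builder lengthens a path with a fresh end e, by induction on the number i of missing
vertices, at a rate of three rounds for two vertices. An edge from e to a new vertex either is
progress at once or starts an alternating run of side-coloured edges. Inner vertices of the run meet
both side colours, so Painter has no choice at them: such a vertex gets a fresh partner by a forced
edge, and the resulting block is later attached by another forced edge. Together with the side edge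
this is three rounds for two vertices. If Painter interrupts the run by the path colour, parity
matters. For an odd number of blocks the two ends of the run meet different side colours, so joining
them is forced. For an even number Builder asks again at the far end, and may be left with a
floating path on three vertices.

The induction therefore treats three kinds of positions at once, `FreshBound`, `SingleBound` and
`FloatBound` (combined in `bounds`), with `Run.wins` as its core. The cases i ≤ 4, and a few cases
in which the cost of a small remainder exceeds the linear trend, are finite games. They are settled
by explicit strategy trees, verified by `check`, whose soundness is `wins_of_check`. -/

/-- The colour (among the two colours in which Builder aims at `P₃`) named by a Boolean. -/
def sideColour (b : Bool) : Fin 3 := if b then 1 else 0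

/-- `u` and `v` are joined by an edge of side colour `b`. -/
def SideAdj (P : Position 3) (b : Bool) (u v : ℕ) : Prop := (P (sideColour b)).Adj u v

/-- `u` and `v` are joined by an edge of the path colour. -/
def MainAdj (P : Position 3) (u v : ℕ) : Prop := (P 2).Adj u v

/-- Some edge of side colour `b` is incident to `u`. -/
def Inc (P : Position 3) (b : Bool) (u : ℕ) : Prop := ∃ v, SideAdj P b u v

/-- No side-coloured edge is incident to `u`. -/
def Fresh (P : Position 3) (u : ℕ) : Prop := ∀ b, ¬ Inc P b u

/-- Edges of both side colours are incident to `u`. -/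
def Sat (P : Position 3) (u : ℕ) : Prop := ∀ b, Inc P b u

/-- Only finitely many vertices have been used. -/
def Bdd (P : Position 3) : Prop := ∃ N, ∀ c u v, (P c).Adj u v → u < N

/-- Builder can force a win in `n` rounds, the target path having `l` vertices. -/
abbrev Wins (l n : ℕ) (P : Position 3) : Prop := BuilderForces ![pathP 3, pathP 3, pathP l] n P

/-- `P'` arises from `P` by adding edges of the path colour. -/
def MainExt (P P' : Position 3) : Prop :=
  (∀ b u v, SideAdj P' b u v ↔ SideAdj P b u v) ∧ (∀ u v, MainAdj P u v → MainAdj P' u v) ∧ Bdd P'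

/-- `P'` arises from `P` by adding the edge `uv` of side colour `b`. -/
def SideStep (P : Position 3) (b : Bool) (u v : ℕ) (P' : Position 3) : Prop :=
  (∀ b' x y, SideAdj P' b' x y ↔ SideAdj P b' x y ∨ (b' = b ∧ (x = u ∧ y = v ∨ x = v ∧ y = u))) ∧
  (∀ x y, MainAdj P' x y ↔ MainAdj P x y) ∧ Bdd P'

/-- Painter has to use the path colour for `uv`. -/
def Link (P : Position 3) (u v : ℕ) : Prop :=
  u ≠ v ∧ (∀ b, ¬ SideAdj P b u v) ∧ ∀ b, Inc P b u ∨ Inc P b v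

/-- `M` is a path in the path colour. -/
def MPath (P : Position 3) (M : List ℕ) : Prop := M.IsChain (MainAdj P) ∧ M.Nodup

/-! ### Elementary facts about positions and single rounds. -/

lemma SideAdj.symm {P : Position 3} {b : Bool} {u v : ℕ} (h : SideAdj P b u v) :
    SideAdj P b v u := SimpleGraph.Adj.symm h

lemma MainAdj.symm {P : Position 3} {u v : ℕ} (h : MainAdj P u v) : MainAdj P v u :=
  SimpleGraph.Adj.symm h

lemma SideAdj.inc {P : Position 3} {b : Bool} {u v : ℕ} (h : SideAdj P b u v) : Inc P b u :=
  ⟨v, h⟩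

lemma SideAdj.ne {P : Position 3} {b : Bool} {u v : ℕ} (h : SideAdj P b u v) : u ≠ v :=
  SimpleGraph.Adj.ne h

lemma Fresh.not_adj {P : Position 3} {u : ℕ} (h : Fresh P u) (b : Bool) (v : ℕ) :
    ¬ SideAdj P b u v := fun h' => h b h'.inc

lemma Fresh.not_adj' {P : Position 3} {u : ℕ} (h : Fresh P u) (b : Bool) (v : ℕ) :
    ¬ SideAdj P b v u := fun h' => h b h'.symm.inc

lemma forces_mono_succ {t : ℕ} {G : Fin t → FinGraph} :
    ∀ {n : ℕ} {P : Position t}, BuilderForces G n P → BuilderForces G (n + 1) P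
  | 0, _, h => Or.inl h
  | _ + 1, _, Or.inl h => Or.inl h
  | _ + 1, _, Or.inr ⟨u, v, h, h'⟩ => Or.inr ⟨u, v, h, fun c => forces_mono_succ (h' c)⟩

lemma forces_mono {t : ℕ} {G : Fin t → FinGraph} {n m : ℕ} {P : Position t} (hnm : n ≤ m)
    (h : BuilderForces G n P) : BuilderForces G m P := by
  induction hnm with
  | refl => exact h
  | step _ ih => exact forces_mono_succ ih

lemma forces_of_won {t : ℕ} {G : Fin t → FinGraph} {n : ℕ} {P : Position t}
    (h : BuilderHasWon G P) : BuilderForces G n P :=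
  forces_mono (Nat.zero_le n) (show BuilderForces G 0 P from h)

lemma pathGraph_isContained_of_chain {G : SimpleGraph ℕ} {M : List ℕ} {l : ℕ}
    (hc : M.IsChain G.Adj) (hn : M.Nodup) (hl : l ≤ M.length) :
    (SimpleGraph.pathGraph l).IsContained G := by
  refine ⟨⟨⟨fun i => M[(i : ℕ)]'(lt_of_lt_of_le i.2 hl), ?_⟩, ?_⟩⟩
  · intro a b hab
    rw [SimpleGraph.pathGraph_adj] at hab
    rw [List.isChain_iff_getElem] at hc
    rcases hab with hab | hab
    · have := hc a.1 (by omega)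
      simpa [hab] using this
    · have := hc b.1 (by omega)
      simpa [hab] using this.symm
  · intro a b hab
    have := (List.Nodup.getElem_inj_iff hn).1 hab
    exact Fin.ext this

lemma wins_of_path {P : Position 3} {M : List ℕ} {l n : ℕ} (h : MPath P M) (hl : l ≤ M.length) :
    Wins l n P :=
  forces_of_won ⟨2, pathGraph_isContained_of_chain (G := P 2) h.1 h.2 hl⟩

lemma pathThree_isContained {G : SimpleGraph ℕ} {u v w : ℕ} (h₁ : G.Adj u v) (h₂ : G.Adj v w)
    (h : u ≠ w) : (SimpleGraph.pathGraph 3).IsContained G :=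
  pathGraph_isContained_of_chain (M := [u, v, w]) (by simp [h₁, h₂])
    (by simp [h₁.ne, h₂.ne, h]) (by simp)

lemma wins_of_side {P : Position 3} {b : Bool} {u v w l n : ℕ} (h₁ : SideAdj P b u v)
    (h₂ : SideAdj P b v w) (h : u ≠ w) : Wins l n P := by
  refine forces_of_won ⟨sideColour b, ?_⟩
  have := pathThree_isContained h₁ h₂ h
  cases b <;> exact this

lemma paintEdge_adj {t : ℕ} (P : Position t) {u v : ℕ} (h : u ≠ v) (c d : Fin t) (x y : ℕ) :
    (paintEdge P u v c d).Adj x y ↔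
      (P d).Adj x y ∨ (d = c ∧ (x = u ∧ y = v ∨ x = v ∧ y = u)) := by
  unfold paintEdge
  by_cases hdc : d = c
  · subst hdc
    simp only [Function.update_self, SimpleGraph.sup_adj, SimpleGraph.edge_adj, true_and]
    constructor
    · rintro (h | ⟨h, -⟩)
      · exact Or.inl h
      · right; tauto
    · rintro (h' | h')
      · exact Or.inl h'
      · right
        refine ⟨by tauto, ?_⟩
        rintro rfl
        rcases h' with ⟨rfl, rfl⟩ | ⟨rfl, rfl⟩ <;> exact h rfl
  · simp [hdc]

lemma sideColour_ne_two (b : Bool) : sideColour b ≠ 2 := by cases b <;> decide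

lemma sideColour_inj {b b' : Bool} : sideColour b = sideColour b' ↔ b = b' := by
  cases b <;> cases b' <;> decide

lemma Bdd.paint {P : Position 3} (hP : Bdd P) {u v : ℕ} (h : u ≠ v) (c : Fin 3) :
    Bdd (paintEdge P u v c) := by
  obtain ⟨N, hN⟩ := hP
  refine ⟨max N (max (u + 1) (v + 1)), fun d x y hxy => ?_⟩
  rw [paintEdge_adj P h] at hxy
  rcases hxy with hxy | ⟨-, ⟨rfl, -⟩ | ⟨rfl, -⟩⟩
  · exact lt_of_lt_of_le (hN d x y hxy) (le_max_left _ _)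
  · exact lt_of_lt_of_le (Nat.lt_succ_self _) ((le_max_left _ _).trans (le_max_right _ _))
  · exact lt_of_lt_of_le (Nat.lt_succ_self _) ((le_max_right _ _).trans (le_max_right _ _))

lemma MainExt.refl {P : Position 3} (h : Bdd P) : MainExt P P :=
  ⟨fun _ _ _ => Iff.rfl, fun _ _ h => h, h⟩

lemma MainExt.trans {P P' P'' : Position 3} (h : MainExt P P') (h' : MainExt P' P'') :
    MainExt P P'' :=
  ⟨fun b u v => (h'.1 b u v).trans (h.1 b u v), fun u v huv => h'.2.1 u v (h.2.1 u v huv), h'.2.2⟩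

lemma mainExt_paint {P : Position 3} (hP : Bdd P) {u v : ℕ} (h : u ≠ v) :
    MainExt P (paintEdge P u v 2) ∧ MainAdj (paintEdge P u v 2) u v := by
  refine ⟨⟨fun b x y => ?_, fun x y hxy => ?_, hP.paint h 2⟩, ?_⟩
  · unfold SideAdj; rw [paintEdge_adj P h]; simp [sideColour_ne_two]
  · unfold MainAdj; rw [paintEdge_adj P h]; exact Or.inl hxy
  · unfold MainAdj; rw [paintEdge_adj P h]; simp

lemma sideStep_paint {P : Position 3} (hP : Bdd P) {u v : ℕ} (h : u ≠ v) (b : Bool) :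
    SideStep P b u v (paintEdge P u v (sideColour b)) := by
  refine ⟨fun b' x y => ?_, fun x y => ?_, hP.paint h _⟩
  · unfold SideAdj; rw [paintEdge_adj P h, sideColour_inj]
  · unfold MainAdj; rw [paintEdge_adj P h]; simp [(sideColour_ne_two b).symm]

/-- One round of the game: Painter either uses a side colour that is absent at both ends, or the
path colour. -/
lemma wins_step {P : Position 3} {l n u v : ℕ} (hP : Bdd P) (huv : u ≠ v)
    (hadj : ∀ b, ¬ SideAdj P b u v)
    (hside : ∀ b P', ¬ Inc P b u → ¬ Inc P b v → SideStep P b u v P' → Wins l n P')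
    (hmain : ∀ P', MainExt P P' → MainAdj P' u v → Wins l n P') : Wins l (n + 1) P := by
  -- The edge may already be present in the path colour; then the round is simply not played.
  by_cases hm : MainAdj P u v
  · exact forces_mono_succ (hmain P (MainExt.refl hP) hm)
  refine Or.inr ⟨u, v, ⟨huv, fun i => ?_⟩, fun c => ?_⟩
  · fin_cases i
    · exact hadj false
    · exact hadj true
    · exact hm
  have key : ∀ b, Wins l n (paintEdge P u v (sideColour b)) := by
    intro b
    have hs := sideStep_paint hP huv b
    by_cases hu : Inc P b u
    · obtain ⟨w, hw⟩ := hu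
      refine wins_of_side (b := b) (u := w) (v := u) (w := v) ((hs.1 _ _ _).2 (Or.inl hw.symm))
        ((hs.1 _ _ _).2 (Or.inr ⟨rfl, Or.inl ⟨rfl, rfl⟩⟩)) ?_
      rintro rfl
      exact hadj b hw
    by_cases hv : Inc P b v
    · obtain ⟨w, hw⟩ := hv
      refine wins_of_side (b := b) (u := w) (v := v) (w := u) ((hs.1 _ _ _).2 (Or.inl hw.symm))
        ((hs.1 _ _ _).2 (Or.inr ⟨rfl, Or.inr ⟨rfl, rfl⟩⟩)) ?_
      rintro rfl
      exact hadj b hw.symm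
    exact hside b _ hu hv hs
  fin_cases c
  · exact key false
  · exact key true
  · exact hmain _ (mainExt_paint hP huv).1 (mainExt_paint hP huv).2

/-- Any side-coloured answer would complete a monochromatic P₃ at an end that meets this colour
already. -/
lemma wins_link {P : Position 3} {l n u v : ℕ} (hP : Bdd P) (h : Link P u v)
    (hmain : ∀ P', MainExt P P' → MainAdj P' u v → Wins l n P') : Wins l (n + 1) P := by
  refine wins_step hP h.1 h.2.1 (fun b P' hu hv _ => ?_) hmain
  exact absurd (h.2.2 b) (by tauto)

lemma MainExt.inc {P P' : Position 3} (h : MainExt P P') {b : Bool} {u : ℕ} :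
    Inc P' b u ↔ Inc P b u := by simp [Inc, h.1]

lemma MainExt.fresh {P P' : Position 3} (h : MainExt P P') {u : ℕ} : Fresh P' u ↔ Fresh P u := by
  simp [Fresh, h.inc]

lemma MainExt.sat {P P' : Position 3} (h : MainExt P P') {u : ℕ} : Sat P' u ↔ Sat P u := by
  simp [Sat, h.inc]

lemma MainExt.link {P P' : Position 3} (h : MainExt P P') {u v : ℕ} (hl : Link P u v) :
    Link P' u v :=
  ⟨hl.1, fun b hb => hl.2.1 b ((h.1 b u v).1 hb), fun b => by simpa [h.inc] using hl.2.2 b⟩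

lemma MainExt.mpath {P P' : Position 3} (h : MainExt P P') {M : List ℕ} (hM : MPath P M) :
    MPath P' M := ⟨hM.1.imp fun _ _ => h.2.1 _ _, hM.2⟩

lemma SideStep.mpath {P P' : Position 3} {b : Bool} {u v : ℕ} (h : SideStep P b u v P')
    {M : List ℕ} : MPath P' M ↔ MPath P M := by
  have : MainAdj P' = MainAdj P := by funext x y; exact propext (h.2.1 x y)
  simp [MPath, this]

lemma SideStep.inc {P P' : Position 3} {b : Bool} {u v : ℕ} (h : SideStep P b u v P') (b' : Bool)
    (x : ℕ) : Inc P' b' x ↔ Inc P b' x ∨ (b' = b ∧ (x = u ∨ x = v)) := by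
  simp only [Inc, h.1]
  constructor
  · rintro ⟨w, hw | hw⟩
    · exact Or.inl ⟨w, hw⟩
    · right; tauto
  · rintro (⟨w, hw⟩ | ⟨rfl, rfl | rfl⟩)
    · exact ⟨w, Or.inl hw⟩
    · exact ⟨v, by tauto⟩
    · exact ⟨u, by tauto⟩

lemma SideStep.fresh {P P' : Position 3} {b : Bool} {u v x : ℕ} (h : SideStep P b u v P')
    (hx : Fresh P x) (hu : x ≠ u) (hv : x ≠ v) : Fresh P' x := by
  intro b' hb'
  rcases (h.inc b' x).1 hb' with h' | ⟨-, h' | h'⟩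
  · exact hx b' h'
  · exact hu h'
  · exact hv h'

lemma SideStep.sat {P P' : Position 3} {b : Bool} {u v x : ℕ} (h : SideStep P b u v P')
    (hx : Sat P x) : Sat P' x := fun b' => (h.inc b' x).2 (Or.inl (hx b'))

lemma SideStep.not_adj {P P' : Position 3} {b : Bool} {u v x y : ℕ} (h : SideStep P b u v P')
    (hxy : ∀ b', ¬ SideAdj P b' x y) (h₁ : ¬ (x = u ∧ y = v)) (h₂ : ¬ (x = v ∧ y = u)) (b' : Bool) :
    ¬ SideAdj P' b' x y := by
  rw [h.1]; intro h'; rcases h' with h' | ⟨-, h' | h'⟩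
  · exact hxy b' h'
  · exact h₁ h'
  · exact h₂ h'

lemma exists_fresh {P : Position 3} (hP : Bdd P) (L : List ℕ) : ∃ x, Fresh P x ∧ x ∉ L := by
  obtain ⟨N, hN⟩ := hP
  obtain ⟨K, hK⟩ : ∃ K, ∀ x ∈ L, x < K := by
    refine ⟨L.sum + 1, fun x hx => Nat.lt_succ_of_le (List.single_le_sum (by simp) x hx)⟩
  refine ⟨max N K, fun b ⟨v, hv⟩ => ?_, fun h => ?_⟩
  · exact absurd (hN _ _ _ hv) (by simp)
  · exact absurd (hK _ h) (by simp)

lemma Link.symm {P : Position 3} {u v : ℕ} (h : Link P u v) : Link P v u :=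
  ⟨h.1.symm, fun b hb => h.2.1 b hb.symm, fun b => (h.2.2 b).symm⟩

lemma Link.of_sat {P : Position 3} {u v : ℕ} (h : Sat P u) (hn : ∀ b, ¬ SideAdj P b u v)
    (huv : u ≠ v) : Link P u v := ⟨huv, hn, fun b => Or.inl (h b)⟩

lemma Link.of_fresh {P : Position 3} {u v : ℕ} (h : Sat P u) (hv : Fresh P v) : Link P u v :=
  Link.of_sat h (fun b => hv.not_adj' b u) (by rintro rfl; exact hv true (h true))

lemma MPath.reverse {P : Position 3} {M : List ℕ} (h : MPath P M) : MPath P M.reverse := by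
  refine ⟨?_, List.nodup_reverse.2 h.2⟩
  rw [List.isChain_reverse]
  exact h.1.imp fun _ _ h => h.symm

/-! ### Painter's strategies -/

/-- `E c` is the set of edges of colour `c`. -/
def EdgeSets (P : Position 3) (E : Fin 3 → Finset (Sym2 ℕ)) : Prop :=
  ∀ c, (P c).edgeSet = ↑(E c)

/-- The side colours are matchings. -/
def SideMatching (P : Position 3) : Prop :=
  ∀ b u v w, SideAdj P b u v → SideAdj P b u w → v = w

lemma EdgeSets.mem {P : Position 3} {E : Fin 3 → Finset (Sym2 ℕ)} (hE : EdgeSets P E) {c : Fin 3}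
    {u v : ℕ} : s(u, v) ∈ E c ↔ (P c).Adj u v := by
  rw [← SimpleGraph.mem_edgeSet, hE c, Finset.mem_coe]

lemma EdgeSets.paint {P : Position 3} {E : Fin 3 → Finset (Sym2 ℕ)} (hE : EdgeSets P E)
    {u v : ℕ} (h : LegalMove P u v) (c : Fin 3) :
    ∃ E', EdgeSets (paintEdge P u v c) E' ∧ ∑ i, (E' i).card = ∑ i, (E i).card + 1 := by
  refine ⟨Function.update E c (insert s(u, v) (E c)), fun d => ?_, ?_⟩
  · ext e
    induction e with
    | _ x y =>
      rw [SimpleGraph.mem_edgeSet, paintEdge_adj P h.1, Finset.mem_coe]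
      by_cases hd : d = c
      · subst hd
        simp [hE.mem, or_comm]
      · simp [hd, hE.mem]
  · have hnot : s(u, v) ∉ E c := by rw [hE.mem]; exact h.2 c
    have hc : (Function.update E c (insert s(u, v) (E c)) c).card = (E c).card + 1 := by
      simp [hnot]
    have hd : ∀ d ≠ c, (Function.update E c (insert s(u, v) (E c)) d).card = (E d).card := by
      intro d hd; simp [Function.update_of_ne hd]
    rw [← Finset.add_sum_erase _ _ (Finset.mem_univ c), hc,
      Finset.sum_congr rfl (fun d hd' => hd d (Finset.ne_of_mem_erase hd')),
      ← Finset.add_sum_erase Finset.univ (fun i => (E i).card) (Finset.mem_univ c)]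
    omega

/-- If Painter can maintain `I`, and Builder's winning positions with `I` have at least `N` edges,
then Builder needs `N` rounds. -/
lemma rounds_ge_of_invariant {G : Fin 3 → FinGraph} (I : Position 3 → Prop) (N : ℕ)
    (hwon : ∀ P E, I P → EdgeSets P E → BuilderHasWon G P → N ≤ ∑ i, (E i).card)
    (hstep : ∀ P u v, I P → LegalMove P u v → ∃ c, I (paintEdge P u v c)) :
    ∀ (n : ℕ) (P : Position 3) (E : Fin 3 → Finset (Sym2 ℕ)), I P → EdgeSets P E →
      BuilderForces G n P → N ≤ ∑ i, (E i).card + n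
  | 0, P, E, hI, hE, h => hwon P E hI hE h
  | n + 1, P, E, hI, hE, h => by
    rcases h with h | ⟨u, v, hl, h⟩
    · exact (hwon P E hI hE h).trans (Nat.le_add_right _ _)
    · obtain ⟨c, hc⟩ := hstep P u v hI hl
      obtain ⟨E', hE', hcard⟩ := hE.paint hl c
      have := rounds_ge_of_invariant I N hwon hstep n _ E' hc hE' (h c)
      omega

lemma not_pathThree_of_sideMatching {P : Position 3} (h : SideMatching P) (b : Bool) :
    ¬ (SimpleGraph.pathGraph 3).IsContained (P (sideColour b)) := by
  rintro ⟨f⟩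
  have h01 : (P (sideColour b)).Adj (f 1) (f 0) :=
    f.toHom.map_adj (by rw [SimpleGraph.pathGraph_adj]; decide)
  have h12 : (P (sideColour b)).Adj (f 1) (f 2) :=
    f.toHom.map_adj (by rw [SimpleGraph.pathGraph_adj]; decide)
  exact absurd (f.injective (h b _ _ _ h01 h12)) (by decide)

lemma exists_path_of_won {P : Position 3} {l : ℕ} (h : SideMatching P)
    (hw : BuilderHasWon ![pathP 3, pathP 3, pathP l] P) :
    ∃ v : ℕ → ℕ, (∀ i j, i < l → j < l → v i = v j → i = j) ∧
      ∀ i, i + 1 < l → MainAdj P (v i) (v (i + 1)) := by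
  obtain ⟨i, hi⟩ := hw
  fin_cases i
  · exact absurd hi (not_pathThree_of_sideMatching h false)
  · exact absurd hi (not_pathThree_of_sideMatching h true)
  obtain ⟨f⟩ := (show (SimpleGraph.pathGraph l).IsContained (P 2) from hi)
  refine ⟨fun i => if hi : i < l then f ⟨i, hi⟩ else 0, fun i j hi hj hij => ?_, fun i hi => ?_⟩
  · simp only [hi, hj, dite_true] at hij
    simpa using f.injective hij
  · simp only [hi, (Nat.lt_succ_self i).trans hi, dite_true]
    exact f.toHom.map_adj (by rw [SimpleGraph.pathGraph_adj]; simp)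

lemma card_main_ge {P : Position 3} {E : Fin 3 → Finset (Sym2 ℕ)} (hE : EdgeSets P E) {l : ℕ}
    {v : ℕ → ℕ} (hv : ∀ i j, i < l → j < l → v i = v j → i = j)
    (hadj : ∀ i, i + 1 < l → MainAdj P (v i) (v (i + 1))) : l - 1 ≤ (E 2).card := by
  rw [← Finset.card_range (l - 1)]
  refine Finset.card_le_card_of_injOn (fun i => s(v i, v (i + 1))) (fun i hi => ?_) ?_
  · have hi := Finset.mem_range.1 (Finset.mem_coe.1 hi)
    exact Finset.mem_coe.2 (hE.mem.2 (hadj i (by omega)))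
  · intro i hi j hj hij
    have hi := Finset.mem_range.1 (Finset.mem_coe.1 hi)
    have hj := Finset.mem_range.1 (Finset.mem_coe.1 hj)
    rcases Sym2.eq_iff.1 hij with ⟨h, -⟩ | ⟨h, h'⟩
    · exact hv _ _ (by omega) (by omega) h
    · have := hv _ _ (by omega) (by omega) h
      have := hv _ _ (by omega) (by omega) h'
      omega

lemma card_inc_le {P : Position 3} {E : Fin 3 → Finset (Sym2 ℕ)} (hE : EdgeSets P E) (b : Bool)
    {s : Finset ℕ} (hs : ∀ x ∈ s, Inc P b x) : s.card ≤ 2 * (E (sideColour b)).card := by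
  have hsub : s ⊆ (E (sideColour b)).biUnion Sym2.toFinset := by
    intro x hx
    obtain ⟨y, hy⟩ := hs x hx
    exact Finset.mem_biUnion.2 ⟨s(x, y), hE.mem.2 hy, by simp⟩
  refine (Finset.card_le_card hsub).trans ((Finset.card_biUnion_le_card_mul _ _ 2 ?_).trans
    (by omega))
  intro e _
  rw [Sym2.card_toFinset]; split <;> omega

/-- The path edges `v (2 * i)`, `v (2 * i + 1)` are pairwise disjoint, so one suitable vertex can be
picked from each of them. -/
lemma pair_cover_card {l : ℕ} {v : ℕ → ℕ} {Q : ℕ → Prop}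
    (hv : ∀ i j, i < l → j < l → v i = v j → i = j)
    (hQ : ∀ i, i + 1 < l → Q (v i) ∨ Q (v (i + 1))) :
    ∃ s : Finset ℕ, (∀ x ∈ s, Q x) ∧ s.card = l / 2 := by
  classical
  let g : ℕ → ℕ := fun i => if Q (v (2 * i)) then v (2 * i) else v (2 * i + 1)
  refine ⟨(Finset.range (l / 2)).image g, ?_, ?_⟩
  · intro x hx
    obtain ⟨i, hi, rfl⟩ := Finset.mem_image.1 hx
    have hi := Finset.mem_range.1 hi
    have := hQ (2 * i) (by omega)
    by_cases h : Q (v (2 * i)) <;> simp only [g, h, if_true, if_false]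
    simpa [h] using this
  · rw [Finset.card_image_of_injOn, Finset.card_range]
    intro i hi j hj hij
    have hi := Finset.mem_range.1 (Finset.mem_coe.1 hi)
    have hj := Finset.mem_range.1 (Finset.mem_coe.1 hj)
    simp only [g] at hij
    split at hij <;> split at hij <;>
      (have := hv _ _ (by omega) (by omega) hij; omega)

/-! ### The greedy Painter. -/

/-- The invariant of the greedy Painter, who prefers the side colour `false` to `true` to the path
colour. -/
structure GreedyInv (P : Position 3) : Prop where
  matching : SideMatching P
  main : ∀ u v, MainAdj P u v → ∀ b, Inc P b u ∨ Inc P b v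
  second : ∀ u v, SideAdj P true u v → Inc P false u ∨ Inc P false v
  disj : ∀ u v b, MainAdj P u v → ¬ SideAdj P b u v
  side : ∀ u v, SideAdj P false u v → ¬ SideAdj P true u v

lemma sideMatching_paint {P : Position 3} {u v : ℕ} {b : Bool} (h : SideMatching P) (huv : u ≠ v)
    (hu : ¬ Inc P b u) (hv : ¬ Inc P b v) : SideMatching (paintEdge P u v (sideColour b)) := by
  intro b' x y z hy hz
  unfold SideAdj at hy hz
  rw [paintEdge_adj P huv, sideColour_inj] at hy hz
  rcases hy with hy | ⟨rfl, hy⟩ <;> rcases hz with hz | ⟨hb, hz⟩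
  · exact h b' x y z hy hz
  · subst hb
    rcases hz with ⟨rfl, rfl⟩ | ⟨rfl, rfl⟩
    · exact absurd ⟨y, hy⟩ hu
    · exact absurd ⟨y, hy⟩ hv
  · rcases hy with ⟨rfl, rfl⟩ | ⟨rfl, rfl⟩
    · exact absurd ⟨z, hz⟩ hu
    · exact absurd ⟨z, hz⟩ hv
  · rcases hy with ⟨rfl, rfl⟩ | ⟨rfl, rfl⟩ <;> rcases hz with ⟨h1, h2⟩ | ⟨h1, h2⟩ <;> omega

lemma inc_paint {P : Position 3} {u v : ℕ} (huv : u ≠ v) (c : Fin 3) {b : Bool} {x : ℕ}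
    (h : Inc P b x) : Inc (paintEdge P u v c) b x := by
  obtain ⟨y, hy⟩ := h
  refine ⟨y, ?_⟩
  unfold SideAdj
  rw [paintEdge_adj P huv]
  exact Or.inl hy

lemma inc_paint_iff {P : Position 3} {u v : ℕ} (huv : u ≠ v) (b' : Bool) {b : Bool} {x : ℕ} :
    Inc (paintEdge P u v (sideColour b')) b x ↔ Inc P b x ∨ (b = b' ∧ (x = u ∨ x = v)) := by
  unfold Inc SideAdj
  simp only [paintEdge_adj P huv, sideColour_inj]
  constructor
  · rintro ⟨y, hy | hy⟩
    · exact Or.inl ⟨y, hy⟩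
    · right; tauto
  · rintro (⟨y, hy⟩ | ⟨rfl, rfl | rfl⟩)
    · exact ⟨y, Or.inl hy⟩
    · exact ⟨v, by tauto⟩
    · exact ⟨u, by tauto⟩

lemma inc_paint_main_iff {P : Position 3} {u v : ℕ} (huv : u ≠ v) {b : Bool} {x : ℕ} :
    Inc (paintEdge P u v 2) b x ↔ Inc P b x := by
  unfold Inc SideAdj
  simp [paintEdge_adj P huv, sideColour_ne_two]

lemma mainAdj_paint_side {P : Position 3} {u v : ℕ} (huv : u ≠ v) (b : Bool) {x y : ℕ} :
    MainAdj (paintEdge P u v (sideColour b)) x y ↔ MainAdj P x y := by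
  unfold MainAdj
  simp [paintEdge_adj P huv, (sideColour_ne_two b).symm]

lemma mainAdj_paint_main {P : Position 3} {u v : ℕ} (huv : u ≠ v) {x y : ℕ} :
    MainAdj (paintEdge P u v 2) x y ↔ MainAdj P x y ∨ (x = u ∧ y = v ∨ x = v ∧ y = u) := by
  unfold MainAdj
  simp [paintEdge_adj P huv]

lemma sideAdj_paint_side {P : Position 3} {u v : ℕ} (huv : u ≠ v) (b' : Bool) {b : Bool}
    {x y : ℕ} : SideAdj (paintEdge P u v (sideColour b')) b x y ↔
      SideAdj P b x y ∨ (b = b' ∧ (x = u ∧ y = v ∨ x = v ∧ y = u)) := by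
  unfold SideAdj
  simp only [paintEdge_adj P huv, sideColour_inj]

lemma sideAdj_paint_main {P : Position 3} {u v : ℕ} (huv : u ≠ v) {b : Bool}
    {x y : ℕ} : SideAdj (paintEdge P u v 2) b x y ↔ SideAdj P b x y := by
  unfold SideAdj
  simp [paintEdge_adj P huv, sideColour_ne_two]

lemma not_pair_of_not {R : ℕ → ℕ → Prop} {u v x y : ℕ}
    (h : ¬ R u v) (hxy : R x y) (hs : R y x) : ¬ (x = u ∧ y = v ∨ x = v ∧ y = u) := by
  rintro (⟨rfl, rfl⟩ | ⟨rfl, rfl⟩)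
  · exact h hxy
  · exact h hs

lemma LegalMove.not_side {P : Position 3} {u v : ℕ} (h : LegalMove P u v) (b : Bool) :
    ¬ SideAdj P b u v := h.2 (sideColour b)

/-- Painter takes the first of the colours 0, 1 that is absent at both ends, and colour 2 if there
is none. When colour 1 is chosen, colour 0 is blocked, which preserves `second`; when colour 2 is
chosen, both are blocked, which preserves `main`. -/
lemma greedyInv_step {P : Position 3} {u v : ℕ} (h : GreedyInv P) (hl : LegalMove P u v) :
    ∃ c, GreedyInv (paintEdge P u v c) := by
  have hm : ¬ MainAdj P u v := hl.2 2
  by_cases h0 : ¬ Inc P false u ∧ ¬ Inc P false v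
  · refine ⟨sideColour false, sideMatching_paint h.matching hl.1 h0.1 h0.2, ?_, ?_, ?_, ?_⟩
    · intro x y hxy b
      rw [mainAdj_paint_side hl.1] at hxy
      exact (h.main x y hxy b).imp (inc_paint hl.1 _) (inc_paint hl.1 _)
    · intro x y hxy
      rw [sideAdj_paint_side hl.1] at hxy
      rcases hxy with hxy | ⟨hb, -⟩
      · exact (h.second x y hxy).imp (inc_paint hl.1 _) (inc_paint hl.1 _)
      · exact absurd hb (by decide)
    · intro x y b hxy
      rw [mainAdj_paint_side hl.1] at hxy
      rw [sideAdj_paint_side hl.1]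
      rintro (h' | ⟨-, h'⟩)
      · exact h.disj x y b hxy h'
      · exact not_pair_of_not hm hxy hxy.symm h'
    · intro x y hx hy
      rw [sideAdj_paint_side hl.1] at hx hy
      rcases hx with hx | ⟨hb, hx⟩ <;> rcases hy with hy | ⟨hb', hy⟩
      · exact h.side x y hx hy
      · exact not_pair_of_not (hl.not_side _) hx hx.symm hy
      · exact not_pair_of_not (hl.not_side _) hy hy.symm hx
      · simp at hb'
  by_cases h1 : ¬ Inc P true u ∧ ¬ Inc P true v
  · refine ⟨sideColour true, sideMatching_paint h.matching hl.1 h1.1 h1.2, ?_, ?_, ?_, ?_⟩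
    · intro x y hxy b
      rw [mainAdj_paint_side hl.1] at hxy
      exact (h.main x y hxy b).imp (inc_paint hl.1 _) (inc_paint hl.1 _)
    · intro x y hxy
      rw [sideAdj_paint_side hl.1] at hxy
      rcases hxy with hxy | ⟨-, ⟨rfl, rfl⟩ | ⟨rfl, rfl⟩⟩
      · exact (h.second x y hxy).imp (inc_paint hl.1 _) (inc_paint hl.1 _)
      · have : Inc P false x ∨ Inc P false y := by tauto
        exact this.imp (inc_paint hl.1 _) (inc_paint hl.1 _)
      · have : Inc P false x ∨ Inc P false y := by tauto
        exact this.imp (inc_paint hl.1 _) (inc_paint hl.1 _)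
    · intro x y b hxy
      rw [mainAdj_paint_side hl.1] at hxy
      rw [sideAdj_paint_side hl.1]
      rintro (h' | ⟨-, h'⟩)
      · exact h.disj x y b hxy h'
      · exact not_pair_of_not hm hxy hxy.symm h'
    · intro x y hx hy
      rw [sideAdj_paint_side hl.1] at hx hy
      rcases hx with hx | ⟨hb, hx⟩ <;> rcases hy with hy | ⟨hb', hy⟩
      · exact h.side x y hx hy
      · exact not_pair_of_not (hl.not_side _) hx hx.symm hy
      · exact not_pair_of_not (hl.not_side _) hy hy.symm hx
      · simp at hb
  refine ⟨2, ?_, ?_, ?_, ?_, ?_⟩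
  · intro b x y z hy hz
    rw [sideAdj_paint_main hl.1] at hy hz
    exact h.matching b x y z hy hz
  · intro x y hxy b
    rw [mainAdj_paint_main hl.1] at hxy
    rw [inc_paint_main_iff hl.1, inc_paint_main_iff hl.1]
    rcases hxy with hxy | ⟨rfl, rfl⟩ | ⟨rfl, rfl⟩
    · exact h.main x y hxy b
    · cases b <;> tauto
    · cases b <;> tauto
  · intro x y hxy
    rw [sideAdj_paint_main hl.1] at hxy
    rw [inc_paint_main_iff hl.1, inc_paint_main_iff hl.1]
    exact h.second x y hxy
  · intro x y b hxy h'
    rw [mainAdj_paint_main hl.1] at hxy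
    rw [sideAdj_paint_main hl.1] at h'
    rcases hxy with hxy | ⟨rfl, rfl⟩ | ⟨rfl, rfl⟩
    · exact h.disj x y b hxy h'
    · exact hl.not_side b h'
    · exact hl.not_side b h'.symm
  · intro x y hx hy
    rw [sideAdj_paint_main hl.1] at hx hy
    exact h.side x y hx hy

lemma greedyInv_empty : GreedyInv (emptyPosition 3) where
  matching b u v w h _ := absurd h (by simp [SideAdj, emptyPosition])
  main u v h := absurd h (by simp [MainAdj, emptyPosition])
  second u v h := absurd h (by simp [SideAdj, emptyPosition])
  disj u v b h := absurd h (by simp [MainAdj, emptyPosition])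
  side u v h := absurd h (by simp [SideAdj, emptyPosition])

lemma edgeSets_empty : EdgeSets (emptyPosition 3) (fun _ => ∅) := by
  intro c; simp [emptyPosition]

lemma exists_unique_edge {P : Position 3} {E : Fin 3 → Finset (Sym2 ℕ)} (hE : EdgeSets P E)
    {b : Bool} (h : (E (sideColour b)).card = 1) :
    ∃ x y, x ≠ y ∧ ∀ u v, SideAdj P b u v ↔ (u = x ∧ v = y ∨ u = y ∧ v = x) := by
  obtain ⟨e, he⟩ := Finset.card_eq_one.1 h
  induction e with
  | _ x y =>
    have key : ∀ u v, SideAdj P b u v ↔ (u = x ∧ v = y ∨ u = y ∧ v = x) := by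
      intro u v
      unfold SideAdj
      rw [← hE.mem, he, Finset.mem_singleton, Sym2.eq_iff]
    exact ⟨x, y, ((key x y).2 (by simp)).ne, key⟩

/-- The two side edges share exactly one vertex y, say they are xy and yw, by `second`, `side` and
`hs`. A path edge then contains y or equals xw. Of the disjoint outer edges of the path one must be
xw, so the middle edge joins y to x or w; but these pairs are side-coloured. -/
lemma greedy_four {P : Position 3} {E : Fin 3 → Finset (Sym2 ℕ)} (h : GreedyInv P)
    (hE : EdgeSets P E) {v : ℕ → ℕ} (hv : ∀ i j, i < 4 → j < 4 → v i = v j → i = j)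
    (hadj : ∀ i, i + 1 < 4 → MainAdj P (v i) (v (i + 1))) (h0 : (E 0).card = 1)
    (h1 : (E 1).card = 1) : False := by
  obtain ⟨x, y, hxy, hr⟩ := exists_unique_edge (b := false) hE h0
  obtain ⟨z, w, hzw, hb⟩ := exists_unique_edge (b := true) hE h1
  have ir : ∀ u, Inc P false u ↔ u = x ∨ u = y := fun u => by
    simp only [Inc, hr]; exact ⟨by rintro ⟨v, h⟩; tauto, by rintro (rfl | rfl) <;> simp⟩
  have ib : ∀ u, Inc P true u ↔ u = z ∨ u = w := fun u => by
    simp only [Inc, hb]; exact ⟨by rintro ⟨v, h⟩; tauto, by rintro (rfl | rfl) <;> simp⟩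
  have hs := h.second z w ((hb z w).2 (by simp))
  rw [ir, ir] at hs
  have hpar := h.side x y ((hr x y).2 (by simp))
  rw [hb] at hpar
  have a0 := hadj 0 (by omega)
  have a1 := hadj 1 (by omega)
  have a2 := hadj 2 (by omega)
  have n01 : v 0 ≠ v 1 := fun h => absurd (hv _ _ (by omega) (by omega) h) (by decide)
  have n02 : v 0 ≠ v 2 := fun h => absurd (hv _ _ (by omega) (by omega) h) (by decide)
  have n03 : v 0 ≠ v 3 := fun h => absurd (hv _ _ (by omega) (by omega) h) (by decide)
  have n12 : v 1 ≠ v 2 := fun h => absurd (hv _ _ (by omega) (by omega) h) (by decide)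
  have n13 : v 1 ≠ v 3 := fun h => absurd (hv _ _ (by omega) (by omega) h) (by decide)
  have n23 : v 2 ≠ v 3 := fun h => absurd (hv _ _ (by omega) (by omega) h) (by decide)
  have r0 := h.main _ _ a0 false
  have b0 := h.main _ _ a0 true
  have r1 := h.main _ _ a1 false
  have b1 := h.main _ _ a1 true
  have r2 := h.main _ _ a2 false
  have b2 := h.main _ _ a2 true
  have d0 := h.disj _ _ false a0
  have d0' := h.disj _ _ true a0
  have d1 := h.disj _ _ false a1
  have d1' := h.disj _ _ true a1
  have d2 := h.disj _ _ false a2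
  have d2' := h.disj _ _ true a2
  simp only [ir] at r0 r1 r2
  simp only [ib] at b0 b1 b2
  simp only [hr] at d0 d1 d2
  simp only [hb] at d0' d1' d2'
  generalize v 0 = p at *
  generalize v (0 + 1) = q at *
  generalize v (1 + 1) = s at *
  generalize v (2 + 1) = t at *
  clear hr hb ir ib hv hadj a0 a1 a2 h hE h0 h1
  grind

/-- The path has l - 1 edges, and each side colour covers ⌊l/2⌋ of its vertices by edges with two
ends each. Only l = 4 needs a further argument. -/
lemma greedy_won {P : Position 3} {E : Fin 3 → Finset (Sym2 ℕ)} {l : ℕ} (hl : 2 ≤ l)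
    (h : GreedyInv P) (hE : EdgeSets P E)
    (hw : BuilderHasWon ![pathP 3, pathP 3, pathP l] P) :
    (if l = 4 then 6 else l - 1 + 2 * ((l / 2 + 1) / 2)) ≤ ∑ i, (E i).card := by
  obtain ⟨v, hv, hadj⟩ := exists_path_of_won h.matching hw
  have hm := card_main_ge hE hv hadj
  have hside : ∀ b, l / 2 ≤ 2 * (E (sideColour b)).card := by
    intro b
    obtain ⟨s, hs, hcard⟩ := pair_cover_card (Q := Inc P b) hv
      (fun i hi => h.main _ _ (hadj i hi) b)
    rw [← hcard]
    exact card_inc_le hE b hs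
  have h0 : l / 2 ≤ 2 * (E 0).card := hside false
  have h1 : l / 2 ≤ 2 * (E 1).card := hside true
  rw [Fin.sum_univ_three]
  split
  · rename_i h4
    subst h4
    -- With at most five edges, three of them in the path colour, each side colour has exactly one
    -- edge.
    by_contra hlt
    exact greedy_four h hE hv hadj (by omega) (by omega)
  · omega

/-! ### The weight-counting Painter. -/

/-- The number of side colours at `u`. -/
noncomputable def sideWeight (P : Position 3) (u : ℕ) : ℕ :=
  open Classical in (if Inc P false u then 1 else 0) + (if Inc P true u then 1 else 0)

/-- The invariant of the Painter who uses a side colour iff the two ends have together at most one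
side-coloured edge. -/
structure ForestInv (P : Position 3) : Prop where
  matching : SideMatching P
  main : ∀ u v, MainAdj P u v → 2 ≤ sideWeight P u + sideWeight P v
  leaf : (∃ b u, Inc P b u) → ∃ u, sideWeight P u = 1

lemma sideWeight_mono {P P' : Position 3} {u : ℕ} (h : ∀ b, Inc P b u → Inc P' b u) :
    sideWeight P u ≤ sideWeight P' u := by
  classical
  unfold sideWeight
  have h0 := h false
  have h1 := h true
  split_ifs <;> simp_all

/-- A side colour is used only if one end is still untouched by side colours; that end then has
weight 1, which renews `leaf`. The path colour does not change weights. -/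
lemma forestInv_step {P : Position 3} {u v : ℕ} (h : ForestInv P) (hl : LegalMove P u v) :
    ∃ c, ForestInv (paintEdge P u v c) := by
  classical
  by_cases hw : sideWeight P u + sideWeight P v ≤ 1
  · obtain ⟨b, hu, hv, hleaf⟩ : ∃ b, ¬ Inc P b u ∧ ¬ Inc P b v ∧
        ((∀ b', ¬ Inc P b' u) ∨ ∀ b', ¬ Inc P b' v) := by
      unfold sideWeight at hw
      by_cases h1 : Inc P false u <;> by_cases h2 : Inc P true u <;>
        by_cases h3 : Inc P false v <;> by_cases h4 : Inc P true v <;>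
        simp [h1, h2, h3, h4] at hw ⊢
    refine ⟨sideColour b, sideMatching_paint h.matching hl.1 hu hv, ?_, fun _ => ?_⟩
    · intro x y hxy
      rw [mainAdj_paint_side hl.1] at hxy
      exact (h.main x y hxy).trans (Nat.add_le_add (sideWeight_mono fun _ => inc_paint hl.1 _)
        (sideWeight_mono fun _ => inc_paint hl.1 _))
    · rcases hleaf with hx | hx
      · refine ⟨u, ?_⟩
        unfold sideWeight
        cases b <;> simp [inc_paint_iff hl.1, hx]
      · refine ⟨v, ?_⟩
        unfold sideWeight
        cases b <;> simp [inc_paint_iff hl.1, hx]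
  · have hsw : ∀ x, sideWeight (paintEdge P u v 2) x = sideWeight P x := by
      intro x; unfold sideWeight; simp [inc_paint_main_iff hl.1]
    refine ⟨2, ?_, ?_, ?_⟩
    · intro b x y z hy hz
      rw [sideAdj_paint_main hl.1] at hy hz
      exact h.matching b x y z hy hz
    · intro x y hxy
      rw [mainAdj_paint_main hl.1] at hxy
      rw [hsw, hsw]
      rcases hxy with hxy | ⟨rfl, rfl⟩ | ⟨rfl, rfl⟩
      · exact h.main x y hxy
      · omega
      · omega
    · rintro ⟨b, x, hx⟩
      rw [inc_paint_main_iff hl.1] at hx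
      simpa only [hsw] using h.leaf ⟨b, x, hx⟩

lemma forestInv_empty : ForestInv (emptyPosition 3) where
  matching b u v w h _ := absurd h (by simp [SideAdj, emptyPosition])
  main u v h := absurd h (by simp [MainAdj, emptyPosition])
  leaf := by rintro ⟨b, u, v, h⟩; exact absurd h (by simp [SideAdj, emptyPosition])

/-- Removing the even index `2 * t` leaves m disjoint pairs of consecutive indices. Keeping the
removed term in the bound makes all even terms vanish if the total is only `2 * m`. -/
lemma sum_ge_of_pairs (g : ℕ → ℕ) : ∀ (m t : ℕ), t ≤ m →
    (∀ i, i < 2 * m → 2 ≤ g i + g (i + 1)) →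
    2 * m + g (2 * t) ≤ ∑ i ∈ Finset.range (2 * m + 1), g i
  | 0, t, ht, _ => by simp [Nat.le_zero.1 ht]
  | m + 1, t, ht, h => by
    have e : 2 * (m + 1) + 1 = 2 * m + 1 + 1 + 1 := by ring
    rw [e, Finset.sum_range_succ _ (2 * m + 1 + 1), Finset.sum_range_succ _ (2 * m + 1)]
    have hp := h (2 * m + 1) (by omega)
    have hp' := h (2 * m) (by omega)
    rcases Nat.lt_or_ge m t with htm | htm
    · have : t = m + 1 := by omega
      subst this
      have ih := sum_ge_of_pairs g m m le_rfl (fun i hi => h i (by omega))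
      rw [show 2 * (m + 1) = 2 * m + 1 + 1 from rfl]
      omega
    · have ih := sum_ge_of_pairs g m t htm (fun i hi => h i (by omega))
      omega

lemma sum_sideWeight_le {P : Position 3} {E : Fin 3 → Finset (Sym2 ℕ)} (hE : EdgeSets P E)
    (s : Finset ℕ) : ∑ x ∈ s, sideWeight P x ≤ 2 * (E 0).card + 2 * (E 1).card := by
  classical
  unfold sideWeight
  rw [Finset.sum_add_distrib, ← Finset.card_filter, ← Finset.card_filter]
  exact Nat.add_le_add (card_inc_le hE false (fun x hx => (Finset.mem_filter.1 hx).2))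
    (card_inc_le hE true (fun x hx => (Finset.mem_filter.1 hx).2))

/-- With at most 2k side edges the total weight is at most 4k, and the path alone already carries
that much. Hence weights alternate 0, 2, …, 0 on the path and vanish off it, contradicting `leaf`.
-/
lemma forest_won {P : Position 3} {E : Fin 3 → Finset (Sym2 ℕ)} {k : ℕ} (hk : 1 ≤ k)
    (h : ForestInv P) (hE : EdgeSets P E)
    (hw : BuilderHasWon ![pathP 3, pathP 3, pathP (4 * k + 1)] P) :
    6 * k + 1 ≤ ∑ i, (E i).card := by
  classical
  obtain ⟨v, hv, hadj⟩ := exists_path_of_won h.matching hw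
  have hm := card_main_ge hE hv hadj
  rw [Fin.sum_univ_three]
  by_contra hlt
  have hsmall : 2 * (E 0).card + 2 * (E 1).card ≤ 4 * k := by omega
  have hpair : ∀ i, i < 2 * (2 * k) → 2 ≤ sideWeight P (v i) + sideWeight P (v (i + 1)) :=
    fun i hi => h.main _ _ (hadj i (by omega))
  have hinj : Set.InjOn v ↑(Finset.range (2 * (2 * k) + 1)) := by
    intro i hi j hj hij
    have hi := Finset.mem_range.1 (Finset.mem_coe.1 hi)
    have hj := Finset.mem_range.1 (Finset.mem_coe.1 hj)
    exact hv i j (by omega) (by omega) hij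
  have hsum : ∀ t, t ≤ 2 * k → 4 * k + sideWeight P (v (2 * t)) ≤
      ∑ x ∈ (Finset.range (2 * (2 * k) + 1)).image v, sideWeight P x := by
    intro t ht
    rw [Finset.sum_image hinj]
    have := sum_ge_of_pairs (fun i => sideWeight P (v i)) (2 * k) t ht hpair
    omega
  have heven : ∀ t, t ≤ 2 * k → sideWeight P (v (2 * t)) = 0 := by
    intro t ht
    have h1 := hsum t ht
    have h2 := sum_sideWeight_le hE ((Finset.range (2 * (2 * k) + 1)).image v)
    omega
  have hle : ∀ x, sideWeight P x ≤ 2 := by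
    intro x; unfold sideWeight; split_ifs <;> omega
  have hodd : sideWeight P (v 1) = 2 := by
    have h1 := hpair 0 (by omega)
    have h2 := heven 0 (by omega)
    have h3 := hle (v 1)
    simp only [Nat.mul_zero] at h2
    simp only [Nat.zero_add] at h1
    omega
  obtain ⟨x, hx⟩ := h.leaf (by
    by_contra hno
    push Not at hno
    unfold sideWeight at hodd
    simp [hno] at hodd)
  by_cases hmem : x ∈ (Finset.range (2 * (2 * k) + 1)).image v
  · obtain ⟨i, hi, rfl⟩ := Finset.mem_image.1 hmem
    have hi := Finset.mem_range.1 hi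
    rcases Nat.even_or_odd' i with ⟨t, rfl | rfl⟩
    · rw [heven t (by omega)] at hx; omega
    · have h1 := hpair (2 * t) (by omega)
      have h2 := heven t (by omega)
      omega
  -- A vertex of weight 1 off the path would raise the total to 4k + 1.
  · have h1 := hsum 0 (by omega)
    have h2 := sum_sideWeight_le hE (insert x ((Finset.range (2 * (2 * k) + 1)).image v))
    rw [Finset.sum_insert hmem] at h2
    omega

/-- The greedy Painter falls short, by one round, only for l ≡ 1 (mod 4); there the weight-counting
Painter takes over. -/
theorem rounds_ge {l n : ℕ} (hl : 2 ≤ l)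
    (h : BuilderForces ![pathP 3, pathP 3, pathP l] n (emptyPosition 3)) :
    (if l % 4 = 0 ∧ 8 ≤ l then 3 * l / 2 - 1 else 3 * l / 2) ≤ n := by
  by_cases h1 : l % 4 = 1
  · obtain ⟨k, rfl⟩ : ∃ k, l = 4 * k + 1 := ⟨l / 4, by omega⟩
    have := rounds_ge_of_invariant ForestInv (6 * k + 1)
      (fun P E hI hE hw => forest_won (by omega) hI hE hw)
      (fun P u v hI hl => forestInv_step hI hl) n _ _ forestInv_empty edgeSets_empty h
    simp only [Finset.card_empty, Finset.sum_const_zero] at this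
    split <;> omega
  · have := rounds_ge_of_invariant GreedyInv _
      (fun P E hI hE hw => greedy_won hl hI hE hw)
      (fun P u v hI hl => greedyInv_step hI hl) n _ _ greedyInv_empty edgeSets_empty h
    simp only [Finset.card_empty, Finset.sum_const_zero] at this
    obtain ⟨k, r, hr, rfl⟩ : ∃ k r, r < 4 ∧ l = 4 * k + r := ⟨l / 4, l % 4, by omega, by omega⟩
    interval_cases r <;> split at this <;> split <;> omega

/-! ### Explicit strategies from small local configurations -/

/-- A strategy of Builder on local vertex names; `win` and `heavy` name the winning path. -/
inductive Strategy : Type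
  | none : Strategy
  | win : List ℕ → Strategy
  | heavy : Bool → List ℕ → List ℕ → Strategy
  | move : ℕ → ℕ → Strategy → Strategy → Strategy → Strategy
  | smove : ℕ → ℕ → Strategy → Strategy → Strategy

/-- A local configuration: the vertices in use are `0, …, n - 1`, of which `0` is the end of the
main path. If `hv` holds, a long path in the path colour joins `1` and `2`. -/
structure Config : Type where
  n : ℕ
  side : List (Bool × ℕ × ℕ)
  inc : List (Bool × ℕ)
  main : List (ℕ × ℕ)
  hv : Bool

namespace Config

/-- The configuration with a new edge of side colour `b`. -/
def addSide (c : Config) (b : Bool) (u v : ℕ) : Config :=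
  { c with
    n := max c.n (max u v + 1)
    side := (b, u, v) :: c.side
    inc := (b, u) :: (b, v) :: c.inc }

/-- The configuration with a new edge of the path colour. -/
def addMain (c : Config) (u v : ℕ) : Config :=
  { c with n := max c.n (max u v + 1), main := (u, v) :: c.main }

/-- The configuration with the side colours exchanged. -/
def swap (c : Config) : Config :=
  { c with
    side := c.side.map fun e => (!e.1, e.2)
    inc := c.inc.map fun e => (!e.1, e.2) }

/-- Adjacency in a side colour. -/
abbrev SAdj (c : Config) (b : Bool) (u v : ℕ) : Prop := (b, u, v) ∈ c.side ∨ (b, v, u) ∈ c.side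

/-- Adjacency in the path colour. -/
abbrev MAdj (c : Config) (u v : ℕ) : Prop := (u, v) ∈ c.main ∨ (v, u) ∈ c.main

/-- Both ends of an edge `uv`, one of which meets the colour `b` already. -/
abbrev Meets (c : Config) (b : Bool) (u v : ℕ) : Prop := (b, u) ∈ c.inc ∨ (b, v) ∈ c.inc

end Config

/-- `q` is a path in the path colour of the configuration. -/
def pathCheck (c : Config) : List ℕ → Bool
  | [] => true
  | [a] => decide (a < c.n)
  | a :: b :: q => decide (a < c.n) && decide (c.MAdj a b) && pathCheck c (b :: q)

/-- The strategy lengthens the main path by `i` vertices in `m` rounds. -/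
def check : Strategy → Config → ℕ → ℕ → Bool
  | .none, _, _, _ => false
  | .win q, c, _, i => !c.hv && decide ((0 :: q).Nodup) && pathCheck c (0 :: q) &&
      decide (i ≤ q.length)
  | .heavy d p q, c, _, i => c.hv && decide ((0 :: p ++ 1 :: 2 :: q).Nodup) &&
      pathCheck c (0 :: p ++ [cond d 1 2]) && pathCheck c (cond d 2 1 :: q) &&
      decide (i ≤ p.length + q.length + 2)
  | .move _ _ _ _ _, _, 0, _ => false
  | .move u v r b g, c, m + 1, i => decide (u ≠ v ∧ ∀ b, ¬ c.SAdj b u v) &&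
      (decide (c.Meets false u v) || check r (c.addSide false u v) m i) &&
      (decide (c.Meets true u v) || check b (c.addSide true u v) m i) &&
      check g (c.addMain u v) m i
  | .smove _ _ _ _, _, 0, _ => false
  | .smove u v r g, c, m + 1, i => decide (u ≠ v ∧ ∀ b, ¬ c.SAdj b u v) &&
      check r (c.addSide false u v) m i && check r (c.addSide true u v).swap m i &&
      check g (c.addMain u v) m i

/-- The configuration `c` occurs in the position `P`, its vertices being named by `φ` and its side
colours being exchanged if `σ` holds; `M` is the main path without its end and `H` the interior
of the long path between `1` and `2`. -/
structure Occurs (P : Position 3) (c : Config) (σ : Bool) (φ : ℕ → ℕ) (M H : List ℕ) : Prop where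
  bdd : Bdd P
  pos : 0 < c.n
  inj : ∀ i j, i < c.n → j < c.n → φ i = φ j → i = j
  adj : ∀ b i j, i < c.n → j < c.n → SideAdj P (b ^^ σ) (φ i) (φ j) → c.SAdj b i j
  inc : ∀ b i, (b, i) ∈ c.inc → i < c.n ∧ Inc P (b ^^ σ) (φ i)
  main : ∀ i j, (i, j) ∈ c.main → i < c.n ∧ j < c.n ∧ MainAdj P (φ i) (φ j)
  path : MPath P (M ++ [φ 0])
  offM : ∀ i < c.n, φ i ∉ M
  offH : ∀ i < c.n, φ i ∉ H
  disj : H.Disjoint M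
  light : c.hv = false → H = []
  heavy : c.hv = true → 2 < c.n ∧ MPath P (φ 1 :: (H ++ [φ 2]))

namespace Occurs

variable {P : Position 3} {c : Config} {σ : Bool} {φ : ℕ → ℕ} {M H : List ℕ}

/-- Local names are realised only when a strategy first uses them; a vertex that is fresh and
distinct from everything named is always available. -/
lemma extend_one (h : Occurs P c σ φ M H) :
    ∃ ψ, Occurs P { c with n := c.n + 1 } σ ψ M H := by
  obtain ⟨x, hx, hxn⟩ := exists_fresh h.bdd (M ++ H ++ (List.range c.n).map φ)
  simp only [List.mem_append, List.mem_map, List.mem_range, not_or, not_exists, not_and] at hxn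
  obtain ⟨⟨hxM, hxH⟩, hxφ⟩ := hxn
  have hlt : ∀ i, i < c.n → Function.update φ c.n x i = φ i := fun i hi =>
    Function.update_of_ne hi.ne _ _
  have hself : Function.update φ c.n x c.n = x := Function.update_self ..
  have hcase : ∀ i, i < c.n + 1 → i < c.n ∨ i = c.n := fun i hi => by omega
  refine ⟨Function.update φ c.n x, h.bdd, Nat.succ_pos _, ?_, ?_, ?_, ?_, ?_, ?_, ?_, h.disj,
    h.light, ?_⟩
  · intro i j hi hj hij
    rcases hcase i hi with hi | rfl <;> rcases hcase j hj with hj | rfl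
    · exact h.inj i j hi hj (by simpa [hlt _ hi, hlt _ hj] using hij)
    · rw [hlt _ hi, hself] at hij; exact absurd hij (hxφ i hi)
    · rw [hlt _ hj, hself] at hij; exact absurd hij.symm (hxφ j hj)
    · rfl
  · intro b i j hi hj hij
    rcases hcase i hi with hi | rfl
    · rcases hcase j hj with hj | rfl
      · exact h.adj b i j hi hj (by simpa [hlt _ hi, hlt _ hj] using hij)
      · rw [hself] at hij; exact absurd hij (hx.not_adj' _ _)
    · rw [hself] at hij; exact absurd hij (hx.not_adj _ _)
  · intro b i hi
    obtain ⟨h1, h2⟩ := h.inc b i hi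
    exact ⟨Nat.lt_succ_of_lt h1, by rwa [hlt _ h1]⟩
  · intro i j hij
    obtain ⟨h1, h2, h3⟩ := h.main i j hij
    exact ⟨Nat.lt_succ_of_lt h1, Nat.lt_succ_of_lt h2, by rwa [hlt _ h1, hlt _ h2]⟩
  · rw [hlt _ h.pos]; exact h.path
  · intro i hi
    rcases hcase i hi with hi | rfl
    · rw [hlt _ hi]; exact h.offM i hi
    · rwa [hself]
  · intro i hi
    rcases hcase i hi with hi | rfl
    · rw [hlt _ hi]; exact h.offH i hi
    · rwa [hself]
  · intro hv
    obtain ⟨h1, h2⟩ := h.heavy hv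
    exact ⟨Nat.lt_succ_of_lt h1, by rwa [hlt _ h1, hlt _ (by omega)]⟩

lemma extend (h : Occurs P c σ φ M H) (k : ℕ) :
    ∃ ψ, Occurs P { c with n := c.n + k } σ ψ M H := by
  induction k with
  | zero => exact ⟨φ, h⟩
  | succ k ih => obtain ⟨ψ, hψ⟩ := ih; exact hψ.extend_one

lemma extend_max (h : Occurs P c σ φ M H) (k : ℕ) :
    ∃ ψ, Occurs P { c with n := max c.n k } σ ψ M H := by
  obtain ⟨ψ, hψ⟩ := h.extend (max c.n k - c.n)
  rw [show c.n + (max c.n k - c.n) = max c.n k by omega] at hψ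
  exact ⟨ψ, hψ⟩

/-- Only the flag σ changes. This is what allows `smove` to answer both side colours with one
subtree. -/
lemma swap (h : Occurs P c σ φ M H) : Occurs P c.swap (!σ) φ M H := by
  have hx : ∀ b : Bool, (b ^^ !σ) = (!b ^^ σ) := by cases σ <;> decide
  refine ⟨h.bdd, h.pos, h.inj, ?_, ?_, h.main, h.path, h.offM, h.offH, h.disj, h.light, h.heavy⟩
  · intro b i j hi hj hij
    rw [hx] at hij
    rcases h.adj _ i j hi hj hij with h' | h'
    · exact Or.inl (List.mem_map.2 ⟨_, h', by simp⟩)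
    · exact Or.inr (List.mem_map.2 ⟨_, h', by simp⟩)
  · intro b i hi
    obtain ⟨⟨b', j⟩, he, heq⟩ := List.mem_map.1 hi
    simp only [Prod.mk.injEq] at heq
    obtain ⟨rfl, rfl⟩ := heq
    rw [hx]
    have := h.inc b' j he
    rwa [Bool.not_not]

lemma addMain {P' : Position 3} {u v : ℕ} (h : Occurs P { c with n := max c.n (max u v + 1) } σ φ M H)
    (hP : MainExt P P') (huv : MainAdj P' (φ u) (φ v)) : Occurs P' (c.addMain u v) σ φ M H := by
  refine ⟨hP.2.2, h.pos, h.inj, ?_, ?_, ?_, hP.mpath h.path, h.offM, h.offH, h.disj, h.light, ?_⟩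
  · intro b i j hi hj hij
    rw [hP.1] at hij
    exact h.adj b i j hi hj hij
  · intro b i hi
    rw [hP.inc]
    exact h.inc b i hi
  · intro i j hij
    rcases List.mem_cons.1 hij with hij | hij
    · obtain ⟨rfl, rfl⟩ := Prod.mk.inj hij
      exact ⟨show _ < max _ _ by omega, show _ < max _ _ by omega, huv⟩
    · obtain ⟨h1, h2, h3⟩ := h.main i j hij
      exact ⟨h1, h2, hP.2.1 _ _ h3⟩
  · intro hv
    exact ⟨(h.heavy hv).1, hP.mpath (h.heavy hv).2⟩

lemma addSide {P' : Position 3} {u v : ℕ} {b : Bool}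
    (h : Occurs P { c with n := max c.n (max u v + 1) } σ φ M H)
    (hP : SideStep P (b ^^ σ) (φ u) (φ v) P') : Occurs P' (c.addSide b u v) σ φ M H := by
  have hu : u < max c.n (max u v + 1) := by omega
  have hv : v < max c.n (max u v + 1) := by omega
  have hx : ∀ b' : Bool, (b' ^^ σ) = (b ^^ σ) → b' = b := by cases σ <;> cases b <;> decide
  refine ⟨hP.2.2, h.pos, h.inj, ?_, ?_, ?_, hP.mpath.2 h.path, h.offM, h.offH, h.disj, h.light, ?_⟩
  · intro b' i j hi hj hij
    rw [hP.1] at hij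
    rcases hij with hij | ⟨hb, ⟨h1, h2⟩ | ⟨h1, h2⟩⟩
    · rcases h.adj b' i j hi hj hij with h' | h'
      · exact Or.inl (List.mem_cons_of_mem _ h')
      · exact Or.inr (List.mem_cons_of_mem _ h')
    · rw [hx _ hb, h.inj _ _ hi hu h1, h.inj _ _ hj hv h2]
      exact Or.inl List.mem_cons_self
    · rw [hx _ hb, h.inj _ _ hi hv h1, h.inj _ _ hj hu h2]
      exact Or.inr List.mem_cons_self
  · intro b' i hi
    rw [hP.inc]
    simp only [Config.addSide, List.mem_cons, Prod.mk.injEq] at hi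
    rcases hi with ⟨rfl, rfl⟩ | ⟨rfl, rfl⟩ | hi
    · exact ⟨hu, Or.inr ⟨rfl, Or.inl rfl⟩⟩
    · exact ⟨hv, Or.inr ⟨rfl, Or.inr rfl⟩⟩
    · exact ⟨(h.inc b' i hi).1, Or.inl (h.inc b' i hi).2⟩
  · intro i j hij
    obtain ⟨h1, h2, h3⟩ := h.main i j hij
    exact ⟨h1, h2, (hP.2.1 _ _).2 h3⟩
  · intro hv
    exact ⟨(h.heavy hv).1, hP.mpath.2 (h.heavy hv).2⟩

lemma madj (h : Occurs P c σ φ M H) {i j : ℕ} (hij : c.MAdj i j) : MainAdj P (φ i) (φ j) := by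
  rcases hij with h' | h'
  · exact (h.main _ _ h').2.2
  · exact (h.main _ _ h').2.2.symm

lemma chain (h : Occurs P c σ φ M H) : ∀ q, pathCheck c q = true →
    (q.map φ).IsChain (MainAdj P) ∧ ∀ x ∈ q, x < c.n
  | [], _ => by simp
  | [a], ha => by simpa [pathCheck] using ha
  | a :: b :: q, ha => by
    simp only [pathCheck, Bool.and_eq_true, decide_eq_true_eq] at ha
    obtain ⟨h1, h2⟩ := h.chain (b :: q) ha.2
    refine ⟨?_, ?_⟩
    · simp only [List.map_cons, List.isChain_cons_cons] at h1 ⊢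
      exact ⟨h.madj ha.1.2, h1⟩
    · intro x hx
      rcases List.mem_cons.1 hx with rfl | hx
      · exact ha.1.1
      · exact h2 x hx

lemma nodup_map (h : Occurs P c σ φ M H) {q : List ℕ} (hq : q.Nodup) (hlt : ∀ x ∈ q, x < c.n) :
    (q.map φ).Nodup :=
  hq.map_on fun _ hx _ hy hxy => h.inj _ _ (hlt _ hx) (hlt _ hy) hxy

end Occurs

/-- Two chains that share the end of one and the start of the other form a chain. -/
lemma isChain_glue {R : ℕ → ℕ → Prop} {A B : List ℕ} {x : ℕ} (h₁ : (A ++ [x]).IsChain R)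
    (h₂ : (x :: B).IsChain R) : (A ++ x :: B).IsChain R := List.isChain_split.2 ⟨h₁, h₂⟩

/-- Induction on the strategy tree. The list `side` bounds the side-coloured adjacencies from above,
while `inc` and `main` bound what is present from below. So a move accepted by `check` is playable,
a colour skipped because of `Meets` really is unavailable to Painter, and the paths named at the
leaves really exist. -/
lemma wins_of_check {l : ℕ} : ∀ (t : Strategy) {c : Config} {m i : ℕ} {P : Position 3} {σ : Bool}
    {φ : ℕ → ℕ} {M H : List ℕ}, Occurs P c σ φ M H → check t c m i = true →
    l ≤ M.length + 1 + i + H.length → Wins l m P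
  | .none, _, _, _, _, _, _, _, _, _, hc, _ => by simp [check] at hc
  | .win q, c, m, i, P, σ, φ, M, H, h, hc, hl => by
    simp only [check, Bool.and_eq_true, decide_eq_true_eq, Bool.not_eq_true'] at hc
    obtain ⟨⟨⟨hv, hnd⟩, hp⟩, hi⟩ := hc
    obtain ⟨h1, h2⟩ := h.chain _ hp
    have hH := h.light hv
    subst hH
    refine wins_of_path (M := M ++ (0 :: q).map φ) ⟨?_, ?_⟩ ?_
    · exact isChain_glue h.path.1 h1
    · refine List.Nodup.append (List.Nodup.of_append_left h.path.2) (h.nodup_map hnd h2) ?_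
      intro x hx hx'
      obtain ⟨j, hj, rfl⟩ := List.mem_map.1 hx'
      exact h.offM j (h2 j hj) hx
    · simp at hl ⊢; omega
  | .heavy d p q, c, m, i, P, σ, φ, M, H, h, hc, hl => by
    simp only [check, Bool.and_eq_true, decide_eq_true_eq] at hc
    obtain ⟨⟨⟨⟨hv, hnd⟩, hp⟩, hq⟩, hi⟩ := hc
    obtain ⟨hn, hH⟩ := h.heavy hv
    obtain ⟨h1, h2⟩ := h.chain _ hp
    obtain ⟨h3, h4⟩ := h.chain _ hq
    -- The floating path is oriented so that it is entered at the end selected by `d`.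
    obtain ⟨K, hKl, hKc, hKp⟩ : ∃ K : List ℕ, K.length = H.length ∧
        (φ (cond d 1 2) :: (K ++ [φ (cond d 2 1)])).IsChain (MainAdj P) ∧ K.Perm H := by
      cases d
      · refine ⟨H.reverse, by simp, ?_, List.reverse_perm H⟩
        have := hH.reverse.1
        simpa using this
      · exact ⟨H, rfl, hH.1, List.Perm.refl H⟩
    refine wins_of_path
      (M := M ++ (0 :: p).map φ ++ φ (cond d 1 2) :: (K ++ φ (cond d 2 1) :: q.map φ)) ⟨?_, ?_⟩ ?_
    · refine isChain_glue ?_ ?_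
      · have := isChain_glue (B := p.map φ ++ [φ (cond d 1 2)]) h.path.1 (by simpa using h1)
        simpa using this
      · exact isChain_glue (A := φ (cond d 1 2) :: K) (by simpa using hKc) (by simpa using h3)
    · have hperm : (M ++ (0 :: p).map φ ++ φ (cond d 1 2) :: (K ++ φ (cond d 2 1) :: q.map φ)).Perm
          ((0 :: p ++ 1 :: 2 :: q).map φ ++ (H ++ M)) := by
        have hc : ∀ x, K.count x = H.count x := fun x => hKp.count_eq x
        rw [List.perm_iff_count]
        intro x
        cases d <;> simp [List.count_append, List.count_cons, hc] <;> omega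
      rw [hperm.nodup_iff]
      have hlt : ∀ x ∈ 0 :: p ++ 1 :: 2 :: q, x < c.n := by
        intro x hx
        simp only [List.cons_append, List.mem_cons, List.mem_append] at hx
        rcases hx with rfl | hx | rfl | rfl | hx
        · exact h.pos
        · exact h2 x (by simp [hx])
        · omega
        · omega
        · exact h4 x (by simp [hx])
      refine List.Nodup.append (h.nodup_map hnd hlt) (List.Nodup.append ?_
        (List.Nodup.of_append_left h.path.2) h.disj) ?_
      · exact List.Nodup.of_append_left (List.nodup_cons.1 hH.2).2
      · intro x hx hx'
        obtain ⟨j, hj, rfl⟩ := List.mem_map.1 hx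
        rcases List.mem_append.1 hx' with hx' | hx'
        · exact h.offH j (hlt j hj) hx'
        · exact h.offM j (hlt j hj) hx'
    · simp [hKl]; omega
  | .move u v r b g, c, m, i, P, σ, φ, M, H, h, hc, hl => by
    cases m with
    | zero => simp [check] at hc
    | succ m =>
    simp only [check, Bool.and_eq_true, Bool.or_eq_true, decide_eq_true_eq] at hc
    obtain ⟨⟨⟨⟨huv, hna⟩, hr⟩, hb⟩, hg⟩ := hc
    obtain ⟨ψ, hψ⟩ := h.extend_max (max u v + 1)
    have hu : u < max c.n (max u v + 1) := by omega
    have hv : v < max c.n (max u v + 1) := by omega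
    refine wins_step h.bdd (fun hh => huv (hψ.inj _ _ hu hv hh)) ?_ ?_ ?_
    · intro b' hb'
      have := hψ.adj (b' ^^ σ) u v hu hv (by simpa using hb')
      exact hna _ this
    · intro b' P' hbu hbv hs
      obtain ⟨b'', rfl⟩ : ∃ b'', b' = (b'' ^^ σ) := ⟨b' ^^ σ, by simp⟩
      have hm : ¬ c.Meets b'' u v := by
        rintro (hm | hm)
        · exact hbu (hψ.inc _ _ hm).2
        · exact hbv (hψ.inc _ _ hm).2
      cases b''
      · exact wins_of_check r (hψ.addSide hs) (hr.resolve_left hm) hl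
      · exact wins_of_check b (hψ.addSide hs) (hb.resolve_left hm) hl
    · intro P' hP' hmain
      exact wins_of_check g (hψ.addMain hP' hmain) hg hl
  | .smove u v r g, c, m, i, P, σ, φ, M, H, h, hc, hl => by
    cases m with
    | zero => simp [check] at hc
    | succ m =>
    simp only [check, Bool.and_eq_true, decide_eq_true_eq] at hc
    obtain ⟨⟨⟨⟨huv, hna⟩, hr⟩, hb⟩, hg⟩ := hc
    obtain ⟨ψ, hψ⟩ := h.extend_max (max u v + 1)
    have hu : u < max c.n (max u v + 1) := by omega
    have hv : v < max c.n (max u v + 1) := by omega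
    refine wins_step h.bdd (fun hh => huv (hψ.inj _ _ hu hv hh)) ?_ ?_ ?_
    · intro b' hb'
      have := hψ.adj (b' ^^ σ) u v hu hv (by simpa using hb')
      exact hna _ this
    · intro b' P' hbu hbv hs
      obtain ⟨b'', rfl⟩ : ∃ b'', b' = (b'' ^^ σ) := ⟨b' ^^ σ, by simp⟩
      cases b''
      · exact wins_of_check r (hψ.addSide hs) hr hl
      · exact wins_of_check r (hψ.addSide hs).swap hb hl
    · intro P' hP' hmain
      exact wins_of_check g (hψ.addMain hP' hmain) hg hl

/-! ### Initial configurations and strategy trees. -/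

/-- The main path ends in a fresh vertex. -/
def freshConfig : Config := ⟨1, [], [], [], false⟩

/-- The main path ends in a fresh vertex, and a floating path has fresh ends. -/
def floatConfig : Config := ⟨3, [], [], [], true⟩

/-- The main path ends in a fresh vertex, and another vertex meets a side colour. -/
def singleConfig : Config := ⟨2, [], [(false, 1)], [], false⟩

/-- The main path ends in a fresh vertex, and a floating path has a saturated and a fresh end. -/
def spareConfig : Config := ⟨3, [], [(false, 1), (true, 1)], [], true⟩

/-- As `spareConfig`, with another vertex that meets a side colour. -/
def spareSingleConfig : Config := ⟨4, [], [(false, 1), (true, 1), (false, 3)], [], true⟩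

/-- As `spareConfig`, with the middle vertex of a path on three vertices attached to the saturated
end. -/
def spareCapConfig : Config :=
  ⟨6, [(false, 1, 3), (true, 1, 3)], [(false, 1), (true, 1), (true, 3)], [(3, 4), (3, 5)], true⟩

/-- The end of the main path meets a side-coloured edge, the other end of which starts a path on two
vertices in the path colour, and there is a floating path with fresh ends. -/
def stemConfig : Config :=
  ⟨5, [(false, 0, 3), (true, 0, 3)], [(false, 0), (false, 3)], [(3, 4)], true⟩

/-- Lengthening a main path with a fresh end by 1. -/
def freshStrategy1 : Strategy :=
  .smove 0 1 (.move 0 2 .none (.move 0 3 .none .none (.win [3])) (.win [2])) (.win [1])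

/-- Lengthening a main path with a fresh end by 2. -/
def freshStrategy2 : Strategy :=
  .smove 0 1 (.move 0 2 .none (.move 0 3 .none .none (.move 1 4 .none (.move 1 3 .none .none (.win
    [3, 1])) (.move 0 4 .none .none (.win [4, 1])))) (.move 1 2 .none (.move 2 3 (.move 2 4 .none
    .none (.win [2, 4])) .none (.win [2, 3])) (.win [2, 1]))) (.smove 1 2 (.move 1 3 .none (.move 1
    4 .none .none (.win [1, 4])) (.win [1, 3])) (.win [1, 2]))

/-- Lengthening a main path with a fresh end by 3. -/
def freshStrategy3 : Strategy :=
  .smove 0 1 (.move 1 2 .none (.move 1 3 .none .none (.move 1 4 .none .none (.move 0 3 .none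
    (.move 0 4 .none .none (.win [4, 1, 3])) (.win [3, 1, 4])))) (.move 1 3 .none (.move 1 4 .none
    .none (.move 0 2 .none (.move 0 4 .none .none (.win [4, 1, 2])) (.win [2, 1, 4]))) (.move 0 2
    .none (.move 0 3 .none .none (.win [3, 1, 2])) (.win [2, 1, 3])))) (.smove 1 2 (.move 1 3 .none
    (.move 1 4 .none .none (.move 2 5 .none (.move 2 4 .none .none (.win [1, 4, 2])) (.move 1 5
    .none .none (.win [1, 5, 2])))) (.move 2 3 .none (.move 3 4 (.move 3 5 .none .none (.win [1, 3,
    5])) .none (.win [1, 3, 4])) (.win [1, 3, 2]))) (.smove 2 3 (.move 2 4 .none (.move 2 5 .none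
    .none (.win [1, 2, 5])) (.win [1, 2, 4])) (.win [1, 2, 3])))

/-- Lengthening a main path with a fresh end by 4. -/
def freshStrategy4 : Strategy :=
  .smove 1 2 (.move 0 1 .none (.move 0 2 .none .none (.move 1 3 .none .none (.move 1 4 .none .none
    (.move 2 3 .none (.move 2 4 .none .none (.win [2, 4, 1, 3])) (.win [2, 3, 1, 4]))))) (.move 2 3
    .none (.move 2 4 .none .none (.move 2 5 .none .none (.move 1 4 .none (.move 1 5 .none .none
    (.win [1, 5, 2, 4])) (.win [1, 4, 2, 5])))) (.move 2 4 .none (.move 2 5 .none .none (.move 1 3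
    .none (.move 1 5 .none .none (.win [1, 5, 2, 3])) (.win [1, 3, 2, 5]))) (.move 1 3 .none (.move
    1 4 .none .none (.win [1, 4, 2, 3])) (.win [1, 3, 2, 4]))))) (.smove 0 3 (.move 1 3 .none (.move
    0 1 .none .none (.move 2 3 .none .none (.move 3 4 .none .none (.win [1, 2, 3, 4])))) (.move 3 4
    .none (.move 3 5 .none .none (.move 0 2 .none (.move 0 5 .none .none (.win [5, 3, 1, 2])) (.win
    [2, 1, 3, 5]))) (.move 0 2 .none (.move 0 4 .none .none (.win [4, 3, 1, 2])) (.win [2, 1, 3,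
    4])))) (.smove 1 3 (.move 1 4 .none (.move 1 5 .none .none (.move 2 3 .none (.move 3 5 .none
    .none (.win [3, 5, 1, 2])) (.win [3, 2, 1, 5]))) (.move 2 3 .none (.move 3 4 .none .none (.win
    [3, 4, 1, 2])) (.win [3, 2, 1, 4]))) (.smove 2 4 (.move 2 5 .none (.move 2 6 .none .none (.win
    [3, 1, 2, 6])) (.win [3, 1, 2, 5])) (.win [3, 1, 2, 4]))))

/-- Joining a floating path to the main path with parameter 1. -/
def floatStrategy1 : Strategy :=
  .smove 0 1 (.move 1 3 .none (.move 0 4 .none (.move 0 2 .none .none (.heavy false [] [])) (.move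
    1 4 .none .none (.heavy true [4] []))) (.move 0 2 .none (.move 0 3 .none .none (.heavy true [3]
    [])) (.heavy false [] []))) (.heavy true [] [])

/-- Joining a floating path to the main path with parameter 2. -/
def floatStrategy2 : Strategy :=
  .smove 0 1 (.move 1 3 .none (.move 1 4 .none .none (.move 0 2 .none (.move 0 4 .none .none
    (.heavy true [4] [])) (.heavy false [] [4]))) (.move 0 2 .none (.move 0 3 .none .none (.heavy
    true [3] [])) (.heavy false [] [3]))) (.smove 2 3 (.move 2 4 .none (.move 2 5 .none .none
    (.heavy true [] [5])) (.heavy true [] [4])) (.heavy true [] [3]))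

/-- Joining a floating path to the main path with parameter 3. -/
def floatStrategy3 : Strategy :=
  .smove 0 3 (.move 1 3 .none (.move 0 1 .none .none (.move 2 3 .none .none (.move 3 4 .none .none
    (.heavy true [] [3, 4])))) (.move 3 4 .none (.move 3 5 .none .none (.move 0 2 .none (.move 0 5
    .none .none (.heavy true [5, 3] [])) (.heavy false [] [3, 5]))) (.move 0 2 .none (.move 0 4
    .none .none (.heavy true [4, 3] [])) (.heavy false [] [3, 4])))) (.smove 1 3 (.move 1 4 .none
    (.move 1 5 .none .none (.move 2 3 .none (.move 3 5 .none .none (.heavy true [3, 5] [])) (.heavy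
    false [3] [5]))) (.move 2 3 .none (.move 3 4 .none .none (.heavy true [3, 4] [])) (.heavy false
    [3] [4]))) (.smove 2 4 (.move 2 5 .none (.move 2 6 .none .none (.heavy true [3] [6])) (.heavy
    true [3] [5])) (.heavy true [3] [4])))

/-- Joining a floating path to the main path with parameter 4. -/
def floatStrategy4 : Strategy :=
  .smove 3 4 (.move 0 3 .none (.move 0 4 .none .none (.move 1 3 .none .none (.move 3 5 .none .none
    (.move 2 4 .none (.move 4 5 .none .none (.heavy true [4, 5, 3] [])) (.heavy false [4] [3,
    5]))))) (.move 1 4 .none (.move 1 3 .none .none (.move 2 4 .none .none (.move 4 5 .none .none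
    (.heavy true [3] [4, 5])))) (.move 4 5 .none (.move 4 6 .none .none (.move 2 3 .none (.move 3 6
    .none .none (.heavy true [3, 6, 4] [])) (.heavy false [3] [4, 6]))) (.move 2 3 .none (.move 3 5
    .none .none (.heavy true [3, 5, 4] [])) (.heavy false [3] [4, 5]))))) (.smove 1 5 (.move 0 5
    .none (.move 0 1 .none .none (.move 2 5 .none .none (.move 3 5 .none .none (.heavy true [] [5,
    3, 4])))) (.move 1 3 .none (.move 1 4 .none .none (.move 3 5 .none .none (.heavy true [5, 3, 4]
    []))) (.move 2 5 .none (.move 4 5 .none .none (.heavy true [5, 4, 3] [])) (.heavy false [5] [3,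
    4])))) (.smove 0 3 (.move 2 3 .none (.move 0 2 .none .none (.move 3 5 .none .none (.heavy false
    [] [5, 3, 4]))) (.move 0 4 .none (.move 0 5 .none .none (.heavy true [5] [3, 4])) (.heavy false
    [4, 3] [5]))) (.smove 2 4 (.move 4 5 .none (.move 1 4 .none .none (.move 2 5 .none .none (.heavy
    true [3, 4] [5]))) (.heavy true [3, 4, 5] [])) (.heavy false [3, 4] [5]))))

/-- Lengthening by 1 with the help of a vertex that meets one side colour. -/
def singleStrategy1 : Strategy :=
  .move 0 1 .none (.move 0 2 (.move 0 3 .none .none (.win [3])) .none (.win [2])) (.win [1])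

/-- Lengthening by 2 with the help of a vertex that meets one side colour. -/
def singleStrategy2 : Strategy :=
  .move 0 1 .none (.move 1 2 .none .none (.move 0 3 (.move 0 2 .none .none (.win [2, 1])) .none
    (.move 1 3 .none .none (.win [3, 1])))) (.move 1 2 .none (.move 1 3 .none .none (.win [1, 3]))
    (.win [1, 2]))

/-- Lengthening by 3 with the help of a vertex that meets one side colour. -/
def singleStrategy3 : Strategy :=
  .move 0 1 .none (.move 1 2 .none .none (.move 1 3 .none .none (.move 0 2 (.move 0 3 .none .none
    (.win [3, 1, 2])) .none (.win [2, 1, 3])))) (.move 1 2 .none (.move 1 3 .none .none (.move 2 4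
    (.move 2 3 .none .none (.win [1, 3, 2])) .none (.move 1 4 .none .none (.win [1, 4, 2])))) (.move
    2 3 (.move 2 4 .none (.move 2 5 .none .none (.win [1, 2, 5])) (.win [1, 2, 4])) (.move 2 4
    (.move 2 5 .none .none (.win [1, 2, 5])) .none (.win [1, 2, 4])) (.win [1, 2, 3])))

/-- Lengthening by 4 with the help of a vertex that meets one side colour. -/
def singleStrategy4 : Strategy :=
  .move 1 2 .none (.move 0 1 .none .none (.move 1 3 .none .none (.move 2 4 (.move 2 3 .none .none
    (.move 2 5 .none .none (.win [1, 3, 2, 5]))) .none (.move 0 2 (.move 2 3 .none .none (.win [1,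
    3, 2, 4])) .none (.move 1 4 .none .none (.win [2, 4, 1, 3])))))) (.move 2 3 (.move 0 3 .none
    (.move 0 2 .none .none (.move 1 3 .none .none (.move 3 4 .none .none (.win [2, 1, 3, 4]))))
    (.move 1 3 .none (.move 1 4 .none .none (.move 3 4 .none .none (.win [3, 4, 1, 2]))) (.move 2 4
    .none (.move 2 5 .none .none (.win [3, 1, 2, 5])) (.win [3, 1, 2, 4])))) (.move 1 3 .none .none
    (.move 0 2 (.move 0 3 .none .none (.move 2 4 .none .none (.win [3, 1, 2, 4]))) .none (.move 3 4
    (.move 3 5 .none .none (.win [2, 1, 3, 5])) .none (.win [2, 1, 3, 4])))) (.move 0 1 .none (.move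
    1 4 .none .none (.move 0 3 (.move 0 4 .none .none (.win [4, 1, 2, 3])) .none (.win [3, 2, 1,
    4]))) (.move 3 4 (.move 3 5 .none (.move 3 6 .none .none (.win [1, 2, 3, 6])) (.win [1, 2, 3,
    5])) (.move 3 5 (.move 3 6 .none .none (.win [1, 2, 3, 6])) .none (.win [1, 2, 3, 5])) (.win [1,
    2, 3, 4]))))

/-- Using a spare block, target 4. -/
def spareStrategy4 : Strategy :=
  .move 1 3 .none .none (.smove 0 2 (.move 0 4 .none (.move 0 3 .none .none (.move 2 4 .none .none
    (.heavy true [3] [4]))) (.move 2 3 .none (.move 2 4 .none .none (.heavy false [4] [3])) (.move 1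
    4 .none .none (.heavy true [4] [3])))) (.smove 3 4 (.move 3 5 .none (.move 3 6 .none .none
    (.heavy false [] [3, 6])) (.heavy false [] [3, 5])) (.heavy false [] [3, 4])))

/-- Using a spare block, target 5. -/
def spareStrategy5 : Strategy :=
  .move 1 3 .none .none (.smove 4 5 (.move 2 4 .none (.move 0 4 .none .none (.move 2 5 .none .none
    (.move 3 4 .none .none (.heavy true [4, 3] [5])))) (.move 0 5 .none (.move 0 4 .none .none
    (.move 3 5 .none .none (.heavy false [4] [3, 5]))) (.move 3 4 .none (.move 3 5 .none .none
    (.heavy true [5, 3] [4])) (.move 1 5 .none .none (.heavy true [5] [4, 3]))))) (.smove 0 3 (.move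
    3 4 .none (.move 0 4 .none .none (.move 3 5 .none .none (.heavy true [4, 5, 3] []))) (.move 0 2
    .none (.move 0 5 .none .none (.heavy true [5, 4, 3] [])) (.heavy false [] [3, 4, 5]))) (.smove 2
    3 (.move 2 4 .none (.move 2 5 .none .none (.heavy true [3] [5, 4])) (.heavy true [3] [4, 5]))
    (.move 1 4 .none .none (.heavy false [3] [4, 5])))))

/-- Using a spare block and a vertex that meets one side colour. -/
def spareSingleStrategy : Strategy :=
  .move 0 1 .none .none (.move 0 3 .none (.move 2 3 .none .none (.heavy true [] [3])) (.move 1 3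
    .none .none (.heavy true [3] [])))

/-- Using a spare block and a capped vertex. -/
def spareCapStrategy : Strategy :=
  .move 0 1 .none .none (.move 0 2 (.move 2 4 .none (.move 2 5 .none .none (.heavy true [] [5, 3,
    4])) (.heavy true [] [4, 3, 5])) (.move 2 4 (.move 2 5 .none .none (.heavy true [] [5, 3, 4]))
    .none (.heavy true [] [4, 3, 5])) (.move 1 4 .none .none (.heavy false [] [4, 3, 5])))

/-- Using a floating path and a stem, target 6. -/
def stemStrategy5 : Strategy :=
  .move 0 5 .none (.move 0 1 .none .none (.move 3 5 .none .none (.move 2 5 (.move 5 6 .none .none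
    (.move 2 4 .none (.move 2 6 .none .none (.heavy true [] [6, 5, 3, 4])) (.heavy true [] [4, 3, 5,
    6]))) .none (.move 4 5 (.move 4 6 .none (.move 4 7 .none .none (.heavy true [] [5, 3, 4, 7]))
    (.heavy true [] [5, 3, 4, 6])) .none (.move 3 6 .none (.move 3 7 .none .none (.heavy true [] [5,
    4, 3, 7])) (.heavy true [] [5, 4, 3, 6])))))) (.move 3 6 .none (.move 1 3 .none .none (.move 3 5
    .none .none (.move 2 6 (.move 1 6 .none .none (.move 4 6 .none .none (.heavy true [5, 3, 4, 6]
    []))) .none (.move 4 6 (.move 5 6 .none .none (.heavy false [5, 6] [3, 4])) .none (.heavy true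
    [5, 3] [6, 4]))))) (.move 1 5 (.move 1 4 .none (.move 1 6 .none .none (.move 4 5 .none .none
    (.heavy true [5, 4, 3, 6] []))) (.move 2 5 .none (.move 5 6 .none .none (.heavy true [5, 6, 3,
    4] [])) (.heavy false [5] [4, 3, 6]))) (.move 1 4 (.move 1 6 .none .none (.move 4 5 .none .none
    (.heavy true [5, 4, 3, 6] []))) .none (.move 2 5 (.move 5 6 .none .none (.heavy true [5, 6, 3,
    4] [])) .none (.heavy false [5] [4, 3, 6]))) (.move 2 4 (.move 2 6 .none (.move 2 3 .none .none
    (.move 4 6 .none .none (.heavy true [5] [3, 4, 6]))) (.heavy true [5] [6, 3, 4])) (.move 2 3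
    .none .none (.move 2 6 (.move 4 6 .none .none (.heavy true [5] [3, 4, 6])) .none (.heavy true
    [5] [6, 3, 4]))) (.heavy true [5] [4, 3, 6]))))

/-- Using a floating path and a stem, target 7. -/
def stemStrategy6 : Strategy :=
  .move 0 5 .none (.move 0 1 .none .none (.move 2 5 (.move 5 6 .none .none (.move 5 7 .none .none
    (.move 3 6 .none (.move 2 6 .none .none (.move 3 7 .none .none (.heavy true [] [6, 5, 7, 3,
    4]))) (.move 2 4 .none (.move 2 7 .none .none (.heavy true [] [7, 5, 6, 3, 4])) (.heavy true []
    [4, 3, 6, 5, 7]))))) .none (.move 3 6 .none (.move 3 7 .none .none (.move 4 6 (.move 4 5 .none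
    .none (.move 6 7 .none .none (.heavy true [] [5, 4, 3, 7, 6]))) .none (.move 5 6 (.move 5 7
    .none .none (.heavy true [] [5, 7, 3, 4, 6])) .none (.heavy true [] [5, 6, 4, 3, 7])))) (.move 4
    5 (.move 5 6 .none .none (.move 4 7 .none (.move 4 8 .none .none (.heavy true [] [5, 6, 3, 4,
    8])) (.heavy true [] [5, 6, 3, 4, 7]))) .none (.move 6 7 (.move 6 8 .none (.move 6 9 .none .none
    (.heavy true [] [5, 4, 3, 6, 9])) (.heavy true [] [5, 4, 3, 6, 8])) (.move 6 8 (.move 6 9 .none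
    .none (.heavy true [] [5, 4, 3, 6, 9])) .none (.heavy true [] [5, 4, 3, 6, 8])) (.heavy true []
    [5, 4, 3, 6, 7])))))) (.move 3 6 .none (.move 1 3 .none .none (.move 2 6 (.move 4 6 .none .none
    (.move 5 6 .none .none (.move 2 7 .none (.move 2 8 .none .none (.heavy true [5, 6, 4, 3] [8]))
    (.heavy true [5, 6, 4, 3] [7])))) .none (.move 5 6 (.move 6 7 .none .none (.move 4 5 .none
    (.move 5 7 .none .none (.heavy false [5, 7, 6] [3, 4])) (.heavy true [5, 4, 3] [6, 7]))) .none
    (.move 4 7 (.move 4 8 .none (.move 4 9 .none .none (.heavy false [5, 6] [3, 4, 9])) (.heavy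
    false [5, 6] [3, 4, 8])) (.move 4 8 (.move 4 9 .none .none (.heavy false [5, 6] [3, 4, 9]))
    .none (.heavy false [5, 6] [3, 4, 8])) (.heavy false [5, 6] [3, 4, 7]))))) (.move 1 7 (.move 5 7
    .none (.move 1 5 .none .none (.move 2 7 .none .none (.move 4 7 .none .none (.heavy true [5] [7,
    4, 3, 6])))) (.move 1 4 .none (.move 1 6 .none .none (.move 4 7 .none .none (.heavy true [5, 7,
    4, 3, 6] []))) (.move 2 7 .none (.move 6 7 .none .none (.heavy true [5, 7, 6, 3, 4] [])) (.heavy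
    false [5, 7] [4, 3, 6])))) (.move 5 7 (.move 1 5 .none .none (.move 2 7 .none .none (.move 4 7
    .none .none (.heavy true [5] [7, 4, 3, 6])))) .none (.move 1 4 (.move 1 6 .none .none (.move 4 7
    .none .none (.heavy true [5, 7, 4, 3, 6] []))) .none (.move 2 7 (.move 6 7 .none .none (.heavy
    true [5, 7, 6, 3, 4] [])) .none (.heavy false [5, 7] [4, 3, 6])))) (.move 2 5 (.move 2 4 .none
    (.move 2 6 .none .none (.move 4 5 .none .none (.heavy false [5, 4, 3, 6] [7]))) (.move 5 6 .none
    (.move 5 7 .none .none (.heavy true [5, 7] [4, 3, 6])) (.heavy false [5, 6, 3, 4] [7]))) (.move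
    2 4 (.move 2 6 .none .none (.move 4 5 .none .none (.heavy false [5, 4, 3, 6] [7]))) .none (.move
    5 6 (.move 5 7 .none .none (.heavy true [5, 7] [4, 3, 6])) .none (.heavy false [5, 6, 3, 4]
    [7]))) (.move 4 7 (.move 6 7 .none (.move 3 7 .none .none (.move 4 6 .none .none (.heavy false
    [5] [7, 3, 4, 6]))) (.heavy false [5] [7, 6, 3, 4])) (.move 3 7 .none .none (.move 4 6 (.move 4
    8 .none .none (.heavy false [5] [7, 3, 4, 8])) .none (.heavy false [5] [7, 3, 4, 6]))) (.heavy
    false [5] [7, 4, 3, 6])))))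

/-! ### Recognising the configurations in a position. -/

/-- The last vertex of `Q` meets no side colour. -/
def EndsFresh (P : Position 3) (Q : List ℕ) : Prop := ∃ M e, Q = M ++ [e] ∧ Fresh P e

section

variable {P : Position 3} {l m i : ℕ} {t : Strategy} {M H Q : List ℕ} {e : ℕ}

/-- A configuration occurs if its vertices are `e` and those listed in `V`. -/
lemma occurs_of_list {c : Config} {σ : Bool} {V : List ℕ} (hP : Bdd P) (hn : c.n = V.length + 1)
    (hM : MPath P (M ++ [e])) (hV : (M ++ e :: V).Nodup)
    (hadj : ∀ b i j, i < c.n → j < c.n → i < j →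
      SideAdj P (b ^^ σ) ((e :: V).getD i 0) ((e :: V).getD j 0) → c.SAdj b i j)
    (hinc : ∀ b i, (b, i) ∈ c.inc → i < c.n ∧ Inc P (b ^^ σ) ((e :: V).getD i 0))
    (hmain : ∀ i j, (i, j) ∈ c.main → i < c.n ∧ j < c.n ∧
      MainAdj P ((e :: V).getD i 0) ((e :: V).getD j 0)) (hH : H.Disjoint (M ++ e :: V))
    (hlight : c.hv = false → H = [])
    (hheavy : c.hv = true → 2 < c.n ∧
      MPath P ((e :: V).getD 1 0 :: (H ++ [(e :: V).getD 2 0]))) :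
    Occurs P c σ (fun i => (e :: V).getD i 0) M H := by
  have hget : ∀ i, i < c.n → ∃ h : i < (e :: V).length, (e :: V).getD i 0 = (e :: V)[i] := by
    intro i hi
    have h : i < (e :: V).length := by simpa [hn] using hi
    exact ⟨h, List.getD_eq_getElem _ _ h⟩
  have hnd := List.nodup_append.1 hV
  have hinj : ∀ i j, i < c.n → j < c.n → (e :: V).getD i 0 = (e :: V).getD j 0 → i = j := by
    intro i j hi hj hij
    obtain ⟨h1, h2⟩ := hget i hi
    obtain ⟨h3, h4⟩ := hget j hj
    rw [h2, h4] at hij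
    exact (List.Nodup.getElem_inj_iff hnd.2.1).1 hij
  refine ⟨hP, by omega, hinj, ?_, hinc, hmain, hM, ?_, ?_, ?_, hlight, hheavy⟩
  · intro b i j hi hj hij
    rcases lt_trichotomy i j with h | h | h
    · exact hadj b i j hi hj h hij
    · exact absurd (by rw [h]) hij.ne
    · exact (hadj b j i hj hi h hij.symm).symm
  · intro i hi h
    obtain ⟨h1, h2⟩ := hget i hi
    exact hnd.2.2 _ h _ (by simp only [h2]; exact List.getElem_mem h1) rfl
  · intro i hi h
    obtain ⟨h1, h2⟩ := hget i hi
    refine hH h (List.mem_append_right _ ?_)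
    simp only [h2]
    exact List.getElem_mem h1
  · exact fun x hx hx' => hH hx (List.mem_append_left _ hx')

lemma wins_freshConfig (hP : Bdd P) (hQ : MPath P Q) (he : EndsFresh P Q) (hl : l ≤ Q.length + i)
    (hc : check t freshConfig m i = true) : Wins l m P := by
  obtain ⟨M, e, rfl, he⟩ := he
  refine wins_of_check t (occurs_of_list (σ := false) (V := []) (H := []) hP rfl hQ hQ.2 ?_
    (by simp [freshConfig]) (by simp [freshConfig]) (by simp) (by simp)
    (by simp [freshConfig])) hc (by simpa using hl)
  intro b i j hi hj hij
  simp only [freshConfig] at hi hj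
  omega

lemma wins_singleConfig {b : Bool} {w : ℕ} (hP : Bdd P) (hQ : MPath P Q)
    (he : EndsFresh P Q) (hn : (Q ++ [w]).Nodup) (hw : Inc P b w) (hl : l ≤ Q.length + i)
    (hc : check t singleConfig m i = true) : Wins l m P := by
  obtain ⟨M, e, rfl, he⟩ := he
  refine wins_of_check t (occurs_of_list (σ := b) (V := [w]) (H := []) hP rfl hQ (by simpa using hn) ?_
    ?_ (by simp [singleConfig]) (by simp) (by simp)
    (by simp [singleConfig])) hc (by simpa using hl)
  · intro b i j hi hj hij h
    simp only [singleConfig] at hi hj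
    interval_cases j <;> interval_cases i
    exact absurd h (he.not_adj _ _)
  · intro b i h
    simp only [singleConfig, List.mem_singleton, Prod.mk.injEq] at h ⊢
    obtain ⟨rfl, rfl⟩ := h
    simpa using hw

/-- Nodup from multiplicities. -/
lemma nodup_of_count {A B : List ℕ} (h : B.Nodup) (hc : ∀ x, A.count x ≤ B.count x) : A.Nodup :=
  List.nodup_iff_count_le_one.2 fun x => (hc x).trans (List.nodup_iff_count_le_one.1 h x)

lemma disjoint_of_nodup {A B : List ℕ} (h : (A ++ B).Nodup) : A.Disjoint B :=
  List.disjoint_of_nodup_append h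

lemma wins_floatConfig {x z : ℕ} (hP : Bdd P) (hQ : MPath P Q) (he : EndsFresh P Q)
    (hH : MPath P (x :: (H ++ [z]))) (hx : Fresh P x)
    (hn : (Q ++ x :: (H ++ [z])).Nodup) (hl : l ≤ Q.length + i + H.length)
    (hc : check t floatConfig m i = true) : Wins l m P := by
  obtain ⟨M, e, rfl, he⟩ := he
  refine wins_of_check t (occurs_of_list (σ := false) (V := [x, z]) (H := H) hP rfl hQ
    (nodup_of_count hn fun x => by simp [List.count_cons]) ?_
    (by simp [floatConfig]) (by simp [floatConfig])
    (disjoint_of_nodup (nodup_of_count hn fun x => by simp [List.count_cons]; omega))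
    (by simp [floatConfig]) (fun _ => ⟨by simp [floatConfig], hH⟩)) hc (by simpa using hl)
  intro b i j hi hj hij h
  simp only [floatConfig] at hi hj
  interval_cases j <;> interval_cases i
  · exact absurd h (he.not_adj _ _)
  · exact absurd h (he.not_adj _ _)
  · exact absurd h (hx.not_adj _ _)

lemma wins_spareConfig {x z : ℕ} (hP : Bdd P) (hQ : MPath P Q) (he : EndsFresh P Q)
    (hH : MPath P (x :: (H ++ [z]))) (hx : Sat P x) (hz : Fresh P z)
    (hn : (Q ++ x :: (H ++ [z])).Nodup) (hl : l ≤ Q.length + i + H.length)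
    (hc : check t spareConfig m i = true) : Wins l m P := by
  obtain ⟨M, e, rfl, he⟩ := he
  refine wins_of_check t (occurs_of_list (σ := false) (V := [x, z]) (H := H) hP rfl hQ
    (nodup_of_count hn fun x => by simp [List.count_cons]) ?_
    ?_ (by simp [spareConfig])
    (disjoint_of_nodup (nodup_of_count hn fun x => by simp [List.count_cons]; omega))
    (by simp [spareConfig]) (fun _ => ⟨by simp [spareConfig], hH⟩)) hc (by simpa using hl)
  · intro b i j hi hj hij h
    simp only [spareConfig] at hi hj
    interval_cases j <;> interval_cases i
    · exact absurd h (he.not_adj _ _)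
    · exact absurd h (he.not_adj _ _)
    · exact absurd h (hz.not_adj' _ _)
  · intro b i h
    simp only [spareConfig, List.mem_cons, Prod.mk.injEq, List.not_mem_nil, or_false] at h ⊢
    rcases h with ⟨rfl, rfl⟩ | ⟨rfl, rfl⟩ <;> simpa using hx _

lemma wins_spareSingleConfig {b : Bool} {x z w : ℕ} (hP : Bdd P) (hQ : MPath P Q)
    (he : EndsFresh P Q) (hH : MPath P (x :: (H ++ [z]))) (hx : Sat P x) (hz : Fresh P z)
    (hw : Inc P b w) (hxw : ∀ b, ¬ SideAdj P b x w)
    (hn : (Q ++ w :: x :: (H ++ [z])).Nodup) (hl : l ≤ Q.length + i + H.length)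
    (hc : check t spareSingleConfig m i = true) : Wins l m P := by
  obtain ⟨M, e, rfl, he⟩ := he
  refine wins_of_check t (occurs_of_list (σ := b) (V := [x, z, w]) (H := H) hP rfl hQ
    (nodup_of_count hn fun x => by simp [List.count_cons]; omega) ?_
    ?_ (by simp [spareSingleConfig])
    (disjoint_of_nodup (nodup_of_count hn fun x => by simp [List.count_cons]; omega))
    (by simp [spareSingleConfig]) (fun _ => ⟨by simp [spareSingleConfig], hH⟩)) hc (by simpa using hl)
  · intro b i j hi hj hij h
    simp only [spareSingleConfig] at hi hj
    interval_cases j <;> interval_cases i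
    · exact absurd h (he.not_adj _ _)
    · exact absurd h (he.not_adj _ _)
    · exact absurd h (hz.not_adj' _ _)
    · exact absurd h (he.not_adj _ _)
    · exact absurd h (hxw _)
    · exact absurd h (hz.not_adj _ _)
  · intro b i h
    simp only [spareSingleConfig, List.mem_cons, Prod.mk.injEq, List.not_mem_nil, or_false] at h ⊢
    rcases h with ⟨rfl, rfl⟩ | ⟨rfl, rfl⟩ | ⟨rfl, rfl⟩
    · simpa using hx _
    · simpa using hx _
    · simpa using hw

/-- Whether x and a are side-adjacent is left open: both possible edges are listed in the
configuration, so the strategy never draws this pair. -/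
lemma wins_spareCapConfig {b : Bool} {x z a p q : ℕ} (hP : Bdd P) (hQ : MPath P Q)
    (he : EndsFresh P Q) (hH : MPath P (x :: (H ++ [z]))) (hx : Sat P x) (hz : Fresh P z)
    (ha : Inc P b a) (hp : Fresh P p) (hq : Fresh P q) (hap : MainAdj P a p) (haq : MainAdj P a q)
    (hn : (Q ++ a :: p :: q :: x :: (H ++ [z])).Nodup)
    (hl : l ≤ Q.length + i + H.length)
    (hc : check t spareCapConfig m i = true) : Wins l m P := by
  obtain ⟨M, e, rfl, he⟩ := he
  refine wins_of_check t (occurs_of_list (σ := !b) (V := [x, z, a, p, q]) (H := H) hP rfl hQ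
    (nodup_of_count hn fun x => by simp [List.count_cons]; omega) ?_
    ?_ ?_
    (disjoint_of_nodup (nodup_of_count hn fun x => by simp [List.count_cons]; omega))
    (by simp [spareCapConfig]) (fun _ => ⟨by simp [spareCapConfig], hH⟩)) hc (by simpa using hl)
  · intro b i j hi hj hij h
    simp only [spareCapConfig] at hi hj
    interval_cases j <;> interval_cases i
    all_goals
      first
      | exact absurd h (he.not_adj _ _)
      | exact absurd h (hz.not_adj _ _)
      | exact absurd h (hz.not_adj' _ _)
      | exact absurd h (hp.not_adj _ _)
      | exact absurd h (hp.not_adj' _ _)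
      | exact absurd h (hq.not_adj' _ _)
      | (cases b <;> decide)
  · intro b i h
    simp only [spareCapConfig, List.mem_cons, Prod.mk.injEq, List.not_mem_nil, or_false] at h ⊢
    rcases h with ⟨rfl, rfl⟩ | ⟨rfl, rfl⟩ | ⟨rfl, rfl⟩
    · simpa using hx _
    · simpa using hx _
    · simpa using ha
  · intro i j h
    simp only [spareCapConfig, List.mem_cons, Prod.mk.injEq, List.not_mem_nil, or_false] at h ⊢
    rcases h with ⟨rfl, rfl⟩ | ⟨rfl, rfl⟩
    · simpa using hap
    · simpa using haq

/-- As the configuration lists both possible side edges between e and y, nothing has to be known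
about that pair beyond the colour b at each end. -/
lemma wins_stemConfig {b : Bool} {x z y p : ℕ} (hP : Bdd P) (hM : MPath P (M ++ [e]))
    (he : Inc P b e) (hH : MPath P (x :: (H ++ [z]))) (hx : Fresh P x) (hz : Fresh P z)
    (hy : Inc P b y) (hp : Fresh P p) (hyp : MainAdj P y p)
    (hn : (M ++ e :: y :: p :: x :: (H ++ [z])).Nodup) (hl : l ≤ M.length + 1 + i + H.length)
    (hc : check t stemConfig m i = true) : Wins l m P := by
  refine wins_of_check t (occurs_of_list (σ := b) (V := [x, z, y, p]) (H := H) hP rfl hM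
    (nodup_of_count hn fun x => by simp [List.count_cons]; omega) ?_
    ?_ ?_
    (disjoint_of_nodup (nodup_of_count hn fun x => by simp [List.count_cons]; omega))
    (by simp [stemConfig]) (fun _ => ⟨by simp [stemConfig], hH⟩)) hc hl
  · intro b i j hi hj hij h
    simp only [stemConfig] at hi hj
    interval_cases j <;> interval_cases i
    all_goals
      first
      | exact absurd h (hz.not_adj _ _)
      | exact absurd h (hz.not_adj' _ _)
      | exact absurd h (hx.not_adj _ _)
      | exact absurd h (hx.not_adj' _ _)
      | exact absurd h (hp.not_adj' _ _)
      | (cases b <;> decide)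
  · intro b i h
    simp only [stemConfig, List.mem_cons, Prod.mk.injEq, List.not_mem_nil, or_false] at h ⊢
    rcases h with ⟨rfl, rfl⟩ | ⟨rfl, rfl⟩
    · simpa using he
    · simpa using hy
  · intro i j h
    simp only [stemConfig, List.mem_singleton, Prod.mk.injEq] at h ⊢
    obtain ⟨rfl, rfl⟩ := h
    simpa using hyp

end

/-! ### Base cases: at most four missing vertices. -/

section

variable {l : ℕ} {P : Position 3} {Q : List ℕ}

lemma wins_fresh_of_le_four {i n : ℕ} (hP : Bdd P) (hQ : MPath P Q) (he : EndsFresh P Q) (hi : i ≤ 4)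
    (hl : l ≤ Q.length + i) (hn : i + 2 ≤ n ∨ i = 0) (hn' : 2 ≤ i → i + 3 ≤ n) :
    Wins l n P := by
  interval_cases i
  · exact wins_of_path hQ (by simpa using hl)
  · exact forces_mono (by omega) (wins_freshConfig (m := 3) hP hQ he hl
      (show check freshStrategy1 _ _ _ = true by decide +kernel))
  · exact forces_mono (by omega) (wins_freshConfig (m := 5) hP hQ he hl
      (show check freshStrategy2 _ _ _ = true by decide +kernel))
  · exact forces_mono (by omega) (wins_freshConfig (m := 6) hP hQ he hl
      (show check freshStrategy3 _ _ _ = true by decide +kernel))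
  · exact forces_mono (by omega) (wins_freshConfig (m := 7) hP hQ he hl
      (show check freshStrategy4 _ _ _ = true by decide +kernel))

lemma wins_single_of_le_four {i n : ℕ} {b : Bool} {w : ℕ} (hP : Bdd P) (hQ : MPath P Q)
    (he : EndsFresh P Q) (hnd : (Q ++ [w]).Nodup) (hw : Inc P b w) (hi : i ≤ 4)
    (hl : l ≤ Q.length + i) (hn : i + 2 ≤ n ∨ i = 0) : Wins l n P := by
  interval_cases i
  · exact wins_of_path hQ (by simpa using hl)
  · exact forces_mono (by omega) (wins_singleConfig (m := 3) hP hQ he hnd hw hl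
      (show check singleStrategy1 _ _ _ = true by decide +kernel))
  · exact forces_mono (by omega) (wins_singleConfig (m := 4) hP hQ he hnd hw hl
      (show check singleStrategy2 _ _ _ = true by decide +kernel))
  · exact forces_mono (by omega) (wins_singleConfig (m := 5) hP hQ he hnd hw hl
      (show check singleStrategy3 _ _ _ = true by decide +kernel))
  · exact forces_mono (by omega) (wins_singleConfig (m := 6) hP hQ he hnd hw hl
      (show check singleStrategy4 _ _ _ = true by decide +kernel))

lemma wins_float_of_le_four {i n : ℕ} {x z : ℕ} {H : List ℕ} (hP : Bdd P)
    (hQ : MPath P Q) (he : EndsFresh P Q) (hH : MPath P (x :: (H ++ [z]))) (hx : Fresh P x)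
    (hnd : (Q ++ x :: (H ++ [z])).Nodup) (hi : 1 ≤ i) (hi' : i ≤ 4)
    (hl : l ≤ Q.length + (i + 1) + H.length) (hn : i + 3 ≤ n) : Wins l n P := by
  interval_cases i
  · exact forces_mono hn (wins_floatConfig hP hQ he hH hx hnd hl
      (show check floatStrategy1 _ _ _ = true by decide +kernel))
  · exact forces_mono hn (wins_floatConfig hP hQ he hH hx hnd hl
      (show check floatStrategy2 _ _ _ = true by decide +kernel))
  · exact forces_mono hn (wins_floatConfig hP hQ he hH hx hnd hl
      (show check floatStrategy3 _ _ _ = true by decide +kernel))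
  · exact forces_mono hn (wins_floatConfig hP hQ he hH hx hnd hl
      (show check floatStrategy4 _ _ _ = true by decide +kernel))

end

/-! ### Runs of alternating side-coloured edges -/

/-- A path in the path colour, given by its ends and its interior. -/
structure Block : Type where
  head : ℕ
  mid : List ℕ
  tail : ℕ

/-- The vertices of a block in order. -/
def Block.verts (B : Block) : List ℕ := B.head :: (B.mid ++ [B.tail])

/-- The vertices of a list of blocks in order. -/
def flat (L : List Block) : List ℕ := L.flatMap Block.verts

/-- The block `B` is a path in the path colour from a saturated to a fresh vertex. -/
def GoodBlock (P : Position 3) (B : Block) : Prop :=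
  Sat P B.head ∧ Fresh P B.tail ∧ MPath P B.verts

@[simp] lemma flat_nil : flat [] = [] := rfl

@[simp] lemma flat_cons (B : Block) (L : List Block) : flat (B :: L) = B.verts ++ flat L := rfl

@[simp] lemma flat_append (L L' : List Block) : flat (L ++ L') = flat L ++ flat L' := by
  simp [flat]

/-- Reversing the order of the blocks does not reverse the blocks themselves, so the vertex list is
permuted but not reversed. Multiplicities suffice for distinctness. -/
lemma count_flat_reverse (L : List Block) (x : ℕ) :
    (flat L.reverse).count x = (flat L).count x := by
  induction L with
  | nil => rfl
  | cons B L ih => simp [ih]; omega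

lemma length_flat_reverse (L : List Block) : (flat L.reverse).length = (flat L).length := by
  induction L with
  | nil => rfl
  | cons B L ih => simp [ih]; omega

lemma Block.length_verts (B : Block) : B.verts.length = B.mid.length + 2 := by
  simp [Block.verts]

lemma MainExt.goodBlock {P P' : Position 3} (h : MainExt P P') {B : Block} (hB : GoodBlock P B) :
    GoodBlock P' B := ⟨h.sat.2 hB.1, h.fresh.2 hB.2.1, h.mpath hB.2.2⟩

lemma SideStep.goodBlock {P P' : Position 3} {b : Bool} {u v : ℕ} (h : SideStep P b u v P')
    {B : Block} (hB : GoodBlock P B) (hu : B.tail ≠ u) (hv : B.tail ≠ v) : GoodBlock P' B :=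
  ⟨h.sat hB.1, h.fresh hB.2.1 hu hv, h.mpath.2 hB.2.2⟩

lemma endsFresh_blocks {P : Position 3} {A : List ℕ} {q : ℕ} {L : List Block} (hq : Fresh P q)
    (hL : ∀ B ∈ L, GoodBlock P B) : EndsFresh P (A ++ q :: flat L) := by
  rcases List.eq_nil_or_concat L with rfl | ⟨L', B, rfl⟩
  · exact ⟨A, q, by simp, hq⟩
  · exact ⟨A ++ q :: (flat L' ++ B.head :: B.mid), B.tail, by simp [Block.verts],
      (hL B (by simp)).2.1⟩

/-! ### Forced joins. -/

/-- Builder joins two paths by a forced edge. -/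
lemma wins_join {P : Position 3} {l n : ℕ} {A R : List ℕ} {q r : ℕ} (hP : Bdd P)
    (hA : MPath P (A ++ [q])) (hR : MPath P (r :: R)) (hl : Link P q r)
    (hn : (A ++ q :: r :: R).Nodup) (hN : 1 ≤ n)
    (h : ∀ P', MainExt P P' → MPath P' (A ++ q :: r :: R) → Wins l (n - 1) P') : Wins l n P := by
  obtain ⟨n, rfl⟩ : ∃ k, n = k + 1 := ⟨n - 1, by omega⟩
  refine wins_link hP hl fun P' hP' hm => h P' hP' ⟨?_, hn⟩
  refine isChain_glue (hP'.mpath hA).1 ?_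
  exact List.isChain_cons_cons.2 ⟨hm, (hP'.mpath hR).1⟩

/-- Builder appends a list of blocks to a path by forced edges. -/
lemma wins_append_blocks {l : ℕ} : ∀ {L : List Block} {P : Position 3} {n : ℕ} {A : List ℕ} {q : ℕ},
    Bdd P → MPath P (A ++ [q]) → (∀ B ∈ L, GoodBlock P B) → (A ++ q :: flat L).Nodup →
    (∀ B ∈ L.head?, ∀ b, ¬ SideAdj P b q B.head) → L.length ≤ n →
    (∀ P', MainExt P P' → MPath P' (A ++ q :: flat L) → Wins l (n - L.length) P') → Wins l n P
  | [], P, n, A, q, hP, hA, _, _, _, _, h => h P (MainExt.refl hP) hA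
  | B :: L, P, n, A, q, hP, hA, hL, hn, hq, hN, h => by
    obtain ⟨hs, hf, hB⟩ := hL B (by simp)
    rw [List.length_cons] at hN
    have hqB : q ≠ B.head := by
      rintro rfl
      have := (List.nodup_append.1 hn).2.1
      simp [Block.verts] at this
    refine wins_join hP hA hB (Link.of_sat hs (fun b hb => hq B (by simp) b hb.symm) hqB.symm).symm
      (nodup_of_count hn fun x => by simp [Block.verts, List.count_cons]) (by omega) fun P₁ h₁ hA₁ => ?_
    refine wins_append_blocks (L := L) (A := A ++ q :: B.head :: B.mid) (q := B.tail) h₁.2.2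
      (by simpa using hA₁) (fun C hC => h₁.goodBlock (hL C (by simp [hC])))
      (by simpa [Block.verts] using hn) (fun C hC b => (h₁.fresh.2 hf).not_adj _ _) (by omega)
      fun P₂ h₂ hA₂ => ?_
    have := h P₂ (h₁.trans h₂) (by simpa [Block.verts] using hA₂)
    rwa [List.length_cons, show n - (L.length + 1) = n - 1 - L.length by omega] at this

/-! ### Bounds for the three kinds of positions -/

/-- The cost of lengthening a main path with a fresh end by `i`. -/
def freshCost (i : ℕ) : ℕ :=
  if i = 0 then 0 else if i = 2 then 5 else if i % 4 = 3 ∧ 5 ≤ i then (3 * i + 1) / 2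
  else (3 * i + 3) / 2

/-- The cost of the same if another vertex meets a side colour. -/
def singleCost (i : ℕ) : ℕ := if i = 0 then 0 else if i ≤ 2 then i + 2 else (3 * i + 1) / 2

/-- The cost of absorbing a floating path and `i - 1` further vertices. -/
def floatCost (i : ℕ) : ℕ := if i = 1 then 4 else if i = 2 then 5 else (3 * i + 3) / 2

/-- Builder can lengthen main paths with a fresh end by `i`. -/
def FreshBound (l i : ℕ) : Prop := ∀ (P : Position 3) (Q : List ℕ) (n : ℕ), Bdd P → MPath P Q →
  EndsFresh P Q → l ≤ Q.length + i → freshCost i ≤ n → Wins l n P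

/-- Builder can lengthen main paths with a fresh end by `i` if there is a vertex that meets a side
colour. -/
def SingleBound (l i : ℕ) : Prop := ∀ (P : Position 3) (Q : List ℕ) (b : Bool) (w n : ℕ), Bdd P →
  MPath P Q → EndsFresh P Q → (Q ++ [w]).Nodup → Inc P b w → l ≤ Q.length + i →
  singleCost i ≤ n → Wins l n P

/-- Builder can absorb a floating path with fresh ends and `i - 1` further vertices. -/
def FloatBound (l i : ℕ) : Prop := ∀ (P : Position 3) (Q : List ℕ) (x z : ℕ) (H : List ℕ) (n : ℕ),
  Bdd P → MPath P Q → EndsFresh P Q → MPath P (x :: (H ++ [z])) → Fresh P x → Fresh P z →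
  (Q ++ x :: (H ++ [z])).Nodup → l ≤ Q.length + (i + 1) + H.length → floatCost i ≤ n → Wins l n P

/-- An alternating run of side-coloured edges leads from the end `e` of the main path to `a`; its
inner vertices are the heads of the blocks in `L`, the last one first. -/
structure Run (P : Position 3) (M : List ℕ) (e a : ℕ) (L : List Block) (c : Bool) : Prop where
  bdd : Bdd P
  path : MPath P (M ++ [e])
  inc_left : Inc P c e
  inc_right : Inc P (c ^^ decide (L.length % 2 = 1)) a
  good : ∀ B ∈ L, GoodBlock P B
  nodup : (M ++ e :: a :: flat L).Nodup
  ends : L ≠ [] → ∀ b, ¬ SideAdj P b e a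
  left : 2 ≤ L.length → ∀ B ∈ L.head?, ∀ b, ¬ SideAdj P b e B.head
  right : 2 ≤ L.length → ∀ B ∈ L.getLast?, ∀ b, ¬ SideAdj P b a B.head

/-- A run whose last inner vertex `h` does not belong to a block yet. -/
structure OpenRun (P : Position 3) (M : List ℕ) (e a h : ℕ) (L : List Block) (c : Bool) : Prop where
  bdd : Bdd P
  path : MPath P (M ++ [e])
  inc_left : Inc P c e
  inc_right : Inc P (c ^^ decide ((L.length + 1) % 2 = 1)) a
  sat : Sat P h
  good : ∀ B ∈ L, GoodBlock P B
  nodup : (M ++ e :: a :: h :: flat L).Nodup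
  ends : ∀ b, ¬ SideAdj P b e a
  left : L ≠ [] → ∀ b, ¬ SideAdj P b e h
  right : ∀ B ∈ L.getLast?, ∀ b, ¬ SideAdj P b a B.head

/-- The first block has no interior unless it is the only one. -/
def Thin (L : List Block) : Prop := L.length ≤ 1 ∨ ∃ B ∈ L.head?, B.mid = []

/-! ### Growing a run. -/

section

variable {P P' : Position 3} {M : List ℕ} {e a h : ℕ} {L : List Block} {c : Bool}

lemma Run.mono (R : Run P M e a L c) (hP : MainExt P P') : Run P' M e a L c := by
  have hadj : ∀ u v, (∀ b, ¬ SideAdj P b u v) → ∀ b, ¬ SideAdj P' b u v :=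
    fun u v h b hb => h b ((hP.1 b u v).1 hb)
  exact ⟨hP.2.2, hP.mpath R.path, hP.inc.2 R.inc_left, hP.inc.2 R.inc_right,
    fun B hB => hP.goodBlock (R.good B hB), R.nodup, fun hL => hadj _ _ (R.ends hL),
    fun hL B hB => hadj _ _ (R.left hL B hB), fun hL B hB => hadj _ _ (R.right hL B hB)⟩

lemma Run.ne (R : Run P M e a L c) : e ≠ a := by
  have := (List.nodup_append.1 R.nodup).2.1
  simp at this
  tauto

/-- If the number of blocks is odd, the ends of the run meet different side colours. -/
lemma Run.link (R : Run P M e a L c) (hL : L.length % 2 = 1) : Link P e a := by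
  refine ⟨R.ne, R.ends (by rintro rfl; simp at hL), fun b => ?_⟩
  have h1 := R.inc_left
  have h2 := R.inc_right
  rw [hL] at h2
  by_cases hb : b = c
  · exact Or.inl (hb ▸ h1)
  · right
    have : b = (c ^^ decide (1 = 1)) := by cases b <;> cases c <;> simp_all
    rwa [this]

/-- The end of a run as the head of a new block. -/
lemma Run.extend {p : ℕ} {b : Bool} (R : Run P M e a L c) (hb : ¬ Inc P b a) (hp : Fresh P p)
    (hn : (M ++ e :: p :: a :: flat L).Nodup) (hs : SideStep P b a p P') :
    OpenRun P' M e p a L c := by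
  have hne := R.ne
  have hpe : p ≠ e := by
    have := (List.nodup_append.1 hn).2.1
    simp at this
    tauto
  -- The vertex `a` already meets the colour determined by c and the parity, so the new edge has the
  -- other one and the run keeps alternating.
  have hb' : b = !(c ^^ decide (L.length % 2 = 1)) := by
    by_contra h
    refine hb ?_
    rw [show b = (c ^^ decide (L.length % 2 = 1)) by
      revert h; generalize (c ^^ decide (L.length % 2 = 1)) = d; cases b <;> cases d <;> simp]
    exact R.inc_right
  have hb'' : b = (c ^^ decide ((L.length + 1) % 2 = 1)) := by
    rw [hb']
    rcases Nat.mod_two_eq_zero_or_one L.length with h | h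
    · simp [h, show (L.length + 1) % 2 = 1 by omega]
    · simp [h, show (L.length + 1) % 2 = 0 by omega]
  refine ⟨hs.2.2, hs.mpath.2 R.path, (hs.inc _ _).2 (Or.inl R.inc_left),
    (hs.inc _ _).2 (Or.inr ⟨hb''.symm, Or.inr rfl⟩), ?_, ?_, hn, ?_, ?_, ?_⟩
  · intro b'
    rw [hs.inc]
    by_cases h : b' = b
    · exact Or.inr ⟨h, Or.inl rfl⟩
    · left
      have : b' = (c ^^ decide (L.length % 2 = 1)) := by
        rw [hb'] at h
        revert h; generalize (c ^^ decide (L.length % 2 = 1)) = d; cases b' <;> cases d <;> simp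
      rw [this]; exact R.inc_right
  · intro B hB
    have hmem : B.tail ∈ flat L := List.mem_flatMap.2 ⟨B, hB, by simp [Block.verts]⟩
    have := (List.nodup_append.1 hn).2.1
    simp only [List.nodup_cons, List.mem_cons, not_or] at this
    exact hs.goodBlock (R.good B hB) (by rintro h; exact this.2.2.1 (h ▸ hmem))
      (by rintro h; exact this.2.1.2 (h ▸ hmem))
  · intro b'
    exact hs.not_adj (fun b => hp.not_adj' _ _) (by tauto) (by tauto) b'
  · intro hL b'
    exact hs.not_adj (R.ends hL) (by tauto) (by tauto) b'
  · intro B hB b'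
    have hmem : B.head ∈ flat L :=
      List.mem_flatMap.2 ⟨B, List.mem_of_mem_getLast? hB, by simp [Block.verts]⟩
    have := (List.nodup_append.1 hn).2.1
    simp only [List.nodup_cons, List.mem_cons, not_or] at this
    refine hs.not_adj (fun b => hp.not_adj _ _) (by tauto) ?_ b'
    rintro ⟨-, h⟩
    exact this.2.2.1 (h ▸ hmem)

/-- An open run becomes a run once its last inner vertex is the head of a block. -/
lemma OpenRun.close {H : List ℕ} {z : ℕ} (R : OpenRun P M e a h L c)
    (hB : MPath P (h :: (H ++ [z]))) (hz : Fresh P z)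
    (hn : (M ++ e :: a :: flat (⟨h, H, z⟩ :: L)).Nodup) : Run P M e a (⟨h, H, z⟩ :: L) c := by
  refine ⟨R.bdd, R.path, R.inc_left, by simpa using R.inc_right, ?_, hn, fun _ => R.ends, ?_, ?_⟩
  · intro B hB'
    rcases List.mem_cons.1 hB' with rfl | hB'
    · exact ⟨R.sat, hz, hB⟩
    · exact R.good B hB'
  · intro hL B hB'
    simp only [List.head?_cons, Option.mem_def, Option.some.injEq] at hB'
    subst hB'
    exact R.left (by rintro rfl; simp at hL)
  · intro hL B hB'
    have : L ≠ [] := by rintro rfl; simp at hL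
    rw [List.getLast?_cons_of_ne_nil this] at hB'
    exact R.right B hB'

lemma OpenRun.mono (R : OpenRun P M e a h L c) (hP : MainExt P P') : OpenRun P' M e a h L c := by
  have hadj : ∀ u v, (∀ b, ¬ SideAdj P b u v) → ∀ b, ¬ SideAdj P' b u v :=
    fun u v h b hb => h b ((hP.1 b u v).1 hb)
  exact ⟨hP.2.2, hP.mpath R.path, hP.inc.2 R.inc_left, hP.inc.2 R.inc_right, hP.sat.2 R.sat,
    fun B hB => hP.goodBlock (R.good B hB), R.nodup, hadj _ _ R.ends,
    fun hL => hadj _ _ (R.left hL), fun B hB => hadj _ _ (R.right B hB)⟩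

end

/-! ### Ways to leave a run. -/

section

variable {P : Position 3} {M : List ℕ} {e a h : ℕ} {L : List Block} {c : Bool} {l i n : ℕ}

lemma Thin.exists_cons (hT : Thin L) (hL : 2 ≤ L.length) :
    ∃ B L', L = B :: L' ∧ B.mid = [] := by
  rcases hT with h | ⟨B, hB, hmid⟩
  · omega
  · obtain ⟨L', rfl⟩ := List.head?_eq_some_iff.1 hB
    exact ⟨B, L', rfl, hmid⟩

/-- After the forced edge from e to a the blocks are taken from the last one on, because it is the
head of the last block that is known not to be a side neighbour of a. Every later link goes from a
fresh tail to a saturated head. -/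
lemma wins_up (hP : Bdd P) (hM : MPath P (M ++ [e])) (hea : Link P e a)
    (hL : ∀ B ∈ L, GoodBlock P B) (hn : (M ++ e :: a :: flat L).Nodup)
    (ha : ∀ B ∈ L.getLast?, ∀ b, ¬ SideAdj P b a B.head)
    (hl : l ≤ M.length + 2 + (flat L).length) (hN : L.length + 1 ≤ n) : Wins l n P := by
  refine wins_join (R := []) hP hM ⟨by simp, by simp⟩ hea
    (hn.sublist (by simp)) (by omega) fun P₁ h₁ hM₁ => ?_
  refine wins_append_blocks (L := L.reverse) (A := M ++ [e]) (q := a) h₁.2.2 (by simpa using hM₁)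
    (fun B hB => h₁.goodBlock (hL B (by simpa using hB)))
    (nodup_of_count hn fun x => by simp [List.count_cons, count_flat_reverse])
    (fun B hB b hb => ha B (by simpa using hB) b ((h₁.1 _ _ _).1 hb)) (by simp; omega)
    fun P₂ h₂ hM₂ => wins_of_path hM₂ ?_
  simp [length_flat_reverse]; omega

/-- With at least two blocks, the head of the first one is not a side neighbour of e, so the blocks
can be attached to e in the listed order and a is left out. -/
lemma Run.wins_down (R : Run P M e a L c) (hL : 2 ≤ L.length)
    (hl : l ≤ M.length + 1 + (flat L).length) (hN : L.length ≤ n) : Wins l n P := by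
  refine wins_append_blocks (L := L) (A := M) (q := e) R.bdd R.path R.good
    (R.nodup.sublist (by simp)) (R.left hL) hN
    fun P₂ h₂ hM₂ => wins_of_path hM₂ ?_
  simp; omega

/-- The run ends in a vertex `a` that has a further neighbour `p` in the path colour; the number
of blocks is odd. -/
lemma Run.wins_odd {p : ℕ} (R : Run P M e a L c) (hL : L.length % 2 = 1) (hp : Fresh P p)
    (hap : MainAdj P a p) (hn : (M ++ e :: a :: p :: flat L).Nodup) (hi : 5 ≤ i)
    (hF : ∀ j < i, FreshBound l j) (hm : L.length + 1 ≤ i / 2)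
    (hl : l + 2 * L.length ≤ M.length + 1 + i + (flat L).length)
    (hN : freshCost i ≤ n + 2 * L.length + 2) : Wins l n P := by
  have hap' : MPath P [a, p] := ⟨by simpa using hap, by
    have := (List.nodup_append.1 hn).2.1
    simp at this ⊢
    tauto⟩
  have hsub : ∀ {L'}, (flat L').Sublist (flat L) → (M ++ e :: a :: p :: flat L').Nodup := fun h =>
    hn.sublist ((List.Sublist.refl _).append (((h.cons_cons _).cons_cons _).cons_cons _))
  -- Using up all blocks would leave 2 or 3 vertices to gain, where `freshCost` may exceed the
  -- remaining rounds by one. One block is kept back instead, which turns the targets into 4 and 5.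
  by_cases hex : i = 2 * L.length + 4 ∨ i = 2 * L.length + 5
  · obtain ⟨B, L, rfl⟩ : ∃ B L', L = B :: L' := by
      cases L with
      | nil => simp at hL
      | cons B L' => exact ⟨B, L', rfl⟩
    have hg := R.good B (by simp)
    have hBl := B.length_verts
    have hlen : (flat (B :: L)).length = B.verts.length + (flat L).length := by simp
    have hlen' : (B :: L).length = L.length + 1 := rfl
    have hc : (i = 2 * L.length + 6 → L.length + 6 ≤ n) ∧
        (i = 2 * L.length + 7 → L.length + 7 ≤ n) := by
      unfold freshCost at hN
      split_ifs at hN <;> omega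
    refine wins_join R.bdd R.path hap' (R.link hL) (hsub (L' := []) (by simp)) (by omega)
      fun P₁ h₁ hM₁ => ?_
    refine wins_append_blocks (L := L) (A := M ++ [e, a]) (q := p) h₁.2.2 (by simpa using hM₁)
      (fun C hC => h₁.goodBlock (R.good C (by simp [hC])))
      (by simpa using hsub (L' := L) (by simp))
      (fun C hC b => (h₁.fresh.2 hp).not_adj _ _) (by omega) fun P₂ h₂ hM₂ => ?_
    have h₃ := h₁.trans h₂
    have hg' := h₃.goodBlock hg
    have hend : EndsFresh P₂ (M ++ [e, a] ++ p :: flat L) := endsFresh_blocks (h₃.fresh.2 hp)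
      fun C hC => h₃.goodBlock (R.good C (by simp [hC]))
    have hnd : ((M ++ [e, a] ++ p :: flat L) ++ B.head :: (B.mid ++ [B.tail])).Nodup :=
      nodup_of_count hn fun x => by simp [List.count_cons, Block.verts]; omega
    rcases hex with hex | hex
    · exact forces_mono (by omega) (wins_spareConfig (i := 4) h₂.2.2 hM₂ hend hg'.2.2 hg'.1 hg'.2.1
        hnd (by simp; omega) (show check spareStrategy4 _ 5 _ = true by decide +kernel))
    · exact forces_mono (by omega) (wins_spareConfig (i := 5) h₂.2.2 hM₂ hend hg'.2.2 hg'.1 hg'.2.1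
        hnd (by simp; omega) (show check spareStrategy5 _ 6 _ = true by decide +kernel))
  · have hc : L.length + 1 ≤ n ∧ freshCost (i - 2 * L.length - 2) ≤ n - 1 - L.length := by
      unfold freshCost at hN ⊢
      split_ifs at hN ⊢ <;> omega
    refine wins_join R.bdd R.path hap' (R.link hL) (hsub (L' := []) (by simp)) (by omega)
      fun P₁ h₁ hM₁ => ?_
    refine wins_append_blocks (L := L) (A := M ++ [e, a]) (q := p) h₁.2.2 (by simpa using hM₁)
      (fun C hC => h₁.goodBlock (R.good C hC)) (by simpa using hn)
      (fun C hC b => (h₁.fresh.2 hp).not_adj _ _) (by omega) fun P₂ h₂ hM₂ => ?_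
    have h₃ := h₁.trans h₂
    exact hF (i - 2 * L.length - 2) (by omega) P₂ _ _ h₂.2.2 hM₂ (endsFresh_blocks (h₃.fresh.2 hp)
      fun C hC => h₃.goodBlock (R.good C hC)) (by simp; omega) hc.2

/-- The run ends in a vertex `a` that has two further neighbours in the path colour; the number
of blocks is even and the target is just short of what the run supplies. -/
lemma Run.wins_cap_finish {p q : ℕ} {B : Block} (R : Run P M e a (B :: L) c) (hL : L ≠ [])
    (hp : Fresh P p) (hq : Fresh P q) (hap : MainAdj P a p) (haq : MainAdj P a q)
    (hn : (M ++ e :: a :: p :: q :: flat (B :: L)).Nodup)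
    (hl : l ≤ M.length + 5 + (flat L).length) (hN : L.length + 2 ≤ n) : Wins l n P := by
  have hg := R.good B (by simp)
  have hL' : 1 ≤ L.length := List.length_pos_iff.2 hL
  have hcnt := List.nodup_iff_count_le_one.1 hn
  have hnd : (M ++ e :: B.head :: p :: a :: q :: flat L).Nodup :=
    nodup_of_count hn fun x => by simp [List.count_cons, Block.verts]; omega
  have hsub : ∀ {S : List ℕ}, S.Sublist (p :: a :: q :: flat L) →
      (M ++ e :: B.head :: S).Nodup := fun h =>
    hnd.sublist ((List.Sublist.refl _).append ((h.cons_cons _).cons_cons _))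
  have hne : e ≠ B.head := by
    have := (List.nodup_append.1 hnd).2.1
    simp at this
    tauto
  -- The tail of the first block is given up; its saturated head leads from e into the path p, a, q.
  refine wins_join (R := []) R.bdd R.path ⟨by simp, by simp⟩
    (Link.of_sat hg.1 (fun b hb => R.left (by simp; omega) B (by simp) b hb.symm) hne.symm).symm
    (hsub (by simp)) (by omega) fun P₁ h₁ hM₁ => ?_
  have hapq : MPath P₁ [p, a, q] := h₁.mpath
    ⟨by simpa using ⟨hap.symm, haq⟩, ((List.nodup_append.1 (hsub (S := [p, a, q]) (by simp))).2.1).sublist (by simp)⟩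
  refine wins_join (A := M ++ [e]) (R := [a, q]) h₁.2.2 (by simpa using hM₁) hapq
    (Link.of_fresh (h₁.sat.2 hg.1) (h₁.fresh.2 hp)) (by simpa using hsub (S := [p, a, q]) (by simp))
    (by omega) fun P₂ h₂ hM₂ => ?_
  have h₃ := h₁.trans h₂
  refine wins_append_blocks (L := L) (A := M ++ [e, B.head, p, a]) (q := q) h₂.2.2
    (by simpa using hM₂)
    (fun C hC => h₃.goodBlock (R.good C (by simp [hC])))
    (by simpa using hnd)
    (fun C hC b => (h₃.fresh.2 hq).not_adj _ _) (by omega) fun P₃ h₄ hM₃ => ?_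
  exact wins_of_path hM₃ (by simp; omega)

/-- The run ends in a vertex `a` that has a further neighbour in the path colour, and the target
is just short of what the run supplies. -/
lemma Run.wins_turn {p : ℕ} {B : Block} (R : Run P M e a (B :: L) c) (hL : L ≠ [])
    (hp : Fresh P p) (hap : MainAdj P a p)
    (hn : (M ++ e :: a :: p :: flat (B :: L)).Nodup)
    (hl : l ≤ M.length + 4 + (flat L).length) (hN : L.length + 2 ≤ n) : Wins l n P := by
  have hg := R.good B (by simp)
  have hL' : 1 ≤ L.length := List.length_pos_iff.2 hL
  have hnd : (M ++ e :: B.head :: p :: a :: flat L.reverse).Nodup :=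
    nodup_of_count hn fun x => by
      simp [List.count_cons, Block.verts, count_flat_reverse]; omega
  have hsub : ∀ {S : List ℕ}, S.Sublist (p :: a :: flat L.reverse) →
      (M ++ e :: B.head :: S).Nodup := fun h =>
    hnd.sublist ((List.Sublist.refl _).append ((h.cons_cons _).cons_cons _))
  have hne : e ≠ B.head := by
    have := (List.nodup_append.1 hnd).2.1
    simp at this
    tauto
  -- Only the head of the first block is used, as a bridge from e to p. The path then leaves through
  -- a, towards the block whose head is known not to be a side neighbour of a.
  refine wins_join (R := []) R.bdd R.path ⟨by simp, by simp⟩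
    (Link.of_sat hg.1 (fun b hb => R.left (by simp; omega) B (by simp) b hb.symm) hne.symm).symm
    (hsub (by simp)) (by omega) fun P₁ h₁ hM₁ => ?_
  have hpa : MPath P₁ [p, a] := h₁.mpath
    ⟨by simpa using hap.symm, ((List.nodup_append.1 (hsub (S := [p, a]) (by simp))).2.1).sublist (by simp)⟩
  refine wins_join (A := M ++ [e]) (R := [a]) h₁.2.2 (by simpa using hM₁) hpa
    (Link.of_fresh (h₁.sat.2 hg.1) (h₁.fresh.2 hp)) (by simpa using hsub (S := [p, a]) (by simp))
    (by omega) fun P₂ h₂ hM₂ => ?_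
  have h₃ := h₁.trans h₂
  refine wins_append_blocks (L := L.reverse) (A := M ++ [e, B.head, p]) (q := a) h₂.2.2
    (by simpa using hM₂)
    (fun C hC => h₃.goodBlock (R.good C (by simp at hC; simp [hC])))
    (by simpa using hnd)
    (fun C hC b hb => R.right (by simp; omega) C
      (by rw [List.getLast?_cons_of_ne_nil hL]; simpa using hC) b ((h₃.1 _ _ _).1 hb))
    (by simp; omega) fun P₃ h₄ hM₃ => ?_
  exact wins_of_path hM₃ (by simp [length_flat_reverse]; omega)

/-- The side edge ev saturates e, so ep is forced and the path absorbs p, a, q and then the blocks.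
Its other end v meets a side colour and becomes the extra vertex required by `SingleBound`. -/
lemma Run.wins_cap_side {P' : Position 3} {p q v : ℕ} {b : Bool} (R : Run P M e a L c)
    (hL : L.length % 2 = 0) (hp : Fresh P p) (hq : Fresh P q) (hv : Fresh P v)
    (hap : MainAdj P a p) (haq : MainAdj P a q) (hb : ¬ Inc P b e) (hs : SideStep P b e v P')
    (hn : (M ++ e :: a :: p :: q :: v :: flat L).Nodup) (hi : 5 ≤ i)
    (hD : ∀ j < i, SingleBound l j) (hm : 2 * L.length + 3 ≤ i)
    (hl : l + 2 * L.length ≤ M.length + 1 + i + (flat L).length)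
    (hN : freshCost i ≤ n + 2 * L.length + 4) : Wins l n P' := by
  have hnd : (M ++ e :: p :: a :: q :: v :: flat L).Nodup :=
    nodup_of_count hn fun x => by simp [List.count_cons]; omega
  have hsub : ∀ {S : List ℕ}, S.Sublist (p :: a :: q :: v :: flat L) →
      (M ++ e :: S).Nodup := fun h =>
    hnd.sublist ((List.Sublist.refl _).append (h.cons_cons _))
  have hde := (List.nodup_append.1 hnd).2.1
  simp only [List.nodup_cons, List.mem_cons, not_or] at hde
  have hsat : Sat P' e := by
    intro b'
    rw [hs.inc]
    by_cases h : b' = b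
    · exact Or.inr ⟨h, Or.inl rfl⟩
    · left
      have : b' = c := by
        have : b ≠ c := by rintro rfl; exact hb R.inc_left
        revert h this; cases b <;> cases b' <;> cases c <;> simp
      rw [this]; exact R.inc_left
  have hp' : Fresh P' p := hs.fresh hp (by tauto) (by tauto)
  have hq' : Fresh P' q := hs.fresh hq (by tauto) (by tauto)
  have hmem : ∀ B ∈ L, B.tail ∈ flat L ∧ B.head ∈ flat L := fun B hB =>
    ⟨List.mem_flatMap.2 ⟨B, hB, by simp [Block.verts]⟩,
      List.mem_flatMap.2 ⟨B, hB, by simp [Block.verts]⟩⟩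
  have hgood : ∀ B ∈ L, GoodBlock P' B := fun B hB => by
    refine hs.goodBlock (R.good B hB) ?_ ?_ <;> intro h
    · exact hde.1.2.2.2.2 (h ▸ (hmem B hB).1)
    · exact hde.2.2.2.2.1 (h ▸ (hmem B hB).1)
  have hpaq : MPath P' [p, a, q] :=
    hs.mpath.2 ⟨by simpa using ⟨hap.symm, haq⟩,
      ((List.nodup_append.1 (hsub (S := [p, a, q]) (by simp))).2.1).sublist (by simp)⟩
  have hN' : 1 ≤ n := by
    unfold freshCost at hN
    split_ifs at hN <;> omega
  refine wins_join hs.2.2 (hs.mpath.2 R.path) hpaq (Link.of_fresh hsat hp') (hsub (by simp)) hN'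
    fun P₁ h₁ hM₁ => ?_
  -- One vertex would remain after using all blocks, at `singleCost 1 = 3`, but only two rounds are
  -- guaranteed; hence a block is kept back.
  by_cases hex : i = 2 * L.length + 4
  · obtain ⟨B, L, rfl⟩ : ∃ B L', L = B :: L' := by
      cases L with
      | nil => simp at hex; omega
      | cons B L' => exact ⟨B, L', rfl⟩
    have hg := hgood B (by simp)
    have hBl := B.length_verts
    have hlen : (flat (B :: L)).length = B.verts.length + (flat L).length := by simp
    have hlen' : (B :: L).length = L.length + 1 := rfl
    have hc : L.length + 4 ≤ n := by
      unfold freshCost at hN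
      split_ifs at hN <;> omega
    refine wins_append_blocks (L := L) (A := M ++ [e, p, a]) (q := q) h₁.2.2 (by simpa using hM₁)
      (fun C hC => h₁.goodBlock (hgood C (by simp [hC])))
      (by simpa using hsub (S := p :: a :: q :: flat L) (by simp))
      (fun C hC b => (h₁.fresh.2 hq').not_adj _ _) (by omega) fun P₂ h₂ hM₂ => ?_
    have h₃ := h₁.trans h₂
    have hg' := h₃.goodBlock hg
    refine forces_mono (by omega) (wins_spareSingleConfig (i := 3) (w := v) (b := b) h₂.2.2 hM₂
      (endsFresh_blocks (h₃.fresh.2 hq') fun C hC => h₃.goodBlock (hgood C (by simp [hC])))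
      hg'.2.2 hg'.1 hg'.2.1 (h₃.inc.2 ((hs.inc _ _).2 (Or.inr ⟨rfl, Or.inr rfl⟩))) ?_ ?_
      (by simp; omega) (show check spareSingleStrategy _ 3 _ = true by decide +kernel))
    · intro b' hb'
      refine hs.not_adj (fun b => hv.not_adj' _ _) ?_ ?_ b' ((h₃.1 _ _ _).1 hb')
      · rintro ⟨h, -⟩
        exact hde.1.2.2.2.2 (h ▸ (hmem B (by simp)).2)
      · rintro ⟨h, -⟩
        exact hde.2.2.2.2.1 (h ▸ (hmem B (by simp)).2)
    · exact nodup_of_count hn fun x => by simp [List.count_cons, Block.verts]; omega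
  · have hc : L.length + 1 ≤ n ∧ singleCost (i - 2 * L.length - 3) ≤ n - 1 - L.length := by
      unfold freshCost at hN
      unfold singleCost
      split_ifs at hN ⊢ <;> omega
    refine wins_append_blocks (L := L) (A := M ++ [e, p, a]) (q := q) h₁.2.2 (by simpa using hM₁)
      (fun C hC => h₁.goodBlock (hgood C hC))
      (by simpa using hsub (S := p :: a :: q :: flat L) (by simp))
      (fun C hC b => (h₁.fresh.2 hq').not_adj _ _) (by omega) fun P₂ h₂ hM₂ => ?_
    have h₃ := h₁.trans h₂
    exact hD (i - 2 * L.length - 3) (by omega) P₂ _ b v _ h₂.2.2 hM₂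
      (endsFresh_blocks (h₃.fresh.2 hq') fun C hC => h₃.goodBlock (hgood C hC))
      (nodup_of_count hn fun x => by simp [List.count_cons]; omega)
      (h₃.inc.2 ((hs.inc _ _).2 (Or.inr ⟨rfl, Or.inr rfl⟩))) (by simp; omega) hc.2

/-- The blocks are attached to the new fresh end v, while p, a, q remains as a floating path with
fresh ends, to be absorbed by means of `FloatBound`. -/
lemma Run.wins_cap_main {p q v : ℕ} (R : Run P M e a L c)
    (hL : L.length % 2 = 0) (hp : Fresh P p) (hq : Fresh P q) (hv : Fresh P v)
    (hap : MainAdj P a p) (haq : MainAdj P a q) (hev : MainAdj P e v)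
    (hn : (M ++ e :: a :: p :: q :: v :: flat L).Nodup) (hi : 5 ≤ i)
    (hK : ∀ j < i, 1 ≤ j → FloatBound l j) (hm : 2 * L.length + 3 ≤ i) (hT : Thin L)
    (hl : l + 2 * L.length ≤ M.length + 1 + i + (flat L).length)
    (hN : freshCost i ≤ n + 2 * L.length + 4) : Wins l n P := by
  have hnd : ∀ {S : List ℕ}, S.Sublist (v :: flat L) → (M ++ e :: S).Nodup := fun h =>
    hn.sublist ((List.Sublist.refl _).append
      ((((h.trans (List.sublist_cons_self _ _)).trans (List.sublist_cons_self _ _)).trans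
        (List.sublist_cons_self _ _)).cons_cons _))
  have hM : MPath P (M ++ [e] ++ [v]) := ⟨by
    have := isChain_glue (B := [v]) R.path.1 (by simpa using hev)
    simpa using this, by simpa using hnd (S := [v]) (by simp)⟩
  have hpaq : MPath P [p, a, q] := ⟨by simpa using ⟨hap.symm, haq⟩,
    nodup_of_count hn fun x => by simp [List.count_cons]; omega⟩
  -- Here the parameter for `FloatBound` would be 0. The head of the first block links the end of
  -- the path to p instead, and its tail is given up.
  by_cases hex : i = 2 * L.length + 3
  · obtain ⟨B, L', rfl, hB⟩ := hT.exists_cons (by omega)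
    have hlen : (flat (B :: L')).length = B.verts.length + (flat L').length := by simp
    have hlen' : (B :: L').length = L'.length + 1 := rfl
    rw [B.length_verts, hB, List.length_nil] at hlen
    have hc : L'.length + 2 ≤ n := by
      unfold freshCost at hN
      split_ifs at hN <;> omega
    have hg := R.good B (by simp)
    have hall : (M ++ [e] ++ v :: flat L' ++ B.head :: p :: [a, q]).Nodup :=
      nodup_of_count hn fun x => by
        simp [List.count_cons, Block.verts]; omega
    refine wins_append_blocks (L := L') (A := M ++ [e]) (q := v) R.bdd hM
      (fun C hC => R.good C (by simp [hC]))
      (hall.sublist (by simp))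
      (fun C hC b => hv.not_adj _ _) (by omega) fun P₁ h₁ hM₁ => ?_
    obtain ⟨M', e', heq, he'⟩ := endsFresh_blocks (A := M ++ [e]) (L := L') (h₁.fresh.2 hv)
      fun C hC => h₁.goodBlock (R.good C (by simp [hC]))
    have hlM := congrArg List.length heq
    rw [heq] at hM₁ hall
    refine wins_join (R := []) h₁.2.2 hM₁ ⟨by simp, by simp⟩
      (Link.of_fresh (h₁.sat.2 hg.1) he').symm (hall.sublist (by simp)) (by omega)
      fun P₂ h₂ hM₂ => ?_
    refine wins_join (A := M' ++ [e']) (R := [a, q]) h₂.2.2 (by simpa using hM₂)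
      ((h₁.trans h₂).mpath hpaq)
      (Link.of_fresh (h₂.sat.2 (h₁.sat.2 hg.1)) ((h₁.trans h₂).fresh.2 hp)) (by simpa using hall)
      (by omega) fun P₃ h₃ hM₃ => wins_of_path hM₃ ?_
    simp at hlM ⊢; omega
  -- Here `floatCost 1 = 4` may be one round too many, so one block is kept back.
  by_cases hex' : i = 2 * L.length + 4
  · obtain ⟨B, L, rfl⟩ : ∃ B L', L = B :: L' := by
      cases L with
      | nil => simp at hex'; omega
      | cons B L' => exact ⟨B, L', rfl⟩
    have hg := R.good B (by simp)
    have hBl := B.length_verts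
    have hlen : (flat (B :: L)).length = B.verts.length + (flat L).length := by simp
    have hlen' : (B :: L).length = L.length + 1 := rfl
    have hc : L.length + 4 ≤ n := by
      unfold freshCost at hN
      split_ifs at hN <;> omega
    refine wins_append_blocks (L := L) (A := M ++ [e]) (q := v) R.bdd hM
      (fun C hC => R.good C (by simp [hC]))
      (by simpa using hnd (S := v :: flat L) (by simp))
      (fun C hC b => hv.not_adj _ _) (by omega) fun P₁ h₁ hM₁ => ?_
    have hg' := h₁.goodBlock hg
    exact forces_mono (by omega) (wins_spareCapConfig (i := 5) h₁.2.2 hM₁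
      (endsFresh_blocks (h₁.fresh.2 hv) fun C hC => h₁.goodBlock (R.good C (by simp [hC])))
      hg'.2.2 hg'.1 hg'.2.1 (h₁.inc.2 R.inc_right) (h₁.fresh.2 hp) (h₁.fresh.2 hq)
      (h₁.2.1 _ _ hap) (h₁.2.1 _ _ haq)
      (nodup_of_count hn fun x => by simp [List.count_cons, Block.verts]; omega)
      (by simp; omega) (show check spareCapStrategy _ 4 _ = true by decide +kernel))
  · have hc : L.length ≤ n ∧ floatCost (i - 2 * L.length - 3) ≤ n - L.length := by
      unfold freshCost at hN
      unfold floatCost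
      split_ifs at hN ⊢ <;> omega
    refine wins_append_blocks (L := L) (A := M ++ [e]) (q := v) R.bdd hM R.good
      (by simpa using hnd (S := v :: flat L) (by simp))
      (fun C hC b => hv.not_adj _ _) (by omega) fun P₁ h₁ hM₁ => ?_
    exact hK (i - 2 * L.length - 3) (by omega) (by omega) P₁ _ p q [a] _ h₁.2.2 hM₁
      (endsFresh_blocks (h₁.fresh.2 hv) fun C hC => h₁.goodBlock (R.good C hC))
      (h₁.mpath hpaq) (h₁.fresh.2 hp) (h₁.fresh.2 hq)
      (nodup_of_count hn fun x => by simp [List.count_cons]; omega) (by simp; omega) hc.2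

/-- The run ends in a vertex `a` that has two further neighbours in the path colour; the number
of blocks is even. -/
lemma Run.wins_cap {p q : ℕ} (R : Run P M e a L c) (hL : L.length % 2 = 0) (hp : Fresh P p)
    (hq : Fresh P q) (hap : MainAdj P a p) (haq : MainAdj P a q)
    (hn : (M ++ e :: a :: p :: q :: flat L).Nodup) (hi : 5 ≤ i)
    (hD : ∀ j < i, SingleBound l j) (hK : ∀ j < i, 1 ≤ j → FloatBound l j)
    (hm : L.length + 1 ≤ i / 2) (hT : Thin L)
    (hl : l + 2 * L.length ≤ M.length + 1 + i + (flat L).length)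
    (hN : freshCost i ≤ n + 2 * L.length + 3) : Wins l n P := by
  by_cases hex : i = 2 * L.length + 2
  · have hc : L.length + 1 ≤ n := by
      unfold freshCost at hN
      split_ifs at hN <;> omega
    obtain ⟨B, L', rfl, hB⟩ := hT.exists_cons (by omega)
    have hlen : (flat (B :: L')).length = B.verts.length + (flat L').length := by simp
    have hlen' : (B :: L').length = L'.length + 1 := rfl
    rw [B.length_verts, hB, List.length_nil] at hlen
    exact R.wins_cap_finish (by rintro rfl; simp at hL) hp hq hap haq hn (by omega) (by omega)
  · obtain ⟨v, hv, hv'⟩ := exists_fresh R.bdd (M ++ e :: a :: p :: q :: flat L)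
    have hnd : (M ++ e :: a :: p :: q :: v :: flat L).Nodup := by
      refine nodup_of_count (List.nodup_cons.2 ⟨hv', hn⟩) fun x => ?_
      simp [List.count_cons]; omega
    have hev : e ≠ v := by rintro rfl; simp at hv'
    obtain ⟨n, rfl⟩ : ∃ k, n = k + 1 := ⟨n - 1, by
      unfold freshCost at hN
      split_ifs at hN <;> omega⟩
    refine wins_step R.bdd hev (fun b => hv.not_adj' _ _) (fun b P' hb _ hs => ?_)
      fun P' hP' hm' => ?_
    · exact R.wins_cap_side hL hp hq hv hap haq hb hs hnd hi hD (by omega) hl (by omega)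
    · exact (R.mono hP').wins_cap_main hL (hP'.fresh.2 hp) (hP'.fresh.2 hq) (hP'.fresh.2 hv)
        (hP'.2.1 _ _ hap) (hP'.2.1 _ _ haq) hm' hnd hi hK (by omega) hT hl (by omega)

end

/-! ### Winning from a run. -/

section

variable {P : Position 3} {M : List ℕ} {e a h : ℕ} {L : List Block} {c : Bool} {l i n : ℕ}

/-- An open run is closed by a fresh vertex, at the cost of one round. -/
lemma OpenRun.wins_fill (R : OpenRun P M e a h L c)
    (ih : ∀ P' z, Run P' M e a (⟨h, [], z⟩ :: L) c → Wins l n P') : Wins l (n + 1) P := by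
  obtain ⟨z, hz, hzn⟩ := exists_fresh R.bdd (M ++ e :: a :: h :: flat L)
  refine wins_link R.bdd (Link.of_fresh R.sat hz) fun P' hP' hm => ih P' z ?_
  refine (R.mono hP').close (H := []) ⟨by simpa using hm, ?_⟩ (hP'.fresh.2 hz) ?_
  · simp at hzn ⊢
    tauto
  · refine nodup_of_count (List.nodup_cons.2 ⟨hzn, R.nodup⟩) fun x => ?_
    simp [List.count_cons, Block.verts]
    omega

lemma length_flat_cons (B : Block) (L : List Block) :
    (flat (B :: L)).length = B.mid.length + 2 + (flat L).length := by
  simp [Block.length_verts]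

lemma OpenRun.link (R : OpenRun P M e a h L c) (hL : L.length % 2 = 0) : Link P e a := by
  refine ⟨?_, R.ends, fun b => ?_⟩
  · have := (List.nodup_append.1 R.nodup).2.1
    simp at this
    tauto
  · have h1 := R.inc_left
    have h2 := R.inc_right
    rw [show (L.length + 1) % 2 = 1 by omega] at h2
    by_cases hb : b = c
    · exact Or.inl (hb ▸ h1)
    · right
      have : b = (c ^^ decide (1 = 1)) := by cases b <;> cases c <;> simp_all
      rwa [this]

/-- Builder wins from a run of side-coloured edges. -/
lemma Run.wins (hi : 5 ≤ i) (hF : ∀ j < i, FreshBound l j) (hD : ∀ j < i, SingleBound l j)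
    (hK : ∀ j < i, 1 ≤ j → FloatBound l j) (R : Run P M e a L c) (hT : Thin L)
    (hm : L.length ≤ i / 2) (hl : l + 2 * L.length ≤ M.length + 1 + i + (flat L).length)
    (hN : freshCost i ≤ n + 2 * L.length + 1) : Wins l n P := by
  -- Induction on the number of blocks still missing from `i / 2`. The budget credits m blocks with
  -- the `2 * m + 1` rounds spent on them and on the first side edge; vertices beyond two per block
  -- are credited through `flat L`.
  obtain ⟨k, hk⟩ : ∃ k, i / 2 - L.length = k := ⟨_, rfl⟩
  induction k using Nat.strong_induction_on generalizing P M e a L c n with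
  | _ k ih =>
  -- With `i / 2` blocks, the blocks alone suffice if i is even. If i ≡ 3 (mod 4) their number is
  -- odd, so the edge ea is forced and supplies the odd vertex. If i ≡ 1 (mod 4) the ends of the run
  -- share a colour and another move at a is needed.
  by_cases hfin : L.length = i / 2 ∧ i % 4 ≠ 1
  · have hc : (i % 2 = 0 → L.length ≤ n) ∧ (i % 2 = 1 → L.length + 1 ≤ n) := by
      unfold freshCost at hN
      split_ifs at hN <;> omega
    rcases Nat.mod_two_eq_zero_or_one i with h2 | h2
    · exact R.wins_down (by omega) (by omega) (hc.1 h2)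
    · exact wins_up R.bdd R.path (R.link (by omega)) R.good R.nodup (R.right (by omega)) (by omega)
        (hc.2 h2)
  -- The case of a side-coloured answer at a: if all blocks are there, the new end can be joined to
  -- e and the game finishes; otherwise the new inner vertex gets a fresh partner and the induction
  -- continues.
  have hopen : ∀ {P' a' h' n'}, OpenRun P' M e a' h' L c → n = n' + 1 → Wins l n' P' := by
    intro P' a' h' n' R' hn'
    by_cases hlast : L.length = i / 2
    · have hc : L.length + 1 ≤ n' := by
        unfold freshCost at hN
        split_ifs at hN <;> omega
      exact wins_up R'.bdd R'.path (R'.link (by omega)) R'.good (R'.nodup.sublist (by simp))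
        R'.right (by omega) (by omega)
    · obtain ⟨n, rfl⟩ : ∃ n, n' = n + 1 := ⟨n' - 1, by
        unfold freshCost at hN
        split_ifs at hN <;> omega⟩
      refine R'.wins_fill fun P₁ z R₁ => ?_
      refine ih (i / 2 - (L.length + 1)) (by omega) R₁ (Or.inr ⟨_, rfl, rfl⟩) ?_ ?_ ?_ rfl
      · simp; omega
      · rw [length_flat_cons]; simp; omega
      · simp; omega
  obtain ⟨n, rfl⟩ : ∃ n', n = n' + 1 := ⟨n - 1, by
    unfold freshCost at hN
    split_ifs at hN <;> omega⟩
  obtain ⟨p, hp, hpn⟩ := exists_fresh R.bdd (M ++ e :: a :: flat L)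
  have hnd : (M ++ e :: p :: a :: flat L).Nodup :=
    nodup_of_count (List.nodup_cons.2 ⟨hpn, R.nodup⟩) fun x => by
      simp [List.count_cons]; omega
  have hnd' : (M ++ e :: a :: p :: flat L).Nodup :=
    nodup_of_count hnd fun x => by simp [List.count_cons]; omega
  have hap : a ≠ p := by rintro rfl; simp at hpn
  refine wins_step R.bdd hap (fun b => hp.not_adj' _ _)
    (fun b P' hb _ hs => hopen (R.extend hb hp hnd hs) rfl) fun P₁ h₁ hap₁ => ?_
  have R₁ := R.mono h₁
  by_cases hlast : L.length = i / 2
  · have hc : L.length + 1 ≤ n := by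
      unfold freshCost at hN
      split_ifs at hN <;> omega
    obtain ⟨B, L', rfl, hB⟩ := hT.exists_cons (by omega)
    rw [length_flat_cons, hB] at hl
    have hlen' : (B :: L').length = L'.length + 1 := rfl
    simp only [List.length_nil] at hl
    exact R₁.wins_turn (by rintro rfl; simp at hlast; omega) (h₁.fresh.2 hp) hap₁ hnd' (by omega)
      (by omega)
  -- For an even number of blocks the edge ea is not forced, so Builder draws a second edge at a;
  -- for an odd number ea can be drawn now.
  rcases Nat.mod_two_eq_zero_or_one L.length with h2 | h2
  · obtain ⟨n, rfl⟩ : ∃ n', n = n' + 1 := ⟨n - 1, by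
      unfold freshCost at hN
      split_ifs at hN <;> omega⟩
    obtain ⟨q, hq, hqn⟩ := exists_fresh R₁.bdd (M ++ e :: a :: p :: flat L)
    have hnq : (q :: (M ++ e :: a :: p :: flat L)).Nodup := List.nodup_cons.2 ⟨hqn, hnd'⟩
    have haq : a ≠ q := by rintro rfl; simp at hqn
    have hpq : p ≠ q := by rintro rfl; simp at hqn
    have hp₁ := h₁.fresh.2 hp
    refine wins_step R₁.bdd haq (fun b => hq.not_adj' _ _) (fun b P' hb _ hs => ?_)
      fun P₂ h₂ haq₂ => ?_
    -- A side-coloured second answer saturates a, and its neighbour p in the path colour already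
    -- completes the block.
    · refine ih (i / 2 - (L.length + 1)) (by omega) ((R₁.extend hb hq ?_ hs).close (H := []) (z := p)
        (hs.mpath.2 ⟨by simpa using hap₁, by simpa using hap⟩) (hs.fresh hp₁ hap.symm hpq) ?_)
        (Or.inr ⟨_, rfl, rfl⟩) ?_ ?_ ?_ rfl
      · exact nodup_of_count hnq fun x => by simp [List.count_cons]; omega
      · exact nodup_of_count hnq fun x => by simp [List.count_cons, Block.verts]; omega
      · simp; omega
      · rw [length_flat_cons]; simp; omega
      · simp; omega
    · exact (R₁.mono h₂).wins_cap h2 (h₂.fresh.2 hp₁) (h₂.fresh.2 hq) (h₂.2.1 _ _ hap₁) haq₂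
        (nodup_of_count hnq fun x => by simp [List.count_cons]; omega) hi hD hK (by omega) hT hl
        (by omega)
  · exact R₁.wins_odd h2 (h₁.fresh.2 hp) hap₁ hnd' hi hF (by omega) hl (by omega)

end

/-! ### Inductive steps for the three kinds of positions. -/

section

variable {P P' : Position 3} {M Q H : List ℕ} {b c : Bool} {e x y z t u v w l i n : ℕ}

lemma sat_of_inc (hbc : b ≠ c) (h : Inc P b u) (h' : Inc P c u) : Sat P u := by
  intro d
  rcases Bool.eq_or_eq_not d b with rfl | rfl
  · exact h
  · rwa [show (!b) = c by cases b <;> cases c <;> simp_all]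

lemma SideStep.inc_left (hs : SideStep P b u v P') : Inc P' b u :=
  (hs.inc _ _).2 (Or.inr ⟨rfl, Or.inl rfl⟩)

lemma SideStep.inc_right (hs : SideStep P b u v P') : Inc P' b v :=
  (hs.inc _ _).2 (Or.inr ⟨rfl, Or.inr rfl⟩)

lemma SideStep.inc_of (hs : SideStep P b u v P') (h : Inc P c w) : Inc P' c w :=
  (hs.inc _ _).2 (Or.inl h)

lemma SideStep.sat_left (hs : SideStep P b u v P') (hb : ¬ Inc P b u) (h : Inc P c u) :
    Sat P' u :=
  sat_of_inc (by rintro rfl; exact hb h) hs.inc_left (hs.inc_of h)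

lemma mPath_singleton (P : Position 3) (u : ℕ) : MPath P [u] := ⟨by simp, by simp⟩

/-- An isolated vertex is joined to a saturated end of a path. -/
lemma wins_snoc {A : List ℕ} {q : ℕ} (hP : Bdd P) (hA : MPath P (A ++ [q])) (hq : Sat P q)
    (hN : 1 ≤ n) (V : List ℕ) (h : ∀ P' r, MainExt P P' → MPath P' (A ++ [q, r]) → Fresh P' r →
      r ∉ V → Wins l (n - 1) P') : Wins l n P := by
  obtain ⟨r, hr, hrn⟩ := exists_fresh hP (A ++ [q] ++ V)
  simp only [List.mem_append, not_or] at hrn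
  refine wins_join hP hA (mPath_singleton P r) (Link.of_fresh hq hr) ?_ hN
    fun P' hP' hM => h P' r hP' hM (hP'.fresh.2 hr) hrn.2
  have hnd : (r :: (A ++ [q])).Nodup := List.nodup_cons.2 ⟨by simpa using hrn.1, hA.2⟩
  exact nodup_of_count hnd fun x => by simp [List.count_cons]; omega

/-- Builder draws up to two edges from w to new vertices. A side-coloured answer saturates w, so w
can be joined to e; three rounds in all gain two vertices, and the new side neighbour of w replaces
w. If both answers are in the path colour, w is the middle of a floating path with fresh ends. -/
lemma singleBound_step (hi : 5 ≤ i) (hD : SingleBound l (i - 2)) (hK : FloatBound l (i - 2)) :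
    SingleBound l i := by
  rintro P Q b w n hP hQ ⟨M, e, rfl, he⟩ hnd hw hl hN
  have hN' : singleCost (i - 2) + 3 ≤ n ∧ floatCost (i - 2) + 2 ≤ n := by
    unfold singleCost at hN ⊢
    unfold floatCost
    split_ifs at hN ⊢ <;> omega
  obtain ⟨x, hx, hxn⟩ := exists_fresh hP (M ++ [e] ++ [w])
  have hnx := List.nodup_cons.2 ⟨hxn, hnd⟩
  have hwx : w ≠ x := by rintro rfl; simp at hxn
  have hew : e ≠ w := by
    have := (List.nodup_append.1 (List.append_assoc _ _ _ ▸ hnd)).2.1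
    simpa using this
  have hex : e ≠ x := by rintro rfl; simp at hxn
  obtain ⟨n, rfl⟩ : ∃ k, n = k + 2 := ⟨n - 2, by omega⟩
  have hnd' : (M ++ [e, w]).Nodup := by simpa using hnd
  refine wins_step hP hwx (fun b => hx.not_adj' _ _) (fun b' P₁ hb _ hs => ?_) fun P₁ h₁ hm₁ => ?_
  · have he' := hs.fresh he hew hex
    refine wins_join (R := []) hs.2.2 (hs.mpath.2 hQ) (mPath_singleton _ w)
      (Link.of_fresh (hs.sat_left hb hw) he').symm hnd' (by omega) fun P₂ h₂ hM₂ => ?_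
    refine wins_snoc (A := M ++ [e]) h₂.2.2 (by simpa using hM₂) (h₂.sat.2 (hs.sat_left hb hw))
      (by omega) [x] fun P₃ z h₃ hM₃ hz hzn => ?_
    refine hD P₃ _ b' x _ h₃.2.2 hM₃ ⟨M ++ [e, w], z, by simp, hz⟩ ?_
      (h₃.inc.2 (h₂.inc.2 hs.inc_right)) (by simp at hl ⊢; omega) (by omega)
    have := hM₃.2
    refine List.Nodup.append this (by simp) ?_
    simp at hxn hzn ⊢
    tauto
  · obtain ⟨y, hy, hyn⟩ := exists_fresh h₁.2.2 (M ++ [e] ++ [w] ++ [x])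
    have hny : (y :: x :: (M ++ [e] ++ [w])).Nodup :=
      List.nodup_cons.2 ⟨by simp at hyn ⊢; tauto, hnx⟩
    have hwy : w ≠ y := by rintro rfl; simp at hyn
    have hey : e ≠ y := by rintro rfl; simp at hyn
    have hxy : x ≠ y := by rintro rfl; simp at hyn
    refine wins_step h₁.2.2 hwy (fun b => hy.not_adj' _ _) (fun b' P₂ hb _ hs => ?_)
      fun P₂ h₂ hm₂ => ?_
    · have he' := hs.fresh (h₁.fresh.2 he) hew hey
      refine wins_join (R := [x]) hs.2.2 (hs.mpath.2 (h₁.mpath hQ))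
        (hs.mpath.2 ⟨by simpa using hm₁, by simpa using hwx⟩)
        (Link.of_fresh (hs.sat_left hb (h₁.inc.2 hw)) he').symm
        (nodup_of_count hny fun x => by simp [List.count_cons]; omega) (by omega)
        fun P₃ h₃ hM₃ => ?_
      refine hD P₃ _ b' y _ h₃.2.2 hM₃ ⟨M ++ [e, w], x, by simp,
        h₃.fresh.2 (hs.fresh (h₁.fresh.2 hx) hwx.symm hxy)⟩
        (nodup_of_count hny fun x => by simp [List.count_cons]; omega)
        (h₃.inc.2 hs.inc_right) (by simp at hl ⊢; omega) (by omega)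
    · refine hK P₂ (M ++ [e]) x y [w] n h₂.2.2 (h₂.mpath (h₁.mpath hQ))
        ⟨M, e, rfl, h₂.fresh.2 (h₁.fresh.2 he)⟩
        ⟨by simpa using ⟨(h₂.2.1 _ _ hm₁).symm, hm₂⟩, ?_⟩ (h₂.fresh.2 (h₁.fresh.2 hx))
        (h₂.fresh.2 hy) (nodup_of_count hny fun x => by simp [List.count_cons]; omega)
        (by simp at hl ⊢; omega) (by omega)
      exact nodup_of_count hny fun x => by simp [List.count_cons]; omega

/-- An edge from e to a new vertex is either a gain of one vertex in one round or a run without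
blocks. -/
lemma freshBound_step (hi : 5 ≤ i) (hF : ∀ j < i, FreshBound l j) (hD : ∀ j < i, SingleBound l j)
    (hK : ∀ j < i, 1 ≤ j → FloatBound l j) : FreshBound l i := by
  rintro P Q n hP hQ ⟨M, e, rfl, he⟩ hl hN
  have hN' : freshCost (i - 1) + 1 ≤ n := by
    unfold freshCost at hN ⊢
    split_ifs at hN ⊢ <;> omega
  obtain ⟨n, rfl⟩ : ∃ k, n = k + 1 := ⟨n - 1, by omega⟩
  obtain ⟨y, hy, hyn⟩ := exists_fresh hP (M ++ [e])
  have hny : (M ++ e :: y :: flat []).Nodup :=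
    nodup_of_count (List.nodup_cons.2 ⟨hyn, hQ.2⟩) fun x => by simp [List.count_cons]; omega
  have hey : e ≠ y := by rintro rfl; simp at hyn
  refine wins_step hP hey (fun b => hy.not_adj' _ _) (fun c P₁ _ _ hs => ?_) fun P₁ h₁ hm₁ => ?_
  · have R : Run P₁ M e y [] c := ⟨hs.2.2, hs.mpath.2 hQ, hs.inc_left, by simpa using hs.inc_right,
      by simp, hny, by simp, by simp, by simp⟩
    exact R.wins hi hF hD hK (Or.inl (by simp)) (by simp) (by simp at hl ⊢; omega) (by simpa using hN)
  · refine hF (i - 1) (by omega) P₁ (M ++ [e] ++ [y]) n h₁.2.2 ⟨?_, by simpa using hny⟩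
      ⟨_, y, rfl, h₁.fresh.2 hy⟩ (by simp at hl ⊢; omega) (by omega)
    simpa using isChain_glue (B := [y]) (h₁.mpath hQ).1 (by simpa using hm₁)

/-- The edges et and yv are forced, so the path reaches v through t and y. A further edge vp
decides: a side colour saturates v, which then takes in the floating path and leaves p as the extra
vertex; the path colour makes p a fresh end while the floating path stays. -/
lemma wins_float_saturated (hP : Bdd P) (hM : MPath P (M ++ [e])) (he : Sat P e)
    (hy : Inc P c y) (hv : Inc P b v) (hbc : b ≠ c) (hyv : ∀ d, ¬ SideAdj P d y v)
    (ht : Fresh P t) (hyt : MainAdj P y t) (hH : MPath P (x :: (H ++ [z]))) (hx : Fresh P x)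
    (hz : Fresh P z) (hn : (M ++ e :: t :: y :: v :: x :: (H ++ [z])).Nodup)
    (hl : l ≤ M.length + 1 + (i + 1) + H.length) (hi : 7 ≤ i) (hN : floatCost i ≤ n + 3)
    (hD : SingleBound l (i - 4)) (hK : FloatBound l (i - 4)) : Wins l n P := by
  have hN' : singleCost (i - 4) + 4 ≤ n ∧ floatCost (i - 4) + 3 ≤ n := by
    unfold floatCost at hN ⊢
    unfold singleCost
    split_ifs at hN ⊢ <;> omega
  obtain ⟨n, rfl⟩ : ∃ k, n = k + 1 + 2 := ⟨n - 3, by omega⟩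
  have hsub : ∀ {S : List ℕ}, S.Sublist (t :: y :: v :: x :: (H ++ [z])) →
      (M ++ e :: S).Nodup := fun h =>
    hn.sublist ((List.Sublist.refl _).append (h.cons_cons _))
  have hnt := (List.nodup_append.1 (hsub (S := [t, y, v]) (by simp))).2.1
  have hty : MPath P [t, y] := ⟨by simpa using hyt.symm, hnt.sublist (by simp)⟩
  refine wins_join hP hM hty (Link.of_fresh he ht) (hsub (by simp)) (by omega) fun P₁ h₁ hM₁ => ?_
  have hlink : Link P y v := ⟨by simp at hnt; tauto, hyv, fun d => by
    by_cases h : d = b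
    · exact Or.inr (h ▸ hv)
    · left
      rwa [show d = c by cases b <;> cases c <;> cases d <;> simp_all]⟩
  refine wins_join (A := M ++ [e, t]) (R := []) h₁.2.2 (by simpa using hM₁)
    (mPath_singleton _ v) (h₁.link hlink) (by simpa using hsub (S := [t, y, v]) (by simp))
    (by omega) fun P₂ h₂ hM₂ => ?_
  have h₃ := h₁.trans h₂
  obtain ⟨p, hp, hpn⟩ := exists_fresh h₂.2.2 (M ++ e :: t :: y :: v :: x :: (H ++ [z]))
  have hnp := List.nodup_cons.2 ⟨hpn, hn⟩
  have hvp : v ≠ p := by rintro rfl; simp at hpn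
  have hxvp : (x ≠ v ∧ x ≠ p) ∧ z ≠ v ∧ z ≠ p := by
    have := (List.nodup_append.1 hn).2.1
    simp at this hpn
    refine ⟨⟨?_, ?_⟩, ?_, ?_⟩ <;> rintro rfl <;> tauto
  refine wins_step (n := n) h₂.2.2 hvp (fun b => hp.not_adj' _ _) (fun d P₃ hd _ hs => ?_)
    fun P₃ h₄ hm₄ => ?_
  · have hx' := hs.fresh (h₃.fresh.2 hx) hxvp.1.1 hxvp.1.2
    have hz' := hs.fresh (h₃.fresh.2 hz) hxvp.2.1 hxvp.2.2
    refine wins_join (A := M ++ [e, t, y]) hs.2.2 (hs.mpath.2 (by simpa using hM₂))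
      (hs.mpath.2 (h₃.mpath hH)) (Link.of_fresh (hs.sat_left hd (h₃.inc.2 hv)) hx')
      (by simpa using hn) (by omega) fun P₄ h₄ hM₄ => ?_
    refine hD P₄ _ d p _ h₄.2.2 hM₄ ⟨M ++ e :: t :: y :: v :: x :: H, z, by simp, h₄.fresh.2 hz'⟩
      (nodup_of_count hnp fun x => by simp [List.count_cons]; omega)
      (h₄.inc.2 hs.inc_right) (by simp at hl ⊢; omega) (by omega)
  · refine hK P₃ (M ++ [e, t, y] ++ [v] ++ [p]) x z H n h₄.2.2
      ⟨?_, nodup_of_count hnp fun x => by simp [List.count_cons]; omega⟩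
      ⟨_, p, rfl, h₄.fresh.2 hp⟩
      (h₄.mpath (h₃.mpath hH)) (h₄.fresh.2 (h₃.fresh.2 hx)) (h₄.fresh.2 (h₃.fresh.2 hz))
      (nodup_of_count hnp fun x => by simp [List.count_cons]; omega) (by simp at hl ⊢; omega)
      (by omega)
    have hM₃ := h₄.mpath hM₂
    have := isChain_glue (A := M ++ [e, t, y]) (B := [p]) (by simpa using hM₃.1) (by simpa using hm₄)
    simpa using this

/-- Builder draws yx. In the path colour it merges t, y and the floating path into one. In a side
colour it saturates y, so that the main path continues through y to t, and x meets a side colour. An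
edge from x to a new vertex q then either saturates x, so that the floating path can be attached, or
lengthens the floating path by q. -/
lemma wins_float_extended (hP : Bdd P) (hM : MPath P (M ++ [e] ++ [v])) (hv : Fresh P v)
    (hy : Inc P c y) (ht : Fresh P t) (hyt : MainAdj P y t) (hH : MPath P (x :: (H ++ [z])))
    (hx : Fresh P x) (hz : Fresh P z) (hn : (M ++ e :: v :: y :: t :: x :: (H ++ [z])).Nodup)
    (hl : l ≤ M.length + 1 + (i + 1) + H.length) (hi : 7 ≤ i) (hN : floatCost i ≤ n + 3)
    (hD : SingleBound l (i - 4)) (hK : FloatBound l (i - 4)) (hK' : FloatBound l (i - 3)) :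
    Wins l n P := by
  have hN' : singleCost (i - 4) + 4 ≤ n ∧ floatCost (i - 4) + 3 ≤ n ∧
      floatCost (i - 3) + 1 ≤ n := by
    unfold floatCost at hN ⊢
    unfold singleCost
    split_ifs at hN ⊢ <;> omega
  obtain ⟨n, rfl⟩ : ∃ k, n = k + 1 := ⟨n - 1, by omega⟩
  have hsub : ∀ {S : List ℕ}, S.Sublist (v :: y :: t :: x :: (H ++ [z])) →
      (M ++ e :: S).Nodup := fun h =>
    hn.sublist ((List.Sublist.refl _).append (h.cons_cons _))
  have hnd := (List.nodup_append.1 hn).2.1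
  have hne : y ≠ x ∧ v ≠ y ∧ v ≠ x ∧ t ≠ y ∧ t ≠ x ∧ z ≠ y ∧ z ≠ x := by
    simp at hnd
    refine ⟨?_, ?_, ?_, ?_, ?_, ?_, ?_⟩ <;> rintro rfl <;> tauto
  refine wins_step hP hne.1 (fun b => hx.not_adj' _ _) (fun d P₁ hd _ hs => ?_)
    fun P₁ h₁ hm₁ => ?_
  · have hyt' : MPath P₁ [y, t] := hs.mpath.2 ⟨by simpa using hyt, hnd.sublist (by simp)⟩
    have hv' := hs.fresh hv hne.2.1 hne.2.2.1
    have ht' := hs.fresh ht hne.2.2.2.1 hne.2.2.2.2.1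
    have hz' := hs.fresh hz hne.2.2.2.2.2.1 hne.2.2.2.2.2.2
    refine wins_join (A := M ++ [e]) hs.2.2 (hs.mpath.2 hM) hyt'
      (Link.of_fresh (hs.sat_left hd hy) hv').symm
      (by simpa using hsub (S := [v, y, t]) (by simp)) (by omega) fun P₂ h₂ hM₂ => ?_
    obtain ⟨q, hq, hqn⟩ := exists_fresh h₂.2.2 (M ++ e :: v :: y :: t :: x :: (H ++ [z]))
    have hnq := List.nodup_cons.2 ⟨hqn, hn⟩
    have hxq : x ≠ q := by rintro rfl; simp at hqn
    have htq : t ≠ q := by rintro rfl; simp at hqn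
    have hzq : z ≠ q := by rintro rfl; simp at hqn
    obtain ⟨n, rfl⟩ : ∃ k, n = k + 1 + 1 := ⟨n - 2, by omega⟩
    refine wins_step (n := n) h₂.2.2 hxq (fun b => hq.not_adj' _ _) (fun d' P₃ hd' _ hs' => ?_)
      fun P₃ h₃ hm₃ => ?_
    · have ht₃ := hs'.fresh (h₂.fresh.2 ht') hne.2.2.2.2.1 htq
      have hz₃ := hs'.fresh (h₂.fresh.2 hz') hne.2.2.2.2.2.2 hzq
      refine wins_join (A := M ++ [e, v, y]) (q := t) hs'.2.2 (hs'.mpath.2 (by simpa using hM₂))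
        (hs'.mpath.2 (h₂.mpath (hs.mpath.2 hH)))
        (Link.of_fresh (hs'.sat_left hd' (h₂.inc.2 hs.inc_right)) ht₃).symm
        (by simpa using hn) (by omega) fun P₄ h₄ hM₄ => ?_
      exact hD P₄ _ d' q _ h₄.2.2 hM₄
        ⟨M ++ e :: v :: y :: t :: x :: H, z, by simp, h₄.fresh.2 hz₃⟩
        (nodup_of_count hnq fun x => by simp [List.count_cons]; omega)
        (h₄.inc.2 hs'.inc_right) (by simp at hl ⊢; omega) (by omega)
    · refine hK P₃ (M ++ [e, v, y] ++ [t]) q z (x :: H) n h₃.2.2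
        (by simpa using h₃.mpath hM₂) ⟨_, t, rfl, h₃.fresh.2 (h₂.fresh.2 ht')⟩
        ⟨?_, nodup_of_count hnq fun x => by simp [List.count_cons]; omega⟩
        (h₃.fresh.2 hq) (h₃.fresh.2 (h₂.fresh.2 hz'))
        (nodup_of_count hnq fun x => by simp [List.count_cons]; omega) (by simp at hl ⊢; omega)
        (by omega)
      exact List.isChain_cons_cons.2 ⟨hm₃.symm, (h₃.mpath (h₂.mpath (hs.mpath.2 hH))).1⟩
  · refine hK' P₁ _ t z (y :: x :: H) n h₁.2.2 (h₁.mpath hM) ⟨_, v, rfl, h₁.fresh.2 hv⟩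
      ⟨?_, nodup_of_count hn fun x => by simp [List.count_cons]; omega⟩
      (h₁.fresh.2 ht) (h₁.fresh.2 hz)
      (nodup_of_count hn fun x => by simp [List.count_cons]; omega) (by simp at hl ⊢; omega)
      (by omega)
    exact List.isChain_cons_cons.2 ⟨(h₁.2.1 _ _ hyt).symm,
      List.isChain_cons_cons.2 ⟨hm₁, (h₁.mpath hH).1⟩⟩

/-- Two side-coloured answers, at ey and then at yt, saturate y. Joining y to the floating path then
yields a block with a long interior for the same price as a two-vertex block, and the run argument
applies. If yt gets the path colour, the answer to a further edge at e separates the last two cases.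
-/
lemma floatBound_step (hi : 5 ≤ i) (hF : ∀ j < i, FreshBound l j) (hD : ∀ j < i, SingleBound l j)
    (hK : ∀ j < i, 1 ≤ j → FloatBound l j) : FloatBound l i := by
  rintro P Q x z H n hP hQ ⟨M, e, rfl, he⟩ hH hx hz hn hl hN
  have hN' : floatCost (i - 1) + 1 ≤ n ∧ freshCost i ≤ n ∧ 3 ≤ n ∧ (i = 5 → 9 ≤ n) ∧
      (i = 6 → 10 ≤ n) := by
    unfold floatCost at hN ⊢
    unfold freshCost
    split_ifs at hN ⊢ <;> omega
  obtain ⟨n, rfl⟩ : ∃ k, n = k + 3 := ⟨n - 3, by omega⟩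
  obtain ⟨y, hy, hyn⟩ := exists_fresh hP (M ++ [e] ++ x :: (H ++ [z]))
  have hny := List.nodup_cons.2 ⟨hyn, hn⟩
  have hne : e ≠ y ∧ x ≠ y ∧ z ≠ y ∧ x ≠ e ∧ z ≠ e := by
    have := (List.nodup_append.1 (List.append_assoc _ _ _ ▸ hn)).2.1
    simp at this hyn
    refine ⟨?_, ?_, ?_, ?_, ?_⟩ <;> rintro rfl <;> tauto
  refine wins_step hP hne.1 (fun b => hy.not_adj' _ _) (fun c P₁ _ _ hs => ?_) fun P₁ h₁ hm₁ => ?_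
  · have R : Run P₁ M e y [] c := ⟨hs.2.2, hs.mpath.2 hQ, hs.inc_left, by simpa using hs.inc_right,
      by simp, nodup_of_count hny fun x => by simp [List.count_cons]; omega, by simp, by simp,
      by simp⟩
    have hH₁ := hs.mpath.2 hH
    have hx₁ := hs.fresh hx hne.2.2.2.1 hne.2.1
    have hz₁ := hs.fresh hz hne.2.2.2.2 hne.2.2.1
    obtain ⟨t, ht, htn⟩ := exists_fresh hs.2.2 (y :: (M ++ [e] ++ x :: (H ++ [z])))
    have hnt := List.nodup_cons.2 ⟨htn, hny⟩
    have hne' : y ≠ t ∧ x ≠ t ∧ z ≠ t ∧ e ≠ t := by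
      simp at htn
      refine ⟨?_, ?_, ?_, ?_⟩ <;> rintro rfl <;> tauto
    refine wins_step hs.2.2 hne'.1 (fun b => ht.not_adj' _ _) (fun b P₂ hb _ hs' => ?_)
      fun P₂ h₂ hm₂ => ?_
    · have R' := R.extend hb ht (nodup_of_count hnt fun x => by simp [List.count_cons]; omega) hs'
      refine wins_join (A := []) hs'.2.2 (mPath_singleton _ y) (hs'.mpath.2 hH₁)
        (Link.of_fresh R'.sat (hs'.fresh hx₁ hne.2.1 hne'.2.1))
        (nodup_of_count hny fun x => by simp [List.count_cons]; omega) (by omega)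
        fun P₃ h₃ hM₃ => ?_
      refine ((R'.mono h₃).close (H := x :: H) (z := z) (by simpa using hM₃)
        (h₃.fresh.2 (hs'.fresh hz₁ hne.2.2.1 hne'.2.2.1))
        (nodup_of_count hnt fun x => by simp [List.count_cons, Block.verts]; omega)).wins
        hi hF hD hK (Or.inl (by simp)) (by simp; omega) ?_ (by simp; omega)
      rw [length_flat_cons]; simp at hl ⊢; omega
    · have hH₂ := h₂.mpath hH₁
      have hx₂ := h₂.fresh.2 hx₁
      have hz₂ := h₂.fresh.2 hz₁
      have hM₂ := h₂.mpath (hs.mpath.2 hQ)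
      have hnt' : (M ++ e :: y :: t :: x :: (H ++ [z])).Nodup :=
        nodup_of_count hnt fun x => by simp [List.count_cons]; omega
      -- For i = 5 and 6 the general argument would end at parameters 1 and 2, where `singleCost`
      -- and `floatCost` are above the linear trend; explicit strategies replace it.
      by_cases h5 : i = 5
      · subst h5
        exact forces_mono (by omega) (wins_stemConfig h₂.2.2 hM₂ (h₂.inc.2 hs.inc_left) hH₂ hx₂ hz₂
          (h₂.inc.2 hs.inc_right) (h₂.fresh.2 ht) hm₂ hnt' (by simpa using hl)
          (show check stemStrategy5 _ 7 6 = true by decide +kernel))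
      by_cases h6 : i = 6
      · subst h6
        exact forces_mono (by omega) (wins_stemConfig h₂.2.2 hM₂ (h₂.inc.2 hs.inc_left) hH₂ hx₂ hz₂
          (h₂.inc.2 hs.inc_right) (h₂.fresh.2 ht) hm₂ hnt' (by simpa using hl)
          (show check stemStrategy6 _ 8 7 = true by decide +kernel))
      obtain ⟨v, hv, hvn⟩ := exists_fresh h₂.2.2 (M ++ e :: y :: t :: x :: (H ++ [z]))
      have hnv := List.nodup_cons.2 ⟨hvn, hnt'⟩
      have hne₂ : e ≠ v ∧ y ≠ v ∧ t ≠ v ∧ x ≠ v ∧ z ≠ v := by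
        simp at hvn
        refine ⟨?_, ?_, ?_, ?_, ?_⟩ <;> rintro rfl <;> tauto
      refine wins_step h₂.2.2 hne₂.1 (fun b => hv.not_adj' _ _) (fun b P₃ hb _ hs' => ?_)
        fun P₃ h₃ hm₃ => ?_
      · refine wins_float_saturated (c := c) (b := b) (y := y) (t := t) (v := v) hs'.2.2
          (hs'.mpath.2 hM₂) (hs'.sat_left hb (h₂.inc.2 hs.inc_left))
          (hs'.inc_of (h₂.inc.2 hs.inc_right)) hs'.inc_right ?_ ?_
          (hs'.fresh (h₂.fresh.2 ht) hne'.2.2.2.symm hne₂.2.2.1) ((hs'.2.1 _ _).2 hm₂)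
          (hs'.mpath.2 hH₂) (hs'.fresh hx₂ hne.2.2.2.1 hne₂.2.2.2.1)
          (hs'.fresh hz₂ hne.2.2.2.2 hne₂.2.2.2.2)
          (nodup_of_count hnv fun x => by simp [List.count_cons]; omega)
          (by simpa using hl) (by omega) hN (hD _ (by omega)) (hK _ (by omega) (by omega))
        · rintro rfl; exact hb (h₂.inc.2 hs.inc_left)
        · exact hs'.not_adj (fun d => hv.not_adj' _ _) (fun h => hne.1 h.1.symm)
            (fun h => hne₂.2.1 h.1)
      · refine wins_float_extended (M := M) (e := e) (c := c) (y := y) (t := t) (v := v) h₃.2.2 ⟨?_, ?_⟩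
          (h₃.fresh.2 hv)
          (h₃.inc.2 (h₂.inc.2 hs.inc_right)) (h₃.fresh.2 (h₂.fresh.2 ht)) (h₃.2.1 _ _ hm₂)
          (h₃.mpath hH₂) (h₃.fresh.2 hx₂) (h₃.fresh.2 hz₂)
          (nodup_of_count hnv fun x => by simp [List.count_cons]; omega)
          (by simpa using hl) (by omega) hN (hD _ (by omega)) (hK _ (by omega) (by omega))
          (hK _ (by omega) (by omega))
        · simpa using isChain_glue (B := [v]) (h₃.mpath hM₂).1 (by simpa using hm₃)
        · exact nodup_of_count hnv fun x => by simp [List.count_cons]; omega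
  · refine hK (i - 1) (by omega) (by omega) P₁ (M ++ [e] ++ [y]) x z H _ h₁.2.2
      ⟨?_, nodup_of_count hny fun x => by simp [List.count_cons]; omega⟩
      ⟨_, y, rfl, h₁.fresh.2 hy⟩ (h₁.mpath hH) (h₁.fresh.2 hx) (h₁.fresh.2 hz)
      (nodup_of_count hny fun x => by simp [List.count_cons]; omega)
      (by simp at hl ⊢; omega) (by omega)
    simpa using isChain_glue (B := [y]) (h₁.mpath hQ).1 (by simpa using hm₁)

end

/-! ### The upper bound. -/

lemma freshBound_of_le_four {l i : ℕ} (hi : i ≤ 4) : FreshBound l i := by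
  intro P Q n hP hQ he hl hN
  unfold freshCost at hN
  refine wins_fresh_of_le_four hP hQ he hi hl ?_ ?_ <;> split_ifs at hN <;> omega

lemma singleBound_of_le_four {l i : ℕ} (hi : i ≤ 4) : SingleBound l i := by
  intro P Q b w n hP hQ he hn hw hl hN
  unfold singleCost at hN
  refine wins_single_of_le_four hP hQ he hn hw hi hl ?_
  split_ifs at hN <;> omega

lemma floatBound_of_le_four {l i : ℕ} (hi : 1 ≤ i) (hi' : i ≤ 4) : FloatBound l i := by
  intro P Q x z H n hP hQ he hH hx hz hn hl hN
  unfold floatCost at hN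
  refine wins_float_of_le_four hP hQ he hH hx hn hi hi' hl ?_
  split_ifs at hN <;> omega

/-- Each of the three inductive steps falls back on other kinds of positions with smaller
parameters, so they are run as one strong induction. -/
lemma bounds (l i : ℕ) : FreshBound l i ∧ SingleBound l i ∧ (1 ≤ i → FloatBound l i) := by
  induction i using Nat.strong_induction_on with
  | _ i ih =>
  by_cases hi : i ≤ 4
  · exact ⟨freshBound_of_le_four hi, singleBound_of_le_four hi,
      fun h => floatBound_of_le_four h hi⟩
  · have hi' : 5 ≤ i := by omega
    have hF : ∀ j < i, FreshBound l j := fun j hj => (ih j hj).1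
    have hD : ∀ j < i, SingleBound l j := fun j hj => (ih j hj).2.1
    have hK : ∀ j < i, 1 ≤ j → FloatBound l j := fun j hj => (ih j hj).2.2
    exact ⟨freshBound_step hi' hF hD hK,
      singleBound_step hi' (hD _ (by omega)) (hK _ (by omega) (by omega)),
      fun _ => floatBound_step hi' hF hD hK⟩

lemma bdd_empty : Bdd (emptyPosition 3) := ⟨0, fun _ _ _ h => h.elim⟩

lemma fresh_empty (u : ℕ) : Fresh (emptyPosition 3) u := fun _ ⟨_, h⟩ => h.elim

/-- By drawing a star with centre `u`, Builder forces a path on three vertices; `S` contains the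
side colours that are still missing at `u`. -/
lemma wins_star {u : ℕ} : ∀ (n : ℕ) {P : Position 3} {A : List ℕ} {S : Finset Bool}, Bdd P →
    MPath P (A ++ [u]) → A.length ≤ 1 → (∀ b ∉ S, Inc P b u) → S.card + 2 ≤ n + A.length →
    Wins 3 n P
  | 0, P, A, S, _, _, hA, _, hS => by omega
  | n + 1, P, A, S, hP, hM, hA, hI, hS => by
    obtain ⟨x, hx, hxn⟩ := exists_fresh hP (A ++ [u])
    have hux : u ≠ x := by rintro rfl; simp at hxn
    refine wins_step hP hux (fun b => hx.not_adj' _ _) (fun b P' hb _ hs => ?_) fun P' hP' hm => ?_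
    · have hbS : b ∈ S := by
        by_contra h
        exact hb (hI b h)
      have hcard := Finset.card_erase_of_mem hbS
      have hpos : 0 < S.card := Finset.card_pos.2 ⟨b, hbS⟩
      refine wins_star n (S := S.erase b) hs.2.2 (hs.mpath.2 hM) hA (fun d hd => ?_) (by omega)
      by_cases hdb : d = b
      · exact hdb ▸ hs.inc_left
      · exact hs.inc_of (hI d fun h => hd (Finset.mem_erase.2 ⟨hdb, h⟩))
    · match A, hA with
      | [], _ =>
        refine wins_star n (A := [x]) (S := S) hP'.2.2 ⟨by simpa using hm.symm, by simpa using hux.symm⟩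
          (by simp) (fun b hb => hP'.inc.2 (hI b hb)) (by simpa using hS)
      | [y], _ =>
        refine wins_of_path (M := [y, u, x]) ⟨?_, ?_⟩ (by simp)
        · have := (hP'.mpath hM).1
          simp at this ⊢
          exact ⟨this, hm⟩
        · have := hM.2
          simp at this hxn ⊢
          tauto

/-- Builder wins within the claimed number of rounds. -/
theorem wins_empty {l : ℕ} (hl : 2 ≤ l) :
    Wins l (if l % 4 = 0 ∧ 8 ≤ l then 3 * l / 2 - 1 else 3 * l / 2) (emptyPosition 3) := by
  -- `freshCost 2 = 5` is one more than the value 4 needed here, so a star is used instead.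
  by_cases h3 : l = 3
  · subst h3
    exact wins_star (u := 0) (A := []) (S := Finset.univ) 4 bdd_empty (mPath_singleton _ 0)
      (by simp) (by simp) (by simp)
  -- A single vertex is a path with a fresh end and l - 1 vertices missing; for l ≠ 3 the claimed
  -- value is at least `freshCost (l - 1)`.
  · refine (bounds l (l - 1)).1 _ [0] _ bdd_empty (mPath_singleton _ 0) ⟨[], 0, rfl, fresh_empty 0⟩
      (by simp; omega) ?_
    unfold freshCost
    split_ifs <;> omega

theorem theorem1 (l : ℕ) (hl : 2 ≤ l) :
    onlineRamsey ![pathP 3, pathP 3, pathP l] =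
      ((if l % 4 = 0 ∧ 8 ≤ l then 3 * l / 2 - 1 else 3 * l / 2 : ℕ) : ℕ∞) :=
  le_antisymm (iInf₂_le (f := fun (n : ℕ) _ => (n : ℕ∞)) _ (wins_empty hl)) (le_iInf₂ fun _ h => Nat.cast_le.2 (rounds_ge hl h))
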